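/- **Theorem 2.2.** Let $U\subset\mathbb R^n$ be open with $0\in U$ and consider $$\dot{\mathbf u}=A(\mu)\mathbf u+G(\mathbf u),\qquad \mathbf u\in U,\ \mu\in\mathbb R, \tag{1}$$ where the real $n\times n$ matrix $A(\mu)$ and the real function $\omega(\mu)$ are continuously differentiable near $\mu=0$ and $\omega(0)\neq0$. Assume that $\mu\pm\mathrm i\,\omega(\mu)$ are eigenvalues of $A(\mu)$ for all $\mu$ near $0$, that $\pm\mathrm i\,\omega(0)$ are simple eigenvalues of $A(0)$, and that all other eigenvalues of $A(0)$ have non-zero real part. Assume that $G$ is locally Lipschitz continuous on $U$, that $G(\mathbf u)=\mathcal O(|\mathbf u|^2)$ as $\mathbf u\to0$, and that the Lipschitz constant of $G$ on the ball $\{|\mathbf u|<\rho\}$ tends to $0$ as $\rho\to0$. Let $q\in\mathbb C^n\setminus\{0\}$ with $A(0)q=\mathrm i\,\omega(0)q$, and let $E^{\mathrm c}=\{\operatorname{Re}(zq): z\in\mathbb C\}$ be the center eigenspace of $A(0)$, identified with $\mathbb C$ through $z\mapsto\operatorname{Re}(zq)$. Then there are an open neighbourhood $V\subset U$ of $0$,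 numbers $\mu_0,a_0>0$, functions $\mu,\tilde\omega:[0,a_0)\to\mathbb R$ with $\mu(0)=0$, $\tilde\omega(0)=\omega(0)$, and functions $\mathbf u_{\rm per}(\cdot\,;a):\mathbb R\to V$, $0\le a<a_0$, such that: 1. For every $a\in[0,a_0)$: $|\mu(a)|<\mu_0$, $\tilde\omega(a)\ne0$, and $\mathbf u_{\rm per}(\cdot\,;a)$ is a solution of (1) at $\mu=\mu(a)$ with period $2\pi/\tilde\omega(a)$. Moreover $\mathbf u_{\rm per}(\cdot\,;0)\equiv0$, and $\mathbf u_{\rm per}(\cdot\,;a)$ has no zero if $a>0$. 2. (Local uniqueness.) If $|m|<\mu_0$ and $\mathbf w:\mathbb R\to V$ is a periodic solution of (1) at $\mu=m$ that is not identically zero, then there are $a\in(0,a_0)$ and $\tau\in\mathbb R$ with $\mu(a)=m$ and $\mathbf w(t)=\mathbf u_{\rm per}(t+\tau;a)$ for all $t\in\mathbb R$. 3. (Lipschitz continuity.) The family $\mathbf u_{\rm per}(t;a)$ is Lipschitz continuous in $a\in[0,a_0)$, uniformly for $t$ in bounded intervals. The functions $\mu$ and $\tilde\omega$ are continuous on $[0,a_0)$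 and locally Lipschitz continuous on $(0,a_0)$, and $|\mu(a)|+|\tilde\omega(a)-\omega(0)|=\mathcal O(a)$. If the Lipschitz constant of $G$ on the ball of radius $r$ about $0$ is $\mathcal O(r)$ as $r\to0$, then $\mu$ and $\tilde\omega$ are Lipschitz continuous on $[0,a_0)$. 4. (Leading order.) For every linear projection $P$ of $\mathbb R^n$ onto $E^{\mathrm c}$, in particular for the spectral projection, $$P\,\mathbf u_{\rm per}(t;a)=\operatorname{Re}\!\left(a\,\mathrm e^{\mathrm i\tilde\omega(a)t}\,q\right)+o(a)\quad(a\to0),\ \text{uniformly in }t\in\mathbb R .$$ 5. There is a constant $C$ with $\operatorname{dist}(\mathbf u_{\rm per}(t;a),E^{\mathrm c})\le C a^2$ for all $a\in[0,a_0)$ and $t\in\mathbb R$. -/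

import Mathlib

open Filter Topology Set
open scoped NNReal

namespace HopfLipschitz

/-- The state space `ℝⁿ` with the Euclidean norm. -/
abbrev State (n : ℕ) : Type := EuclideanSpace ℝ (Fin n)

/-- The complexification of a real square matrix. -/
noncomputable def complexify {n : ℕ} (B : Matrix (Fin n) (Fin n) ℝ) :
    Matrix (Fin n) (Fin n) ℂ :=
  B.map (fun x : ℝ => (x : ℂ))

/-- The componentwise real part `ℂⁿ → ℝⁿ`, as a real-linear map. -/
noncomputable def reVec (n : ℕ) : (Fin n → ℂ) →ₗ[ℝ] State n where
  toFun q := WithLp.toLp 2 (fun i => (q i).re)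
  map_add' p q := by
    ext i
    simp
  map_smul' c q := by
    ext i
    simp

/-- The real eigenspace of `B` belonging to the pair of eigenvalues `± i w`: the real parts
(equivalently, the real span of the real and imaginary parts) of the complex eigenvectors of
`B` for the eigenvalue `i w`. -/
noncomputable def centerEigenspace {n : ℕ} (B : Matrix (Fin n) (Fin n) ℝ) (w : ℝ) :
    Submodule ℝ (State n) :=
  ((Module.End.eigenspace (Matrix.toLin' (complexify B)) ((w : ℂ) * Complex.I)).restrictScalars
    ℝ).map (reVec n)

/-- `x` is a solution, defined for all times, of the autonomous system `x' = B x + G x`. -/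
def IsSolution {n : ℕ} (B : Matrix (Fin n) (Fin n) ℝ) (G : State n → State n)
    (x : ℝ → State n) : Prop :=
  ∀ t : ℝ, HasDerivAt x (Matrix.toEuclideanLin B (x t) + G (x t)) t

/-- `x` has some positive period. -/
def IsPeriodic {n : ℕ} (x : ℝ → State n) : Prop :=
  ∃ T : ℝ, 0 < T ∧ Function.Periodic x T

/-- The Lipschitz constant of `G` on the ball of radius `ρ` about the origin tends to zero
as `ρ → 0`. -/
def VanishingLipschitzConstant {n : ℕ} (G : State n → State n) : Prop :=
  ∀ ε : ℝ, 0 < ε → ∃ ρ : ℝ, 0 < ρ ∧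
    ∀ x y : State n, ‖x‖ < ρ → ‖y‖ < ρ → ‖G x - G y‖ ≤ ε * ‖x - y‖

/-- The Lipschitz constant of `G` on the ball of radius `r` about the origin is `O(r)`
as `r → 0`. -/
def LinearLipschitzConstant {n : ℕ} (G : State n → State n) : Prop :=
  ∃ C ρ : ℝ, 0 < ρ ∧ ∀ r : ℝ, r < ρ →
    ∀ x y : State n, ‖x‖ ≤ r → ‖y‖ ≤ r → ‖G x - G y‖ ≤ C * r * ‖x - y‖

end HopfLipschitz

/-! Blow up and freeze the period. Writing u(t) = a v(t/(1+ν)) turns (1) into v' = (1+ν)(A(μ)v +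
a⁻¹G(av)), to be solved for a function v of the fixed period T₀ = 2π/|ω(0)| together with two real
numbers μ, ν. With z the complex center coordinate, given by a left eigenvector of A(0), the
condition z(v(0)) = 1 fixes amplitude and phase. At a = 0 the nonlinearity drops out, and the linear
center motion with μ = ν = 0 is a solution.

Existence. The map x ↦ a⁻¹G(ax) has the same Lipschitz constant as G, which is small once G is
replaced by a global extension of its restriction to a small ball (`exists_global_extension`). So a
contraction argument needs no derivative of G, provided the linearization in (v, μ, ν) at the center
motion is invertible. By a dimension count only injectivity is needed (`eq_zero_of_homogeneous`): in
the rotating frame the forcing produces a secular term (μc + iνω(0))t, which must vanish by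
periodicity. Since Re c ≠ 0 (the crossing speed of the eigenvalue, `left_eigenvector_deriv`), this
gives μ = ν = 0, and hyperbolicity kills the rest.

Dependence on a. Comparing two fixed points costs the size of the difference of the two
nonlinearities (`exists_periodicSolution`). Quadratic smallness of G gives O(a) for the distance to
the center motion, hence O(a²) in the original variables, which yields the leading order and the
distance to the center eigenspace. The difference for amplitudes b ≤ a is O((a-b)/a), with the
Lipschitz constant of G on a ball of radius O(a) as factor. Multiplication by the amplitude removes
the singularity at 0 for u, and a Lipschitz constant O(r) removes it for μ and the frequency.

Uniqueness. A competing periodic solution w has an unknown and possibly large period. Exponentially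
weighted norms show that bounded solutions of a slightly perturbed linear equation are determined by
z at one time and lie in a narrow cone about the center eigenspace (`exists_cone_estimate`). Applied
to w, this makes z(w) nowhere zero, with a logarithm of nearly constant speed. After the full
period, z(w) has made N turns and its modulus has returned; by a chord argument some single turn
already returns to the same value of z (`exists_return`). Applied to the difference of two
translates of w, the cone estimate shows that this single turn is a period. Hence w, rescaled, lies
in the contraction ball and is on the branch (`exists_normalization`). To exclude amplitudes ≥ a₀,
points with z real and ≥ a₀ are removed from V; the branch avoids them because its orbits meet the
positive half-axis of z only at z = a (`eq_one_of_z_eq_pos`). -/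

namespace HopfLipschitz

/-! ### Bounded solutions of hyperbolic linear equations in exponentially weighted norms -/

section Hyperbolic

variable {W : Type*} [NormedAddCommGroup W] [NormedSpace ℂ W]

lemma norm_le_of_bounded_of_re_neg {l : ℂ} {η M D : ℝ} (hη : 0 < η) (hl : l.re ≤ -(2 * η))
    {x f : ℝ → W} (hM : ∀ t, ‖x t‖ ≤ M) (hx : ∀ t, HasDerivAt x (l • x t + f t) t)
    (hf : ∀ t, ‖f t‖ ≤ D * Real.exp (η * |t|)) (t : ℝ) :
    ‖x t‖ ≤ D / η * Real.exp (η * |t|) := by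
  have hD : 0 ≤ D := by
    have := (norm_nonneg _).trans (hf 0)
    simpa using this
  set β : ℝ := -l.re with hβ
  have hβη : η ≤ β - η := by linarith
  have hβη0 : 0 < β - η := by linarith
  have hnorm : ∀ r : ℝ, ‖Complex.exp (-l * r)‖ = Real.exp (β * r) := by
    intro r
    rw [Complex.norm_exp]
    simp [hβ]
  have hg : ∀ r : ℝ, HasDerivAt (fun r : ℝ => Complex.exp (-l * r) • x r)
      (Complex.exp (-l * r) • f r) r := by
    intro r
    have h1 : HasDerivAt (fun r : ℝ => Complex.exp (-l * r))
        (Complex.exp (-l * r) * (-l)) r := by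
      have : HasDerivAt (fun r : ℝ => -l * (r : ℂ)) (-l) r := by
        simpa using (Complex.ofRealCLM.hasDerivAt (x := r)).const_mul (-l)
      exact this.cexp
    have h2 := h1.smul (hx r)
    refine h2.congr_deriv ?_
    rw [smul_add, smul_smul, mul_neg, neg_smul]
    abel
  -- Variation of constants on [s, t], with s → -∞ afterwards: boundedness of x makes the
  -- contribution of the initial value disappear. The gap 2η leaves a decay rate of at least η
  -- against the growth of the weight.
  have key : ∀ s ≤ t, ‖x t‖ ≤ M * Real.exp (β * (s - t)) + D / η * Real.exp (η * |t|) := by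
    intro s hst
    set c : ℝ := D * Real.exp (η * |t|) * Real.exp (η * t) with hc
    have hb := image_norm_le_of_norm_deriv_right_le_deriv_boundary
      (f := fun r : ℝ => Complex.exp (-l * r) • x r)
      (f' := fun r => Complex.exp (-l * r) • f r) (a := s) (b := t)
      (fun r _ => (hg r).continuousAt.continuousWithinAt)
      (fun r _ => (hg r).hasDerivWithinAt)
      (B := fun r => M * Real.exp (β * s) + c * (Real.exp ((β - η) * r)
        - Real.exp ((β - η) * s)) / (β - η))
      (B' := fun r => c * Real.exp ((β - η) * r))
      (by
        simp only [sub_self, mul_zero, zero_div, add_zero]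
        rw [norm_smul, hnorm, mul_comm]
        gcongr
        exact hM s)
      (by
        intro r
        have h1 : HasDerivAt (fun r : ℝ => Real.exp ((β - η) * r))
            (Real.exp ((β - η) * r) * (β - η)) r := by
          have : HasDerivAt (fun r : ℝ => (β - η) * r) (β - η) r := by
            simpa using (hasDerivAt_id r).const_mul (β - η)
          exact this.exp
        have h2 := (((h1.sub_const (Real.exp ((β - η) * s))).const_mul c).div_const
          (β - η)).const_add (M * Real.exp (β * s))
        refine h2.congr_deriv ?_
        field_simp)
      (by
        intro r hr
        rw [norm_smul, hnorm]
        calc Real.exp (β * r) * ‖f r‖ ≤ Real.exp (β * r) * (D * Real.exp (η * |r|)) := by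
              gcongr
              exact hf r
          _ ≤ Real.exp (β * r) * (D * Real.exp (η * |t| + η * (t - r))) := by
              gcongr
              have : |r| ≤ |t| + (t - r) := by
                have h1 : |r| - |t| ≤ |r - t| := abs_sub_abs_le_abs_sub r t
                rw [abs_of_nonpos (by linarith [hr.2] : r - t ≤ 0)] at h1
                linarith
              nlinarith
          _ = c * Real.exp ((β - η) * r) := by
              rw [hc]
              have : Real.exp (β * r) * Real.exp (η * |t| + η * (t - r))
                  = Real.exp (η * |t|) * Real.exp (η * t) * Real.exp ((β - η) * r) := by
                rw [← Real.exp_add, ← Real.exp_add, ← Real.exp_add]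
                congr 1
                ring
              linear_combination D * this)
      (right_mem_Icc.2 hst)
    simp only [norm_smul, hnorm] at hb
    have hc0 : 0 ≤ c := by positivity
    have h3 : Real.exp (β * t) * ‖x t‖ ≤ M * Real.exp (β * s) +
        c * Real.exp ((β - η) * t) / η := by
      refine hb.trans ?_
      gcongr
      have := Real.exp_pos ((β - η) * s)
      linarith
    have h4 : c * Real.exp ((β - η) * t) = Real.exp (β * t) * (D * Real.exp (η * |t|)) := by
      have : Real.exp (η * t) * Real.exp ((β - η) * t) = Real.exp (β * t) := by
        rw [← Real.exp_add]
        congr 1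
        ring
      rw [hc, ← this]
      ring
    have h5 : Real.exp (β * s) = Real.exp (β * t) * Real.exp (β * (s - t)) := by
      rw [← Real.exp_add]
      congr 1
      ring
    rw [h4, h5] at h3
    have h6 := Real.exp_pos (β * t)
    refine le_of_mul_le_mul_left (h3.trans (le_of_eq ?_)) h6
    field_simp
  have hlim : Tendsto (fun s : ℝ => M * Real.exp (β * (s - t)) + D / η * Real.exp (η * |t|))
      atBot (𝓝 (M * 0 + D / η * Real.exp (η * |t|))) := by
    refine Tendsto.add_const _ (Tendsto.const_mul _ ?_)
    refine Real.tendsto_exp_atBot.comp ?_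
    refine Tendsto.const_mul_atBot (by linarith) ?_
    simpa [sub_eq_add_neg] using tendsto_atBot_add_const_right atBot (-t) tendsto_id
  have := ge_of_tendsto hlim ((eventually_le_atBot t).mono key)
  simpa using this

lemma norm_le_of_bounded_of_re_ne_zero {l : ℂ} {η M D : ℝ} (hη : 0 < η) (hl : 2 * η ≤ |l.re|)
    {x f : ℝ → W} (hM : ∀ t, ‖x t‖ ≤ M) (hx : ∀ t, HasDerivAt x (l • x t + f t) t)
    (hf : ∀ t, ‖f t‖ ≤ D * Real.exp (η * |t|)) (t : ℝ) :
    ‖x t‖ ≤ D / η * Real.exp (η * |t|) := by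
  rcases le_abs'.1 hl with h | h
  · exact norm_le_of_bounded_of_re_neg hη h hM hx hf t
  -- Time reversal exchanges the signs of the real part, and the weight is even.
  · have := norm_le_of_bounded_of_re_neg (l := -l) (x := fun s => x (-s)) (f := fun s => -f (-s))
      hη (by simpa using h) (fun s => hM (-s)) (D := D)
      (fun s => by
        have h1 := (hx (-s)).scomp s (hasDerivAt_neg s)
        refine h1.congr_deriv ?_
        rw [neg_one_smul, neg_add, neg_smul])
      (fun s => by simpa using hf (-s)) (-t)
    simpa using this

open Polynomial in
-- Peeling off one root at a time replaces a spectral decomposition: (B - l)x solves an equation of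
-- the same kind and is annihilated by the product over the remaining roots, and then x' = lx + ((B
-- - l)x + f) is a scalar problem with controlled forcing.
lemma exists_norm_le_of_aeval_eq_zero (B : W →L[ℂ] W) {η : ℝ} (hη : 0 < η) (s : Multiset ℂ)
    (hs : ∀ l ∈ s, 2 * η ≤ |l.re|) :
    ∃ K : ℝ, 0 < K ∧ ∀ (x f : ℝ → W) (M D : ℝ), (∀ t, ‖x t‖ ≤ M) →
      (∀ t, HasDerivAt x (B (x t) + f t) t) →
      (∀ t, aeval B (s.map fun a => X - C a).prod (x t) = 0) →
      (∀ t, ‖f t‖ ≤ D * Real.exp (η * |t|)) → ∀ t, ‖x t‖ ≤ K * D * Real.exp (η * |t|) := by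
  induction s using Multiset.induction with
  | empty =>
    refine ⟨1, one_pos, fun x f M D _ _ h hf t => ?_⟩
    have : x t = 0 := by simpa using h t
    rw [this, norm_zero, one_mul]
    exact (norm_nonneg _).trans (hf t)
  | cons l s ih =>
    obtain ⟨K, hK, h⟩ := ih fun a ha => hs a (Multiset.mem_cons_of_mem ha)
    set Bl : W →L[ℂ] W := B - l • ContinuousLinearMap.id ℂ W with hBl
    refine ⟨(K * ‖Bl‖ + 1) / η, by positivity, fun x f M D hM hx h0 hf t => ?_⟩
    have hcomm : ∀ w, Bl (B w) = B (Bl w) := fun w => by simp [hBl]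
    have h1 := h (fun t => Bl (x t)) (fun t => Bl (f t)) (‖Bl‖ * M) (‖Bl‖ * D)
      (fun t => (Bl.le_opNorm _).trans (by gcongr; exact hM t))
      (fun t => by
        have := ((Bl.restrictScalars ℝ).hasFDerivAt.comp_hasDerivAt t (hx t))
        refine this.congr_deriv ?_
        simp only [ContinuousLinearMap.coe_restrictScalars', map_add, hcomm])
      (fun t => by
        have := h0 t
        rw [Multiset.map_cons, Multiset.prod_cons, mul_comm, map_mul] at this
        simpa [hBl, Algebra.algebraMap_eq_smul_one] using this)
      (fun t => (Bl.le_opNorm _).trans (by rw [mul_assoc]; gcongr; exact hf t))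
    have h2 := norm_le_of_bounded_of_re_ne_zero (l := l) (η := η) (D := (K * ‖Bl‖ + 1) * D) hη
      (hs l (Multiset.mem_cons_self l s)) (f := fun t => Bl (x t) + f t) hM
      (fun t => by
        refine (hx t).congr_deriv ?_
        simp only [hBl, sub_apply, smul_apply,
          ContinuousLinearMap.id_apply]
        abel)
      (fun t => (norm_add_le _ _).trans (by linarith [h1 t, hf t])) t
    refine h2.trans (le_of_eq ?_)
    ring

lemma exists_pos_le_abs_re (s : Multiset ℂ) (hs : ∀ l ∈ s, l.re ≠ 0) :
    ∃ η : ℝ, 0 < η ∧ ∀ l ∈ s, 2 * η ≤ |l.re| := by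
  induction s using Multiset.induction with
  | empty => exact ⟨1, one_pos, by simp⟩
  | cons l s ih =>
    obtain ⟨η, hη, h⟩ := ih fun a ha => hs a (Multiset.mem_cons_of_mem ha)
    have hl : 0 < |l.re| := abs_pos.2 (hs l (Multiset.mem_cons_self l s))
    refine ⟨min η (|l.re| / 2), lt_min hη (by linarith), fun a ha => ?_⟩
    rcases Multiset.mem_cons.1 ha with rfl | ha
    · linarith [min_le_right η (|a.re| / 2)]
    · linarith [min_le_left η (|l.re| / 2), h a ha]

end Hyperbolic

/-! ### Left eigenvectors and the derivative of a simple eigenvalue -/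

section SimpleEigenvalue

open Polynomial

variable {V : Type*} [AddCommGroup V] [Module ℂ V] [FiniteDimensional ℂ V]

/-- If the characteristic polynomial is (X - l)Q, then by Cayley–Hamilton Q(f) maps into the
l-eigenspace, a line because l is simple. Its coefficient along q, divided by Q(l) ≠ 0, is the left
eigenvector. So Q(f) is a multiple of the spectral projection. -/
lemma exists_left_eigenvector {f : Module.End ℂ V} {l : ℂ} {q : V} (hq0 : q ≠ 0)
    (hq : f q = l • q) (hl : f.charpoly.rootMultiplicity l = 1) :
    ∃ p : V →ₗ[ℂ] ℂ, p q = 1 ∧ (∀ v, p (f v) = l * p v) ∧ (∀ v, f v = l • v → v = p v • q) ∧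
      ∀ Q : ℂ[X], f.charpoly = (X - C l) * Q → Q.eval l ≠ 0 ∧
        ∀ v, aeval f Q v = (Q.eval l * p v) • q := by
  have hev : f.HasEigenvector l q := ⟨Module.End.mem_eigenspace_iff.2 hq, hq0⟩
  have hspan : ∀ v, f v = l • v → ∃ c : ℂ, c • q = v := by
    intro v hv
    have h1 : Module.finrank ℂ (f.eigenspace l) ≤ 1 :=
      (LinearMap.finrank_eigenspace_le f l).trans hl.le
    obtain ⟨c, hc⟩ := (finrank_le_one_iff.1 h1)
    obtain ⟨a, ha⟩ := hc ⟨q, hev.1⟩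
    obtain ⟨b, hb⟩ := hc ⟨v, Module.End.mem_eigenspace_iff.2 hv⟩
    have ha' : a • (c : V) = q := congrArg Subtype.val ha
    have hb' : b • (c : V) = v := congrArg Subtype.val hb
    have ha0 : a ≠ 0 := by
      rintro rfl
      exact hq0 (by rw [← ha', zero_smul])
    exact ⟨b * a⁻¹, by rw [← ha', smul_smul, mul_assoc, inv_mul_cancel₀ ha0, mul_one, hb']⟩
  have hroot : f.charpoly.IsRoot l := by
    rw [← Module.End.hasEigenvalue_iff_isRoot_charpoly]
    exact Module.End.hasEigenvalue_of_hasEigenvector hev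
  obtain ⟨Q, hQ⟩ := Polynomial.dvd_iff_isRoot.2 hroot
  have hch0 : f.charpoly ≠ 0 := f.charpoly_monic.ne_zero
  have hQl : Q.eval l ≠ 0 := by
    intro h
    obtain ⟨R, hR⟩ := Polynomial.dvd_iff_isRoot.2 (show Q.IsRoot l from h)
    have h2 : (X - C l) ^ 2 ∣ f.charpoly := ⟨R, by rw [hQ, hR]; ring⟩
    have := (Polynomial.le_rootMultiplicity_iff hch0).2 h2
    omega
  obtain ⟨φ, hφ⟩ := Module.Projective.exists_dual_ne_zero ℂ hq0
  have hQq : aeval f Q q = Q.eval l • q := Module.End.aeval_apply_of_hasEigenvector hev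
  have hQf : ∀ v, f (aeval f Q v) = l • aeval f Q v := by
    intro v
    have h1 : aeval f f.charpoly v = 0 := by rw [LinearMap.aeval_self_charpoly]; rfl
    rw [hQ, map_mul] at h1
    simpa [sub_eq_zero, Algebra.algebraMap_eq_smul_one] using h1
  refine ⟨((Q.eval l)⁻¹ * (φ q)⁻¹) • (φ ∘ₗ aeval f Q), ?_, ?_, ?_, ?_⟩
  · simp only [LinearMap.smul_apply, LinearMap.comp_apply, hQq, map_smul, smul_eq_mul]
    field_simp
  · intro v
    have : aeval f Q (f v) = f (aeval f Q v) := by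
      have := congrArg (fun g : Module.End ℂ V => g v)
        (Polynomial.aeval_mul f (p := Q) (q := X))
      rw [mul_comm] at this
      simpa using this.symm
    simp only [LinearMap.smul_apply, LinearMap.comp_apply, this, hQf, map_smul, smul_eq_mul]
    ring
  · intro v hv
    obtain ⟨c, rfl⟩ := hspan v hv
    simp only [LinearMap.smul_apply, LinearMap.comp_apply, hQq, map_smul, smul_eq_mul]
    congr 1
    field_simp
  · intro Q' hQ'
    have : Q' = Q := by
      have := hQ'.symm.trans hQ
      exact mul_left_cancel₀ (X_sub_C_ne_zero l) this
    subst this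
    refine ⟨hQl, fun v => ?_⟩
    obtain ⟨c, hc⟩ := hspan _ (hQf v)
    simp only [LinearMap.smul_apply, LinearMap.comp_apply, ← hc, map_smul, smul_eq_mul]
    congr 1
    field_simp

end SimpleEigenvalue

/-- No smooth choice of eigenvectors is needed. An eigenvector w of A(m) normalized by p(w) = 1
satisfies ‖w - q‖ = O(e), where e measures the change of A and l, so replacing w by q in l(m) - l(0)
= p((A(m) - A(0))w) costs only O(e²) = o(m). -/
lemma left_eigenvector_deriv {W : Type*} [NormedAddCommGroup W] [NormedSpace ℂ W]
    [FiniteDimensional ℂ W] {A : ℝ → W →L[ℂ] W} {A₁ : W →L[ℂ] W} {l : ℝ → ℂ} {l₁ : ℂ}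
    {p : W →L[ℂ] ℂ} {q : W} (hA : HasDerivAt A A₁ 0) (hl : HasDerivAt l l₁ 0)
    (hev : ∀ᶠ m in 𝓝 0, ∃ v, v ≠ 0 ∧ A m v = l m • v) (hpq : p q = 1)
    (hq : A 0 q = l 0 • q)
    (hp : ∀ v, p (A 0 v) = l 0 * p v) (hker : ∀ v, A 0 v = l 0 • v → v = p v • q) :
    p (A₁ q) = l₁ := by
  -- Adding p to A(0) - l(0) makes the map injective, hence bounded below in finite dimension; this
  -- controls w - q, on which p vanishes.
  set N : W →L[ℂ] W × ℂ := (A 0 - l 0 • ContinuousLinearMap.id ℂ W).prod p with hN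
  obtain ⟨K, hK, hKN⟩ := LinearMap.exists_antilipschitzWith (N : W →ₗ[ℂ] W × ℂ) (by
    rw [LinearMap.ker_eq_bot']
    intro v hv
    have h1 : A 0 v - l 0 • v = 0 ∧ p v = 0 := by simpa [hN] using hv
    rw [hker v (sub_eq_zero.1 h1.1), h1.2, zero_smul])
  have hKN' : ∀ v, p v = 0 → ‖v‖ ≤ K * ‖A 0 v - l 0 • v‖ := by
    intro v hv
    have := ZeroHomClass.bound_of_antilipschitz (N : W →ₗ[ℂ] W × ℂ) hKN v
    simpa [hN, Prod.norm_def, hv] using this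
  set e : ℝ → ℝ := fun m => ‖l m - l 0‖ + ‖A m - A 0‖ with he
  have hgder : HasDerivAt (fun m => l m - l 0 - p ((A m - A 0) q)) (l₁ - p (A₁ q)) 0 := by
    refine (hl.sub_const _).sub ?_
    have h1 := (hA.sub_const (A 0))
    have h2 := ((ContinuousLinearMap.apply ℂ W q).restrictScalars ℝ).hasFDerivAt.comp_hasDerivAt
      (0 : ℝ) h1
    have h3 := (p.restrictScalars ℝ).hasFDerivAt.comp_hasDerivAt (0 : ℝ) h2
    exact h3
  have hebig : e =O[𝓝 0] fun m : ℝ => m := by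
    have h1 := hl.differentiableAt.isBigO_sub.norm_left
    have h2 := hA.differentiableAt.isBigO_sub.norm_left
    simpa using h1.add h2
  have he0 : Tendsto e (𝓝 0) (𝓝 0) := hebig.trans_tendsto tendsto_id
  have hsmall : ∀ᶠ m in 𝓝 0, K * e m < 1 / 2 := by
    have : Tendsto (fun m => K * e m) (𝓝 0) (𝓝 (K * 0)) := he0.const_mul _
    rw [mul_zero] at this
    exact this.eventually_lt_const (by norm_num)
  have hbound : ∀ᶠ m in 𝓝 0,
      ‖l m - l 0 - p ((A m - A 0) q)‖ ≤ (‖p‖ * (2 * K * ‖q‖)) * ‖e m * e m‖ := by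
    filter_upwards [hev, hsmall] with m ⟨v, hv0, hv⟩ hm
    have hNv : ∀ v, A m v = l m • v → ‖A 0 v - l 0 • v‖ ≤ e m * ‖v‖ := by
      intro v hv
      have : A 0 v - l 0 • v = (l m - l 0) • v - (A m - A 0) v := by
        rw [sub_smul, ← hv]
        simp
      rw [this, he, add_mul]
      refine (norm_sub_le _ _).trans (add_le_add (norm_smul_le _ _) ((A m - A 0).le_opNorm v))
    have he_nonneg : 0 ≤ e m := by positivity
    have hpv : p v ≠ 0 := by
      intro h
      have h1 := (hKN' v h).trans (mul_le_mul_of_nonneg_left (hNv v hv) K.2)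
      have := norm_pos_iff.2 hv0
      change ‖v‖ ≤ K * (e m * ‖v‖) at h1
      nlinarith
    set w : W := (p v)⁻¹ • v with hw
    have hpw : p w = 1 := by simp [hw, hpv]
    have hAw : A m w = l m • w := by rw [hw, map_smul, hv, smul_comm]
    have h1 : ‖w - q‖ ≤ K * (e m * ‖w‖) := by
      have h1 := hKN' (w - q) (by rw [map_sub, hpw, hpq, sub_self])
      have h2 : A 0 (w - q) - l 0 • (w - q) = A 0 w - l 0 • w := by
        rw [map_sub, hq, smul_sub]
        abel
      rw [h2] at h1
      exact h1.trans (mul_le_mul_of_nonneg_left (hNv w hAw) K.2)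
    have h2 : ‖w‖ ≤ 2 * ‖q‖ := by
      have := norm_le_norm_add_norm_sub' w q
      nlinarith [norm_nonneg w]
    have h3 : l m - l 0 - p ((A m - A 0) q) = p ((A m - A 0) (w - q)) := by
      have : p ((A m - A 0) w) = l m - l 0 := by
        simp [hAw, hp, hpw]
      rw [map_sub, map_sub, this]
    rw [h3]
    calc ‖p ((A m - A 0) (w - q))‖ ≤ ‖p‖ * (‖A m - A 0‖ * ‖w - q‖) :=
          (p.le_opNorm _).trans (by gcongr; exact (A m - A 0).le_opNorm _)
      _ ≤ ‖p‖ * (e m * (K * (e m * (2 * ‖q‖)))) := by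
          gcongr
          · exact le_add_of_nonneg_left (norm_nonneg _)
          · exact h1.trans (by gcongr)
      _ = _ := by
          rw [Real.norm_of_nonneg (by positivity)]
          ring
  have ho : (fun m => l m - l 0 - p ((A m - A 0) q)) =o[𝓝 0] fun m : ℝ => m := by
    refine (Asymptotics.IsBigO.of_bound _ hbound).trans_isLittleO ?_
    have h1 : e =o[𝓝 0] fun _ => (1 : ℝ) := (Asymptotics.isLittleO_one_iff ℝ).2 he0
    simpa using h1.mul_isBigO hebig
  have hzero : HasDerivAt (fun m => l m - l 0 - p ((A m - A 0) q)) 0 0 := by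
    rw [hasDerivAt_iff_isLittleO]
    simpa using ho
  exact (sub_eq_zero.1 (hgder.unique hzero)).symm

/-- A one-parameter family of linear maps `A` on a real vector space, differentiable at `0`, such
that `A 0` has a pair of simple eigenvalues `± i ω₀` and no other eigenvalue on the imaginary axis.
The map `z` is the left eigenvector, `j` parametrizes the center eigenspace, and `c` is the
derivative of the critical eigenvalue. The absence of other imaginary eigenvalues is expressed by
an estimate in exponentially weighted norms for bounded solutions in the kernel of `z`. -/
structure HopfData (E : Type*) [NormedAddCommGroup E] [NormedSpace ℝ E] where
  A : ℝ → E →L[ℝ] E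
  A₁ : E →L[ℝ] E
  ω₀ : ℝ
  z : E →L[ℝ] ℂ
  j : ℂ →L[ℝ] E
  c : ℂ
  d : ℂ
  ω₀_ne : ω₀ ≠ 0
  strictDeriv : HasStrictDerivAt A A₁ 0
  z_j : ∀ ζ, z (j ζ) = ζ
  A_j : ∀ ζ, A 0 (j ζ) = j (Complex.I * ω₀ * ζ)
  z_A : ∀ u, z (A 0 u) = Complex.I * ω₀ * z u
  z_A₁_j : ∀ ζ, z (A₁ (j ζ)) = c * ζ + d * (starRingEnd ℂ) ζ
  c_re : c.re ≠ 0
  hyperbolic : ∃ K η : ℝ, 0 < K ∧ 0 < η ∧ ∀ (x f : ℝ → E) (M D : ℝ), (∀ t, ‖x t‖ ≤ M) →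
    (∀ t, HasDerivAt x (A 0 (x t) + f t) t) → (∀ t, z (x t) = 0) →
    (∀ t, ‖f t‖ ≤ D * Real.exp (η * |t|)) → ∀ t, ‖x t‖ ≤ K * D * Real.exp (η * |t|)

/-! ### Complexification of real matrices and the hyperbolic estimate -/

section Matrix

variable {n : ℕ}

/-- The inclusion of `ℝⁿ` into `ℂⁿ`. -/
noncomputable def toComplexVec (n : ℕ) : State n →L[ℝ] (Fin n → ℂ) :=
  LinearMap.toContinuousLinearMap
    { toFun := fun u i => (u i : ℂ)
      map_add' := fun u v => by ext i; simp
      map_smul' := fun c u => by ext i; simp }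

@[simp] lemma toComplexVec_apply (u : State n) (i : Fin n) : toComplexVec n u i = (u i : ℂ) := rfl

@[simp] lemma reVec_apply (v : Fin n → ℂ) (i : Fin n) : reVec n v i = (v i).re := rfl

lemma toComplexVec_toEuclideanLin (B : Matrix (Fin n) (Fin n) ℝ) (u : State n) :
    toComplexVec n (Matrix.toEuclideanLin B u) = (complexify B).mulVec (toComplexVec n u) := by
  ext i
  simp [Matrix.toLpLin_apply, Matrix.mulVec, dotProduct, complexify]

lemma star_mulVec_complexify (B : Matrix (Fin n) (Fin n) ℝ) (v : Fin n → ℂ) :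
    star ((complexify B).mulVec v) = (complexify B).mulVec (star v) := by
  ext i
  simp [Matrix.mulVec, dotProduct, complexify]

lemma toComplexVec_reVec (v : Fin n → ℂ) :
    toComplexVec n (reVec n v) = (2⁻¹ : ℂ) • (v + star v) := by
  ext i
  simp only [toComplexVec_apply, reVec_apply, Pi.smul_apply, Pi.add_apply, Pi.star_apply,
    Complex.star_def, Complex.add_conj, smul_eq_mul]
  push_cast
  ring

lemma reVec_mulVec_complexify (B : Matrix (Fin n) (Fin n) ℝ) (v : Fin n → ℂ) :
    reVec n ((complexify B).mulVec v) = Matrix.toEuclideanLin B (reVec n v) := by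
  ext i
  simp [Matrix.toLpLin_apply, Matrix.mulVec, dotProduct, complexify]

lemma toComplexVec_injective : Function.Injective (toComplexVec n) := by
  intro u v h
  ext i
  exact Complex.ofReal_injective (congrFun h i)

lemma complexify_charpoly_rootMultiplicity (B : Matrix (Fin n) (Fin n) ℝ) (l : ℂ) :
    (complexify B).charpoly.rootMultiplicity (star l) =
      (complexify B).charpoly.rootMultiplicity l := by
  have h1 : (complexify B).charpoly = B.charpoly.map Complex.ofRealHom :=
    Matrix.charpoly_map B Complex.ofRealHom
  have h2 : (complexify B).charpoly.map (starRingEnd ℂ) = (complexify B).charpoly := by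
    rw [h1, Polynomial.map_map]
    congr 1
    ext
    simp
  have := Polynomial.eq_rootMultiplicity_map (p := (complexify B).charpoly)
    (f := starRingEnd ℂ) (starRingEnd ℂ).injective l
  rw [h2] at this
  exact this.symm

open Polynomial in
lemma apply_aeval_of_left_eigenvector {V : Type*} [AddCommGroup V] [Module ℂ V]
    {F : Module.End ℂ V} {p : V →ₗ[ℂ] ℂ} {l : ℂ} (hp : ∀ v, p (F v) = l * p v) (R : ℂ[X]) (v : V) :
    p (aeval F R v) = R.eval l * p v := by
  induction R using Polynomial.induction_on' generalizing v with
  | add R S hR hS => simp [hR, hS, add_mul]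
  | monomial k a =>
    induction k generalizing v with
    | zero => simp [Algebra.algebraMap_eq_smul_one]
    | succ k ih =>
      have h := ih (F v)
      rw [hp] at h
      simp only [aeval_monomial, pow_succ, eval_monomial, Module.End.mul_apply] at h ⊢
      rw [h]
      ring

open Polynomial in
-- For real x, vanishing of the left eigenvector for l forces vanishing of its conjugate for -l.
-- Then x is annihilated by P(B), where the characteristic polynomial is (X - l)(X + l)P and P has
-- no root on the imaginary axis, so the estimate by roots applies.
lemma exists_hyperbolic_estimate (B : Matrix (Fin n) (Fin n) ℝ) {l : ℂ} (hl : l ≠ 0)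
    (hstar : star l = -l)
    (hsimple : (complexify B).charpoly.rootMultiplicity l = 1)
    (hhyp : ∀ z : ℂ, (complexify B).charpoly.IsRoot z → z ≠ l → z ≠ -l → z.re ≠ 0)
    {q : Fin n → ℂ} (hq0 : q ≠ 0) (hq : (complexify B).mulVec q = l • q)
    (p : (Fin n → ℂ) →ₗ[ℂ] ℂ) (hpq : p q = 1) (hp : ∀ v, p ((complexify B).mulVec v) = l * p v) :
    ∃ K η : ℝ, 0 < K ∧ 0 < η ∧ ∀ (x f : ℝ → State n) (M D : ℝ), (∀ t, ‖x t‖ ≤ M) →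
    (∀ t, HasDerivAt x (Matrix.toEuclideanLin B (x t) + f t) t) →
    (∀ t, p (toComplexVec n (x t)) = 0) →
    (∀ t, ‖f t‖ ≤ D * Real.exp (η * |t|)) → ∀ t, ‖x t‖ ≤ K * D * Real.exp (η * |t|) := by
  set F : Module.End ℂ (Fin n → ℂ) := Matrix.toLin' (complexify B) with hF
  have hFc : F.charpoly = (complexify B).charpoly := Matrix.charpoly_toLin' _
  have hFa : ∀ v, F v = (complexify B).mulVec v := fun v => rfl
  have hFs : ∀ v, star (F v) = F (star v) := star_mulVec_complexify B
  have hne : l ≠ -l := fun h => hl (by linear_combination h / 2)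
  have hqs : F (star q) = (-l) • star q := by
    rw [← hFs, hFa, hq, star_smul, hstar]
  obtain ⟨p₁, h1q, h1f, -, h1Q⟩ := exists_left_eigenvector (f := F) hq0 hq (by rw [hFc, hsimple])
  obtain ⟨p₂, h2q, h2f, -, h2Q⟩ := exists_left_eigenvector (f := F) (l := -l) (q := star q)
    (by simpa using hq0) hqs
    (by rw [hFc, ← hstar, complexify_charpoly_rootMultiplicity, hsimple])
  have hroot : ∀ m : ℂ, (complexify B).charpoly.rootMultiplicity m = 1 →
      (complexify B).charpoly.IsRoot m := fun m hm =>
    ((Polynomial.rootMultiplicity_pos (Matrix.charpoly_monic _).ne_zero).1 (by omega))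
  have hroot1 := hroot l hsimple
  have hroot2 := hroot (-l) (by rw [← hstar, complexify_charpoly_rootMultiplicity, hsimple])
  obtain ⟨Q, hQ⟩ := Polynomial.dvd_iff_isRoot.2 hroot1
  have hQroot : Q.IsRoot (-l) := by
    rw [hQ, Polynomial.IsRoot.def, eval_mul, mul_eq_zero] at hroot2
    refine hroot2.resolve_left ?_
    simpa [sub_eq_zero] using hne.symm
  obtain ⟨P, hP⟩ := Polynomial.dvd_iff_isRoot.2 hQroot
  have hch1 : F.charpoly = (X - C l) * ((X - C (-l)) * P) := by rw [hFc, hQ, hP]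
  have hch2 : F.charpoly = (X - C (-l)) * ((X - C l) * P) := by rw [hch1]; ring
  obtain ⟨hP1, hPv1⟩ := h1Q _ hch1
  obtain ⟨hP2, hPv2⟩ := h2Q _ hch2
  have hPmonic : P.Monic := by
    have h1 : ((X - C l) * ((X - C (-l)) * P)).Monic := by rw [← hch1]; exact F.charpoly_monic
    exact (monic_X_sub_C (-l)).of_mul_monic_left ((monic_X_sub_C l).of_mul_monic_left h1)
  have hProots : ∀ a ∈ P.roots, a.re ≠ 0 := by
    intro a ha
    have ha0 : P.eval a = 0 := (mem_roots'.1 ha).2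
    refine hhyp a ?_ ?_ ?_
    · rw [← hFc, hch1, Polynomial.IsRoot.def, eval_mul, eval_mul, ha0, mul_zero, mul_zero]
    · rintro rfl
      exact hP1 (by rw [eval_mul, ha0, mul_zero])
    · rintro rfl
      exact hP2 (by rw [eval_mul, ha0, mul_zero])
  have hPprod : P = (P.roots.map fun a => X - C a).prod :=
    (IsAlgClosed.splits P).eq_prod_roots_of_monic hPmonic
  have huniq : ∀ p : (Fin n → ℂ) →ₗ[ℂ] ℂ, p q = 1 → (∀ v, p (F v) = l * p v) →
      ∀ v, p v = p₁ v := by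
    intro p hpq hp v
    have h := congrArg p (hPv1 v)
    rw [apply_aeval_of_left_eigenvector hp, map_smul, hpq, smul_eq_mul, mul_one] at h
    exact mul_left_cancel₀ hP1 h
  have hp1 := huniq p hpq hp
  have hp2 : ∀ v, star v = v → p₁ v = 0 → p₂ v = 0 := by
    intro v hv hv0
    have h := huniq
      { toFun := fun v => star (p₂ (star v))
        map_add' := fun u v => by simp
        map_smul' := fun c u => by simp }
      (by simp [h2q]) (fun v => by simp [hFs, h2f, ← hstar]) v
    rw [hv0] at h
    simpa [hv] using h
  obtain ⟨η, hη, hηr⟩ := exists_pos_le_abs_re P.roots hProots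
  set Bc : (Fin n → ℂ) →L[ℂ] (Fin n → ℂ) := LinearMap.toContinuousLinearMap F with hBc
  obtain ⟨K, hK, hKx⟩ := exists_norm_le_of_aeval_eq_zero Bc hη P.roots hηr
  obtain ⟨L, hL, hLx⟩ := LinearMap.exists_antilipschitzWith
    (toComplexVec n : State n →ₗ[ℝ] (Fin n → ℂ))
    (LinearMap.ker_eq_bot.2 toComplexVec_injective)
  have hLx' : ∀ u : State n, ‖u‖ ≤ L * ‖toComplexVec n u‖ := fun u =>
    ZeroHomClass.bound_of_antilipschitz (toComplexVec n : State n →ₗ[ℝ] (Fin n → ℂ)) hLx u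
  have haeval : ∀ (R : ℂ[X]) v, aeval Bc R v = aeval F R v := by
    intro R v
    induction R using Polynomial.induction_on' generalizing v with
    | add R S hR hS => simp [hR, hS]
    | monomial k a =>
      induction k generalizing v with
      | zero => simp [Algebra.algebraMap_eq_smul_one]
      | succ k ih =>
        have h := ih (F v)
        simp only [aeval_monomial, pow_succ, Module.End.mul_apply] at h ⊢
        exact h
  refine ⟨L * K * (‖toComplexVec n‖ + 1), η, by positivity, hη, fun x f M D hM hx hx0 hf t => ?_⟩
  have hPx : ∀ t, aeval F P (toComplexVec n (x t)) = 0 := by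
    intro t
    have hreal : star (toComplexVec n (x t)) = toComplexVec n (x t) := by
      ext i
      simp
    have e1 := hPv1 (toComplexVec n (x t))
    have e2 := hPv2 (toComplexVec n (x t))
    have h0 : p₁ (toComplexVec n (x t)) = 0 := by rw [← hp1]; exact hx0 t
    rw [h0, mul_zero, zero_smul, map_mul] at e1
    rw [hp2 _ hreal h0, mul_zero, zero_smul, map_mul] at e2
    -- Both (X + l)P and (X - l)P annihilate x; their difference is 2lP.
    have e3 : (2 * l) • aeval F P (toComplexVec n (x t)) = 0 := by
      simp only [map_sub, map_neg, aeval_X, aeval_C, Algebra.algebraMap_eq_smul_one,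
        Module.End.mul_apply, LinearMap.sub_apply, LinearMap.smul_apply, Module.End.one_apply,
        sub_neg_eq_add] at e1 e2
      rw [two_mul, add_smul]
      have := congrArg₂ (· - ·) e1 e2
      simp only [sub_zero] at this
      rw [← this]
      simp
    exact (smul_eq_zero.1 e3).resolve_left (by simpa using hl)
  have h := hKx (fun t => toComplexVec n (x t)) (fun t => toComplexVec n (f t))
    (‖toComplexVec n‖ * M) ((‖toComplexVec n‖ + 1) * D)
    (fun t => ((toComplexVec n).le_opNorm _).trans (by gcongr; exact hM t))
    (fun t => by
      have h1 := (toComplexVec n).hasFDerivAt.comp_hasDerivAt t (hx t)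
      refine h1.congr_deriv ?_
      rw [map_add, toComplexVec_toEuclideanLin]
      rfl)
    (fun t => by rw [← hPprod, haeval]; exact hPx t)
    (fun t => ((toComplexVec n).le_opNorm _).trans (by
      rw [mul_assoc]
      gcongr
      · linarith
      · exact hf t)) t
  refine (hLx' _).trans ((mul_le_mul_of_nonneg_left h L.2).trans (le_of_eq ?_))
  change (L : ℝ) * _ = _
  ring

end Matrix

/-! ### From the matrix family to the abstract bifurcation data -/

section Matrix

variable {n : ℕ}

/-- A real matrix as a continuous linear map of the Euclidean space. -/
noncomputable def matrixCLM (B : Matrix (Fin n) (Fin n) ℝ) : State n →L[ℝ] State n :=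
  LinearMap.toContinuousLinearMap (Matrix.toEuclideanLin B)

@[simp] lemma matrixCLM_apply (B : Matrix (Fin n) (Fin n) ℝ) (u : State n) :
    matrixCLM B u = Matrix.toEuclideanLin B u := rfl

/-- A function of the entries of a matrix, as a continuous linear map. -/
noncomputable def entriesCLM {F : Type*} [NormedAddCommGroup F] [NormedSpace ℝ F]
    (g : Matrix (Fin n) (Fin n) ℝ →ₗ[ℝ] F) : (Fin n → Fin n → ℝ) →L[ℝ] F :=
  LinearMap.toContinuousLinearMap
    { toFun := fun B => g (Matrix.of B)
      map_add' := fun _ _ => g.map_add _ _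
      map_smul' := fun _ _ => g.map_smul _ _ }

lemma hasStrictDerivAt_entries {F : Type*} [NormedAddCommGroup F] [NormedSpace ℝ F]
    (g : Matrix (Fin n) (Fin n) ℝ →ₗ[ℝ] F)
    {A : ℝ → Matrix (Fin n) (Fin n) ℝ} (hA : ∀ i j, ContDiffAt ℝ 1 (fun μ => A μ i j) 0) :
    HasStrictDerivAt (fun m => g (A m))
      (g (Matrix.of fun i j => deriv (fun μ => A μ i j) 0)) 0 := by
  have h1 : HasStrictDerivAt (fun (m : ℝ) (i j : Fin n) => A m i j)
      (fun i j => deriv (fun μ => A μ i j) 0) 0 :=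
    hasStrictDerivAt_pi.2 fun i => hasStrictDerivAt_pi.2 fun j =>
      (hA i j).hasStrictDerivAt one_ne_zero
  exact (entriesCLM g).hasStrictFDerivAt.comp_hasStrictDerivAt (0 : ℝ) h1

lemma exists_hopfData (A : ℝ → Matrix (Fin n) (Fin n) ℝ) (ω : ℝ → ℝ)
    (hA : ∀ i j, ContDiffAt ℝ 1 (fun μ => A μ i j) 0)
    (hω : ContDiffAt ℝ 1 ω 0) (hω0 : ω 0 ≠ 0)
    (hpair : ∀ᶠ μ : ℝ in 𝓝 0, (complexify (A μ)).charpoly.IsRoot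
      ((μ : ℂ) + (ω μ : ℂ) * Complex.I))
    (hsimple : (complexify (A 0)).charpoly.rootMultiplicity ((ω 0 : ℂ) * Complex.I) = 1)
    (hhyp : ∀ z : ℂ, (complexify (A 0)).charpoly.IsRoot z →
      z ≠ (ω 0 : ℂ) * Complex.I → z ≠ -((ω 0 : ℂ) * Complex.I) → z.re ≠ 0)
    (q : Fin n → ℂ) (hq0 : q ≠ 0)
    (hq : (complexify (A 0)).mulVec q = ((ω 0 : ℂ) * Complex.I) • q) :
    ∃ H : HopfData (State n), (∀ m, H.A m = matrixCLM (A m)) ∧ H.ω₀ = ω 0 ∧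
      ∀ ζ, H.j ζ = reVec n (ζ • q) := by
  set l : ℂ := (ω 0 : ℂ) * Complex.I with hl
  have hl0 : l ≠ 0 := by simp [hl, hω0]
  have hstar : star l = -l := by simp [hl]
  set F : Module.End ℂ (Fin n → ℂ) := Matrix.toLin' (complexify (A 0)) with hF
  obtain ⟨p, hpq, hp, hker, -⟩ := exists_left_eigenvector (f := F) hq0 hq
    (by rw [hF, Matrix.charpoly_toLin', hsimple])
  have hps : p (star q) = 0 := by
    have h1 : F (star q) = -l • star q := by
      have := star_mulVec_complexify (A 0) q
      rw [hq, star_smul, hstar] at this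
      exact this.symm
    have h2 := hp (star q)
    rw [h1, map_smul, smul_eq_mul] at h2
    have h3 : (2 * l) * p (star q) = 0 := by linear_combination -h2
    exact (mul_eq_zero.1 h3).resolve_left (by simpa using hl0)
  set A₁ : Matrix (Fin n) (Fin n) ℝ := Matrix.of fun i j => deriv (fun μ => A μ i j) 0 with hA₁
  -- The factor 2 compensates Re(ζq) = (ζq + conj(ζq))/2, since p vanishes on the conjugate of q.
  set z : State n →L[ℝ] ℂ := (2 : ℝ) • ((LinearMap.toContinuousLinearMap p).restrictScalars ℝ).comp
    (toComplexVec n) with hz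
  have hz_apply : ∀ u, z u = 2 * p (toComplexVec n u) := by
    intro u
    simp [hz]
  set j : ℂ →L[ℝ] State n := LinearMap.toContinuousLinearMap
    ((reVec n).comp ((LinearMap.toSpanSingleton ℂ (Fin n → ℂ) q).restrictScalars ℝ)) with hj
  have hj_apply : ∀ ζ, j ζ = reVec n (ζ • q) := fun ζ => rfl
  have hpj : ∀ (B : Matrix (Fin n) (Fin n) ℝ) ζ, z (matrixCLM B (j ζ)) =
      p ((complexify B).mulVec q) * ζ +
        p ((complexify B).mulVec (star q)) * (starRingEnd ℂ) ζ := by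
    intro B ζ
    rw [hz_apply, matrixCLM_apply, toComplexVec_toEuclideanLin, hj_apply, toComplexVec_reVec,
      Matrix.mulVec_smul, Matrix.mulVec_add, star_smul, Matrix.mulVec_smul, Matrix.mulVec_smul]
    simp only [map_smul, map_add, smul_eq_mul, Complex.star_def]
    ring
  -- the derivative of the critical eigenvalue
  have hderiv : p ((complexify A₁).mulVec q) = 1 + ((deriv ω 0 : ℝ) : ℂ) * Complex.I := by
    let g : Matrix (Fin n) (Fin n) ℝ →ₗ[ℝ] ((Fin n → ℂ) →L[ℂ] (Fin n → ℂ)) :=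
      { toFun := fun B => LinearMap.toContinuousLinearMap (Matrix.toLin' (complexify B))
        map_add' := fun B C => by
          ext v i
          simp [complexify, Matrix.mulVec, dotProduct, add_mul, Finset.sum_add_distrib]
        map_smul' := fun c B => by
          ext v i
          simp [complexify, Matrix.mulVec, dotProduct, mul_assoc, Finset.mul_sum] }
    have hl' : HasDerivAt (fun μ : ℝ => (μ : ℂ) + (ω μ : ℂ) * Complex.I)
        (1 + ((deriv ω 0 : ℝ) : ℂ) * Complex.I) 0 := by
      have h1 := (hω.differentiableAt one_ne_zero).hasDerivAt.ofReal_comp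
      have h2 := Complex.ofRealCLM.hasDerivAt (x := (0 : ℝ))
      exact (h2.add (h1.mul_const Complex.I)).congr_deriv (by simp)
    have hl00 : ((0 : ℝ) : ℂ) + (ω 0 : ℂ) * Complex.I = l := by simp [hl]
    refine left_eigenvector_deriv (A := fun m => g (A m)) (A₁ := g A₁)
      (p := LinearMap.toContinuousLinearMap p) (q := q)
      (hasStrictDerivAt_entries g hA).hasDerivAt hl' ?_ hpq ?_ ?_ ?_
    · filter_upwards [hpair] with m hm
      have h1 : Module.End.HasEigenvalue (Matrix.toLin' (complexify (A m)))
          ((m : ℂ) + (ω m : ℂ) * Complex.I) := by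
        rw [Module.End.hasEigenvalue_iff_isRoot_charpoly, Matrix.charpoly_toLin']
        exact hm
      obtain ⟨v, hv⟩ := h1.exists_hasEigenvector
      exact ⟨v, hv.2, hv.apply_eq_smul⟩
    · rw [hl00]
      exact hq
    · rw [hl00]
      exact hp
    · rw [hl00]
      exact hker
  refine ⟨{ A := fun m => matrixCLM (A m)
            A₁ := matrixCLM A₁
            ω₀ := ω 0
            z := z
            j := j
            c := p ((complexify A₁).mulVec q)
            d := p ((complexify A₁).mulVec (star q))
            ω₀_ne := hω0
            strictDeriv := ?_
            z_j := ?_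
            A_j := ?_
            z_A := ?_
            z_A₁_j := hpj A₁
            c_re := ?_
            hyperbolic := ?_ }, fun _ => rfl, rfl, fun _ => rfl⟩
  · exact hasStrictDerivAt_entries ((LinearMap.toContinuousLinearMap.toLinearMap).comp
      (Matrix.toEuclideanLin.toLinearMap : Matrix (Fin n) (Fin n) ℝ →ₗ[ℝ] _)) hA
  · intro ζ
    rw [hz_apply, hj_apply, toComplexVec_reVec, star_smul]
    simp [hpq, hps]
  · intro ζ
    rw [matrixCLM_apply, hj_apply, hj_apply, ← reVec_mulVec_complexify, Matrix.mulVec_smul, hq,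
      smul_smul, hl]
    congr 2
    ring
  · intro u
    rw [hz_apply, hz_apply, matrixCLM_apply, toComplexVec_toEuclideanLin]
    have := hp (toComplexVec n u)
    rw [hF, Matrix.toLin'_apply] at this
    rw [this, hl]
    ring
  -- The eigenvalue is μ + iω(μ), so the real part of its derivative is 1.
  · rw [hderiv]
    simp
  · obtain ⟨K, η, hK, hη, h⟩ := exists_hyperbolic_estimate (A 0) hl0 hstar hsimple hhyp hq0 hq p
      hpq hp
    refine ⟨K, η, hK, hη, fun x f M D hM hx hx0 hf => h x f M D hM hx (fun t => ?_) hf⟩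
    have := hx0 t
    rw [hz_apply] at this
    simpa using this

lemma reVec_smul_mem_centerEigenspace {B : Matrix (Fin n) (Fin n) ℝ} {w : ℝ} {q : Fin n → ℂ}
    (hq : (complexify B).mulVec q = ((w : ℂ) * Complex.I) • q) (ζ : ℂ) :
    reVec n (ζ • q) ∈ centerEigenspace B w := by
  refine Submodule.mem_map_of_mem ?_
  rw [Submodule.restrictScalars_mem]
  exact Submodule.smul_mem _ _ (Module.End.mem_eigenspace_iff.2 hq)

end Matrix

/-! ### Weighted integration, a chord argument and the cone estimate -/

lemma norm_sub_le_of_norm_deriv_le_exp {F : Type*} [NormedAddCommGroup F] [NormedSpace ℝ F]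
    {g g' : ℝ → F} {η D : ℝ} (hη : 0 < η) (hg : ∀ t, HasDerivAt g (g' t) t)
    (hD : ∀ t, ‖g' t‖ ≤ D * Real.exp (η * |t|)) (t : ℝ) :
    ‖g t - g 0‖ ≤ D / η * Real.exp (η * |t|) := by
  have hD0 : 0 ≤ D := by simpa using (norm_nonneg _).trans (hD 0)
  have key : ∀ (g g' : ℝ → F), (∀ t, HasDerivAt g (g' t) t) →
      (∀ t, ‖g' t‖ ≤ D * Real.exp (η * |t|)) → ∀ t, 0 ≤ t →
      ‖g t - g 0‖ ≤ D / η * Real.exp (η * |t|) := by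
    intro g g' hg hD t ht
    have hb := image_norm_le_of_norm_deriv_right_le_deriv_boundary
      (f := fun r => g r - g 0) (f' := g') (a := 0) (b := t)
      (fun r _ => ((hg r).sub_const _).continuousAt.continuousWithinAt)
      (fun r _ => ((hg r).sub_const _).hasDerivWithinAt)
      (B := fun r => D / η * (Real.exp (η * r) - 1))
      (B' := fun r => D * Real.exp (η * r)) (by simp)
      (fun r => by
        have h1 : HasDerivAt (fun r : ℝ => η * r) η r := by
          simpa using (hasDerivAt_id r).const_mul η
        refine ((h1.exp.sub_const 1).const_mul (D / η)).congr_deriv ?_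
        field_simp)
      (fun r hr => by simpa [abs_of_nonneg hr.1] using hD r)
      (right_mem_Icc.2 ht)
    refine hb.trans ?_
    rw [abs_of_nonneg ht]
    gcongr
    linarith
  rcases le_total 0 t with ht | ht
  · exact key g g' hg hD t ht
  · have := key (fun s => g (-s)) (fun s => -g' (-s))
      (fun s => by
        refine ((hg (-s)).scomp s (hasDerivAt_neg s)).congr_deriv ?_
        simp)
      (fun s => by simpa using hD (-s)) (-t) (by linarith)
    simpa using this

/-- Otherwise f(x + T) - f(x) has constant sign by the intermediate value theorem, so f is strictly
monotone along x₀ + kT and cannot return after N steps. This reduces a period of N turns to a single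
turn. -/
lemma exists_add_eq_of_add_nsmul_eq {f : ℝ → ℝ} (hf : Continuous f) {x₀ T : ℝ} {N : ℕ}
    (hN : N ≠ 0) (h : f (x₀ + N * T) = f x₀) : ∃ x, f (x + T) = f x := by
  by_contra! hne
  have hcont : Continuous fun x => f (x + T) - f x := by fun_prop
  have hsign : (∀ x, 0 < f (x + T) - f x) ∨ ∀ x, f (x + T) - f x < 0 := by
    by_contra! hcon
    obtain ⟨⟨a, ha⟩, b, hb⟩ := hcon
    obtain ⟨x, hx⟩ := mem_range_of_exists_le_of_exists_ge hcont ⟨a, ha⟩ ⟨b, hb⟩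
    exact hne x (sub_eq_zero.1 hx)
  have hstep : ∀ k : ℕ, x₀ + (k + 1 : ℕ) * T = x₀ + k * T + T := fun k => by push_cast; ring
  rcases hsign with hs | hs
  · have : StrictMono fun k : ℕ => f (x₀ + k * T) := strictMono_nat_of_lt_succ fun k => by
      simp only [hstep]
      linarith [hs (x₀ + k * T)]
    have := this (Nat.pos_of_ne_zero hN)
    simp [h] at this
  · have : StrictAnti fun k : ℕ => f (x₀ + k * T) := strictAnti_nat_of_succ_lt fun k => by
      simp only [hstep]
      linarith [hs (x₀ + k * T)]
    have := this (Nat.pos_of_ne_zero hN)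
    simp [h] at this

namespace HopfData

variable {E : Type*} [NormedAddCommGroup E] [NormedSpace ℝ E] (H : HopfData E)

/-- The period of the linear center motion. -/
noncomputable def T₀ : ℝ := 2 * Real.pi / |H.ω₀|

lemma T₀_pos : 0 < H.T₀ := div_pos Real.two_pi_pos (abs_pos.2 H.ω₀_ne)

lemma hasDerivAt_z {x : ℝ → E} {e : E} {t : ℝ} (hx : HasDerivAt x (H.A 0 (x t) + e) t) :
    HasDerivAt (fun s => H.z (x s)) (Complex.I * H.ω₀ * H.z (x t) + H.z e) t := by
  refine (H.z.hasFDerivAt.comp_hasDerivAt t hx).congr_deriv ?_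
  rw [map_add, H.z_A]

lemma hasDerivAt_complement {x : ℝ → E} {e : E} {t : ℝ}
    (hx : HasDerivAt x (H.A 0 (x t) + e) t) :
    HasDerivAt (fun s => x s - H.j (H.z (x s)))
      (H.A 0 (x t - H.j (H.z (x t))) + (e - H.j (H.z e))) t := by
  refine (hx.sub (H.j.hasFDerivAt.comp_hasDerivAt t (H.hasDerivAt_z hx))).congr_deriv ?_
  rw [map_sub, H.A_j, map_add]
  abel

lemma hasDerivAt_exp_mul {z : ℝ → ℂ} {e : ℂ} {t : ℝ}
    (hz : HasDerivAt z (Complex.I * H.ω₀ * z t + e) t) :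
    HasDerivAt (fun s : ℝ => Complex.exp (-(Complex.I * H.ω₀ * s)) * z s)
      (Complex.exp (-(Complex.I * H.ω₀ * t)) * e) t := by
  have h1 : HasDerivAt (fun s : ℝ => -(Complex.I * H.ω₀ * (s : ℂ)))
      (-(Complex.I * H.ω₀)) t := by
    exact ((Complex.ofRealCLM.hasDerivAt (x := t)).const_mul (Complex.I * H.ω₀)).neg.congr_deriv
      (by simp)
  refine (h1.cexp.mul hz).congr_deriv ?_
  ring

lemma norm_exp_I_mul (t : ℝ) : ‖Complex.exp (-(Complex.I * H.ω₀ * t))‖ = 1 := by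
  rw [Complex.norm_exp]
  simp

/-- Bounded solutions of a small perturbation of the linear equation lie in a narrow cone around
the center eigenspace and are controlled by their center component at one time. -/
lemma exists_cone_estimate : ∃ ε₀ C η : ℝ, 0 < ε₀ ∧ 0 < C ∧ 0 < η ∧
    ∀ (ε M : ℝ) (x e : ℝ → E), 0 ≤ ε → ε ≤ ε₀ → (∀ t, ‖x t‖ ≤ M) →
      (∀ t, HasDerivAt x (H.A 0 (x t) + e t) t) → (∀ t, ‖e t‖ ≤ ε * ‖x t‖) →
      (∀ t, ‖x t‖ ≤ C * ‖H.z (x 0)‖ * Real.exp (η * |t|)) ∧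
        ‖x 0 - H.j (H.z (x 0))‖ ≤ C * ε * ‖H.z (x 0)‖ := by
  obtain ⟨K, η, hK, hη, hyp⟩ := H.hyperbolic
  set P : ℝ := 1 + ‖H.j‖ * ‖H.z‖ with hP
  have hP0 : 0 < P := by positivity
  set S : ℝ := ‖H.j‖ * (‖H.z‖ / η) + K * P with hS
  have hS0 : 0 < S := by positivity
  refine ⟨1 / (2 * S), (2 * ‖H.j‖ + 1) * (K * P + 1), η, by positivity, by positivity, hη, ?_⟩
  intro ε M x e hε hε0 hM hx he
  -- The weighted supremum is finite because x is bounded. The weight is needed because integrating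
  -- the center equation over long times gives no uniform bound; against the weight it only costs a
  -- factor 1/η.
  set D : ℝ := ⨆ t, Real.exp (-(η * |t|)) * ‖x t‖ with hD
  have hbdd : BddAbove (range fun t => Real.exp (-(η * |t|)) * ‖x t‖) := by
    refine ⟨M, ?_⟩
    rintro _ ⟨t, rfl⟩
    have h1 : Real.exp (-(η * |t|)) ≤ 1 := Real.exp_le_one_iff.2 (by
      have := mul_nonneg hη.le (abs_nonneg t)
      linarith)
    calc Real.exp (-(η * |t|)) * ‖x t‖ ≤ 1 * ‖x t‖ := by gcongr
      _ ≤ M := by rw [one_mul]; exact hM t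
  have hxD : ∀ t, ‖x t‖ ≤ D * Real.exp (η * |t|) := by
    intro t
    have h1 := le_ciSup hbdd t
    have h2 : Real.exp (-(η * |t|)) * Real.exp (η * |t|) = 1 := by
      rw [← Real.exp_add]
      simp
    calc ‖x t‖ = Real.exp (-(η * |t|)) * ‖x t‖ * Real.exp (η * |t|) := by
          rw [mul_right_comm, h2, one_mul]
      _ ≤ _ := by gcongr
  have hD0 : 0 ≤ D := by simpa using (norm_nonneg _).trans (hxD 0)
  have heD : ∀ t, ‖e t‖ ≤ ε * D * Real.exp (η * |t|) := fun t =>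
    (he t).trans (by rw [mul_assoc]; gcongr; exact hxD t)
  have hz : ∀ t, ‖H.z (x t)‖ ≤ ‖H.z (x 0)‖ + ‖H.z‖ * (ε * D) / η * Real.exp (η * |t|) := by
    intro t
    have h1 := norm_sub_le_of_norm_deriv_le_exp (D := ‖H.z‖ * (ε * D)) hη
      (fun t => H.hasDerivAt_exp_mul (H.hasDerivAt_z (hx t)))
      (fun t => by
        rw [norm_mul, H.norm_exp_I_mul, one_mul, mul_assoc]
        exact (H.z.le_opNorm _).trans (by gcongr; exact heD t)) t
    have h2 := norm_le_norm_add_norm_sub'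
      (Complex.exp (-(Complex.I * H.ω₀ * t)) * H.z (x t)) (H.z (x 0))
    rw [norm_mul, H.norm_exp_I_mul, one_mul] at h2
    refine h2.trans (by gcongr; simpa using h1)
  have hy : ∀ t, ‖x t - H.j (H.z (x t))‖ ≤ K * (P * (ε * D)) * Real.exp (η * |t|) := by
    refine hyp (fun t => x t - H.j (H.z (x t))) (fun t => e t - H.j (H.z (e t))) (P * M)
      (P * (ε * D)) ?_ (fun t => H.hasDerivAt_complement (hx t))
      (fun t => by rw [map_sub, H.z_j, sub_self]) ?_
    · intro t
      have h1 : ‖H.j (H.z (x t))‖ ≤ ‖H.j‖ * (‖H.z‖ * ‖x t‖) :=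
        (H.j.le_opNorm _).trans (by gcongr; exact H.z.le_opNorm _)
      calc _ ≤ ‖x t‖ + ‖H.j‖ * (‖H.z‖ * ‖x t‖) := (norm_sub_le _ _).trans (by gcongr)
        _ = P * ‖x t‖ := by rw [hP]; ring
        _ ≤ P * M := by gcongr; exact hM t
    · intro t
      have h1 : ‖H.j (H.z (e t))‖ ≤ ‖H.j‖ * (‖H.z‖ * ‖e t‖) :=
        (H.j.le_opNorm _).trans (by gcongr; exact H.z.le_opNorm _)
      calc _ ≤ ‖e t‖ + ‖H.j‖ * (‖H.z‖ * ‖e t‖) := (norm_sub_le _ _).trans (by gcongr)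
        _ = P * ‖e t‖ := by rw [hP]; ring
        _ ≤ P * (ε * D * Real.exp (η * |t|)) := by gcongr; exact heD t
        _ = _ := by ring
  -- Center part and complement together give D ≤ ‖j‖‖z(x(0))‖ + SεD, and Sε ≤ 1/2 absorbs the last
  -- term.
  have hDle : D ≤ 2 * ‖H.j‖ * ‖H.z (x 0)‖ := by
    have h1 : D ≤ ‖H.j‖ * ‖H.z (x 0)‖ + S * (ε * D) := by
      refine ciSup_le fun t => ?_
      have hexp1 : 1 ≤ Real.exp (η * |t|) := Real.one_le_exp (by positivity)
      have h2 : ‖x t‖ ≤ (‖H.j‖ * ‖H.z (x 0)‖ + S * (ε * D)) * Real.exp (η * |t|) := by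
        calc ‖x t‖ = ‖H.j (H.z (x t)) + (x t - H.j (H.z (x t)))‖ := by rw [add_sub_cancel]
          _ ≤ ‖H.j‖ * ‖H.z (x t)‖ + K * (P * (ε * D)) * Real.exp (η * |t|) :=
            (norm_add_le _ _).trans (add_le_add (H.j.le_opNorm _) (hy t))
          _ ≤ ‖H.j‖ * (‖H.z (x 0)‖ * Real.exp (η * |t|)
                + ‖H.z‖ * (ε * D) / η * Real.exp (η * |t|))
                + K * (P * (ε * D)) * Real.exp (η * |t|) := by
              gcongr
              refine (hz t).trans ?_
              gcongr
              exact le_mul_of_one_le_right (norm_nonneg _) hexp1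
          _ = _ := by rw [hS]; ring
      have h3 : Real.exp (-(η * |t|)) * Real.exp (η * |t|) = 1 := by
        rw [← Real.exp_add]
        simp
      calc Real.exp (-(η * |t|)) * ‖x t‖ ≤ Real.exp (-(η * |t|)) *
            ((‖H.j‖ * ‖H.z (x 0)‖ + S * (ε * D)) * Real.exp (η * |t|)) := by gcongr
        _ = (‖H.j‖ * ‖H.z (x 0)‖ + S * (ε * D)) *
            (Real.exp (-(η * |t|)) * Real.exp (η * |t|)) := by ring
        _ = _ := by rw [h3, mul_one]
    have h2 : S * (ε * D) ≤ D / 2 := by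
      calc S * (ε * D) ≤ S * (1 / (2 * S) * D) := by gcongr
        _ = D / 2 := by field_simp
    linarith
  have hz0 := norm_nonneg (H.z (x 0))
  have hj0 := norm_nonneg H.j
  constructor
  · intro t
    refine (hxD t).trans ?_
    gcongr
    refine hDle.trans (mul_le_mul_of_nonneg_right ?_ hz0)
    nlinarith [mul_pos hK hP0]
  · have := hy 0
    simp only [abs_zero, mul_zero, Real.exp_zero, mul_one] at this
    calc _ ≤ K * (P * (ε * D)) := this
      _ ≤ K * (P * (ε * (2 * ‖H.j‖ * ‖H.z (x 0)‖))) := by gcongr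
      _ = (2 * ‖H.j‖) * (K * P) * ε * ‖H.z (x 0)‖ := by ring
      _ ≤ _ := by
        gcongr <;> linarith

end HopfData

/-! ### The center logarithm, returns after one turn and the period of small solutions -/

namespace HopfData

variable {E : Type*} [NormedAddCommGroup E] [NormedSpace ℝ E] (H : HopfData E)

/-- Complex logarithm of the center component along a solution. -/
lemma exists_log {z h : ℝ → ℂ} {κ : ℝ} (hh : Continuous h)
    (hhκ : ∀ t, ‖h t‖ ≤ κ) (hz : ∀ t, HasDerivAt z ((Complex.I * H.ω₀ + h t) * z t) t) :
    ∃ ℓ : ℝ → ℂ, ℓ 0 = 0 ∧ (∀ s t, ‖ℓ t - ℓ s‖ ≤ κ * |t - s|) ∧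
      ∀ s t, z t = z s * Complex.exp (Complex.I * H.ω₀ * (t - s) + (ℓ t - ℓ s)) := by
  have hd : ∀ t, HasDerivAt (fun t => ∫ s in (0 : ℝ)..t, h s) (h t) t := fun t =>
    intervalIntegral.integral_hasDerivAt_right (hh.intervalIntegrable _ _)
      (hh.stronglyMeasurableAtFilter _ _) hh.continuousAt
  refine ⟨fun t => ∫ s in (0 : ℝ)..t, h s, by simp, fun s t => ?_, ?_⟩
  · have := convex_univ.norm_image_sub_le_of_norm_hasDerivWithin_le (C := κ)
      (fun t _ => (hd t).hasDerivWithinAt) (fun t _ => hhκ t) (mem_univ s) (mem_univ t)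
    simpa using this
  · set ℓ : ℝ → ℂ := fun t => ∫ s in (0 : ℝ)..t, h s with hℓ
    set L : ℝ → ℂ := fun t => Complex.I * H.ω₀ * t + ℓ t with hL
    have hLd : ∀ t, HasDerivAt L (Complex.I * H.ω₀ + h t) t := fun t =>
      (((Complex.ofRealCLM.hasDerivAt (x := t)).const_mul (Complex.I * H.ω₀)).add
        (hd t)).congr_deriv (by simp)
    have hconst : ∀ t, HasDerivAt (fun t => z t * Complex.exp (-L t)) 0 t := fun t =>
      ((hz t).mul (hLd t).neg.cexp).congr_deriv (by ring)
    have heq : ∀ s t, z t * Complex.exp (-L t) = z s * Complex.exp (-L s) := fun s t =>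
      is_const_of_deriv_eq_zero (fun t => (hconst t).differentiableAt)
        (fun t => (hconst t).deriv) t s
    intro s t
    have h1 : Complex.I * H.ω₀ * (t - s) + (ℓ t - ℓ s) = L t + (-L s) := by
      simp only [hL]
      ring
    rw [h1, Complex.exp_add, mul_left_comm, ← heq s t, mul_left_comm, ← Complex.exp_add]
    simp

lemma exp_I_mul_T₀ : Complex.exp (Complex.I * H.ω₀ * H.T₀) = 1 := by
  have hne : (|H.ω₀| : ℝ) ≠ 0 := abs_ne_zero.2 H.ω₀_ne
  rw [Complex.exp_eq_one_iff]
  rcases abs_choice H.ω₀ with h | h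
  · refine ⟨1, ?_⟩
    have : (H.ω₀ : ℂ) * H.T₀ = 2 * Real.pi := by
      rw [T₀, h, ← Complex.ofReal_mul, mul_div_cancel₀ _ H.ω₀_ne]
      push_cast
      ring
    push_cast
    linear_combination Complex.I * this
  · refine ⟨-1, ?_⟩
    have : (H.ω₀ : ℂ) * H.T₀ = -(2 * Real.pi) := by
      have h2 : H.ω₀ * (2 * Real.pi / -H.ω₀) = -(2 * Real.pi) := by
        field_simp [H.ω₀_ne]
      rw [T₀, h, ← Complex.ofReal_mul, h2]
      push_cast
      ring
    push_cast
    linear_combination Complex.I * this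

/-- A logarithm of the center component with almost constant speed makes a full turn between two
times at which the center component is the same, provided that this component is periodic. -/
lemma exists_return {z ℓ : ℝ → ℂ} {κ T : ℝ} (hκ : 2 * κ ≤ |H.ω₀|) (hℓ0 : ℓ 0 = 0)
    (hℓ : ∀ s t, ‖ℓ t - ℓ s‖ ≤ κ * |t - s|) (hz0 : z 0 ≠ 0)
    (hz : ∀ s t, z t = z s * Complex.exp (Complex.I * H.ω₀ * (t - s) + (ℓ t - ℓ s)))
    (hT : 0 < T) (hper : z T = z 0) :
    (∃ t₁ t₂, t₁ < t₂ ∧ z t₂ = z t₁ ∧ |t₂ - t₁ - H.T₀| ≤ 2 * κ / |H.ω₀| * H.T₀) ∧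
      ∃ t a : ℝ, 0 < a ∧ z t = a := by
  have hω := abs_pos.2 H.ω₀_ne
  have hκ0 : 0 ≤ κ := by simpa using (norm_nonneg _).trans (hℓ 0 1)
  -- The phase of z relative to time 0, divided by ω₀. Its slope is at least 1/2, so it can replace
  -- time as independent variable, and one turn is an increment T₀ of φ for either sign of ω₀.
  set φ : ℝ → ℝ := fun t => t + (ℓ t).im / H.ω₀ with hφ
  have hφd : ∀ s t, |(φ t - φ s) - (t - s)| ≤ κ / |H.ω₀| * |t - s| := by
    intro s t
    have h1 : (φ t - φ s) - (t - s) = (ℓ t - ℓ s).im / H.ω₀ := by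
      simp only [hφ, Complex.sub_im]
      ring
    rw [h1, abs_div, div_mul_eq_mul_div]
    gcongr
    exact (Complex.abs_im_le_norm _).trans (hℓ s t)
  have hκω : κ / |H.ω₀| ≤ 1 / 2 := by
    rw [div_le_iff₀ hω]
    linarith
  have hφlow : ∀ s t, s ≤ t → (t - s) / 2 ≤ φ t - φ s := by
    intro s t hst
    have h1 := (abs_le.1 (hφd s t)).1
    rw [abs_of_nonneg (sub_nonneg.2 hst)] at h1
    nlinarith
  have hφmono : StrictMono φ := fun s t hst => by linarith [hφlow s t hst.le]
  have hℓcont : Continuous ℓ := by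
    refine (LipschitzWith.of_dist_le_mul (K := ⟨κ, hκ0⟩) fun t s => ?_).continuous
    rw [dist_eq_norm, Real.dist_eq]
    exact hℓ s t
  have hφcont : Continuous φ := continuous_id.add
    ((Complex.continuous_im.comp hℓcont).div_const _)
  have hφsurj : Function.Surjective φ := by
    refine hφcont.surjective ?_ ?_
    · refine tendsto_atTop_mono' atTop (f₁ := fun t => t / 2 + φ 0) ?_
        (tendsto_atTop_add_const_right _ _ (tendsto_id.atTop_div_const two_pos))
      filter_upwards [eventually_ge_atTop 0] with t ht
      linarith [hφlow 0 t ht]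
    · refine tendsto_atBot_mono' atBot (f₁ := fun t => t / 2 + φ 0) ?_
        (tendsto_atBot_add_const_right _ _ (tendsto_id.atBot_div_const two_pos))
      filter_upwards [eventually_le_atBot 0] with t ht
      linarith [hφlow t 0 ht]
  set Φ : ℝ ≃o ℝ := hφmono.orderIsoOfSurjective φ hφsurj with hΦ
  have hΦφ : ∀ t, φ (Φ.symm t) = t := fun t => Φ.apply_symm_apply t
  have hφ0 : φ 0 = 0 := by simp [hφ, hℓ0]
  have hT₀ := H.T₀_pos
  constructor
  · obtain ⟨k, hk⟩ : ∃ k : ℤ, Complex.I * H.ω₀ * (T - (0 : ℝ)) + (ℓ T - ℓ 0)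
        = k * (2 * Real.pi * Complex.I) := by
      rw [← Complex.exp_eq_one_iff]
      have h1 := hz 0 T
      rw [hper] at h1
      exact (mul_eq_left₀ hz0).1 h1.symm
    have hkre : (ℓ T).re = 0 := by
      have := congrArg Complex.re hk
      simpa [hℓ0] using this
    have hkim : H.ω₀ * φ T = k * (2 * Real.pi) := by
      have := congrArg Complex.im hk
      simp only [hℓ0, Complex.ofReal_zero, sub_zero, Complex.add_im, Complex.mul_im,
        Complex.mul_re, Complex.I_re, Complex.I_im, Complex.ofReal_re, Complex.ofReal_im,
        Complex.intCast_re, Complex.intCast_im, Complex.re_ofNat, Complex.im_ofNat] at this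
      simp only [hφ, mul_add, mul_div_cancel₀ _ H.ω₀_ne]
      linarith
    have hφT : 0 < φ T := by
      rw [← hφ0]
      exact hφmono hT
    have hkN : φ T = k.natAbs * H.T₀ := by
      have h1 := congrArg abs hkim
      rw [abs_mul, abs_mul, abs_of_pos hφT, abs_of_pos Real.two_pi_pos] at h1
      rw [T₀, Nat.cast_natAbs, Int.cast_abs]
      field_simp
      linarith
    have hk0 : k.natAbs ≠ 0 := by
      intro h
      rw [h] at hkN
      simp [hkN] at hφT
    -- At time T the phase has advanced by N turns and the log modulus has returned. The chord
    -- argument for the log modulus as a function of the phase yields one turn with equal moduli,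
    -- hence equal values of z.
    obtain ⟨x, hx⟩ := exists_add_eq_of_add_nsmul_eq (f := fun x => (ℓ (Φ.symm x)).re)
      (x₀ := 0) (T := H.T₀) (N := k.natAbs)
      (Complex.continuous_re.comp (hℓcont.comp Φ.symm.continuous)) hk0 (by
        have h0 : Φ.symm 0 = 0 := Φ.symm_apply_eq.2 hφ0.symm
        have h1 : Φ.symm (φ T) = T := Φ.symm_apply_apply T
        rw [zero_add, ← hkN, h0, h1, hkre, hℓ0, Complex.zero_re])
    have hlt : Φ.symm x < Φ.symm (x + H.T₀) := Φ.symm.strictMono (by linarith)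
    have hφdiff : φ (Φ.symm (x + H.T₀)) - φ (Φ.symm x) = H.T₀ := by
      rw [hΦφ, hΦφ]
      ring
    refine ⟨Φ.symm x, Φ.symm (x + H.T₀), hlt, ?_, ?_⟩
    · rw [hz (Φ.symm x) (Φ.symm (x + H.T₀))]
      have h1 : Complex.I * H.ω₀ * ((Φ.symm (x + H.T₀) : ℝ) - (Φ.symm x : ℝ))
          + (ℓ (Φ.symm (x + H.T₀)) - ℓ (Φ.symm x)) = Complex.I * H.ω₀ * H.T₀ := by
        apply Complex.ext
        · have : (ℓ (Φ.symm (x + H.T₀))).re = (ℓ (Φ.symm x)).re := hx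
          simp [this]
        · simp only [hφ] at hφdiff
          have h2 : H.ω₀ * H.T₀ = H.ω₀ * (Φ.symm (x + H.T₀) - Φ.symm x) +
              ((ℓ (Φ.symm (x + H.T₀))).im - (ℓ (Φ.symm x)).im) := by
            have e1 := mul_div_cancel₀ (ℓ (Φ.symm (x + H.T₀))).im H.ω₀_ne
            have e2 := mul_div_cancel₀ (ℓ (Φ.symm x)).im H.ω₀_ne
            linear_combination (-H.ω₀) * hφdiff + e1 - e2
          simp
          linarith
      rw [h1, H.exp_I_mul_T₀, mul_one]
    · have h1 := hφd (Φ.symm x) (Φ.symm (x + H.T₀))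
      have h2 := hφlow (Φ.symm x) (Φ.symm (x + H.T₀)) hlt.le
      rw [hφdiff] at h1 h2
      rw [abs_sub_comm] at h1
      refine h1.trans ?_
      rw [abs_of_pos (sub_pos.2 hlt)]
      have h3 : Φ.symm (x + H.T₀) - Φ.symm x ≤ 2 * H.T₀ := by linarith
      calc κ / |H.ω₀| * (Φ.symm (x + H.T₀) - Φ.symm x) ≤ κ / |H.ω₀| * (2 * H.T₀) := by gcongr
        _ = _ := by ring
  -- The time at which the accumulated phase cancels the argument of z(0).
  · set t := Φ.symm (-(z 0).arg / H.ω₀) with ht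
    refine ⟨t, ‖z 0‖ * Real.exp (ℓ t).re, by positivity, ?_⟩
    have h1 : Complex.I * H.ω₀ * (t - (0 : ℝ)) + (ℓ t - ℓ 0) =
        (ℓ t).re + -((z 0).arg * Complex.I) := by
      have h2 := hΦφ (-(z 0).arg / H.ω₀)
      rw [← ht] at h2
      simp only [hφ] at h2
      field_simp [H.ω₀_ne] at h2
      apply Complex.ext
      · simp [hℓ0]
      · simp [hℓ0]
        linarith
    rw [hz 0 t, h1, Complex.exp_add, Complex.exp_neg]
    push_cast
    nth_rewrite 1 [← Complex.norm_mul_exp_arg_mul_I (z 0)]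
    have := Complex.exp_ne_zero ((z 0).arg * Complex.I)
    field_simp

end HopfData

namespace HopfData

variable {E : Type*} [NormedAddCommGroup E] [NormedSpace ℝ E] (H : HopfData E)

/-- A nontrivial periodic solution of a small perturbation of the linear equation has, whatever its
period is, a period close to that of the linear center motion, and after a shift of time it is
relatively close to that motion. -/
lemma exists_near_linear : ∃ ε₀ C : ℝ, 0 < ε₀ ∧ 0 < C ∧ ∀ (ε M T : ℝ) (s : Set E) (g : E → E)
    (w : ℝ → E), 0 ≤ ε → ε ≤ ε₀ → (0 : E) ∈ s → g 0 = 0 →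
    (∀ x ∈ s, ∀ y ∈ s, ‖g x - g y‖ ≤ ε * ‖x - y‖) → (∀ t, w t ∈ s) → (∀ t, ‖w t‖ ≤ M) →
    (∀ t, HasDerivAt w (H.A 0 (w t) + g (w t)) t) → 0 < T → Function.Periodic w T →
    (∃ t, w t ≠ 0) →
    ∃ t₀ a ν : ℝ, 0 < a ∧ H.z (w t₀) = a ∧ |ν| ≤ C * ε ∧ |ν| ≤ 1 / 2 ∧
      Function.Periodic w ((1 + ν) * H.T₀) ∧
      ∀ r, |r| ≤ H.T₀ →
        ‖w (t₀ + (1 + ν) * r) - a • H.j (Complex.exp (Complex.I * H.ω₀ * r))‖ ≤ C * ε * a := by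
  obtain ⟨ε₁, Cc, η, hε₁, hCc, hη, hcone⟩ := H.exists_cone_estimate
  have hω := abs_pos.2 H.ω₀_ne
  have hT₀ := H.T₀_pos
  -- C₁ε bounds the logarithmic derivative of z(w) minus iω₀; C₂ε will bound the error of the
  -- logarithm over one turn, half of it from the period and half from this drift.
  set C₁ : ℝ := (‖H.z‖ + 1) * Cc with hC₁
  have hC₁0 : 0 < C₁ := by positivity
  set C₂ : ℝ := 4 * C₁ * H.T₀ with hC₂
  have hC₂0 : 0 < C₂ := by positivity
  set C : ℝ := 3 * Cc + 2 * ‖H.j‖ * C₂ + 2 * C₁ / |H.ω₀| with hC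
  refine ⟨min ε₁ (min (|H.ω₀| / (4 * C₁)) (1 / C₂)), C,
    lt_min hε₁ (lt_min (by positivity) (by positivity)), by positivity, ?_⟩
  intro ε M T s g w hε hε₀ h0s hg0 hg hws hM hw hT hper hne
  have hεε₁ : ε ≤ ε₁ := hε₀.trans (min_le_left _ _)
  have hεω : C₁ * ε ≤ |H.ω₀| / 4 := by
    have h1 : ε ≤ |H.ω₀| / (4 * C₁) := hε₀.trans ((min_le_right _ _).trans (min_le_left _ _))
    rw [le_div_iff₀ (by positivity)] at h1
    linarith
  have hεC₂ : C₂ * ε ≤ 1 := by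
    have h1 : ε ≤ 1 / C₂ := hε₀.trans ((min_le_right _ _).trans (min_le_right _ _))
    rw [le_div_iff₀ (by positivity)] at h1
    linarith
  have hgw : ∀ t, ‖g (w t)‖ ≤ ε * ‖w t‖ := fun t => by
    simpa [hg0] using hg (w t) (hws t) 0 h0s
  have hconew : ∀ t, (∀ r, ‖w (t + r)‖ ≤ Cc * ‖H.z (w t)‖ * Real.exp (η * |r|)) ∧
      ‖w t - H.j (H.z (w t))‖ ≤ Cc * ε * ‖H.z (w t)‖ := by
    intro t
    have := hcone ε M (fun r => w (t + r)) (fun r => g (w (t + r))) hε hεε₁ (fun r => hM _)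
      (fun r => (hw (t + r)).comp_const_add t r) (fun r => hgw _)
    simpa using this
  -- If z vanished at one time, the cone estimate centered there would make w vanish identically.
  have hz0 : ∀ t, H.z (w t) ≠ 0 := by
    intro t ht
    obtain ⟨r, hr⟩ := hne
    have := (hconew t).1 (r - t)
    rw [ht, norm_zero, mul_zero, zero_mul, add_sub_cancel] at this
    exact hr (norm_le_zero_iff.1 this)
  have hwz : ∀ t, ‖w t‖ ≤ Cc * ‖H.z (w t)‖ := fun t => by simpa using (hconew t).1 0
  have hwcont : Continuous w := continuous_iff_continuousAt.2 fun t => (hw t).continuousAt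
  have hgcont : Continuous fun t => g (w t) := by
    have h1 : LipschitzOnWith ⟨ε, hε⟩ g s := LipschitzOnWith.of_dist_le_mul fun x hx y hy => by
      rw [dist_eq_norm, dist_eq_norm]
      exact hg x hx y hy
    exact h1.continuousOn.comp_continuous hwcont hws
  have hzcont : Continuous fun t => H.z (w t) := H.z.continuous.comp hwcont
  obtain ⟨ℓ, hℓ0, hℓ, hzℓ⟩ := H.exists_log (z := fun t => H.z (w t))
    (h := fun t => H.z (g (w t)) / H.z (w t)) (κ := C₁ * ε)
    ((H.z.continuous.comp hgcont).div hzcont hz0)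
    (fun t => by
      rw [norm_div, div_le_iff₀ (norm_pos_iff.2 (hz0 t))]
      calc ‖H.z (g (w t))‖ ≤ ‖H.z‖ * (ε * (Cc * ‖H.z (w t)‖)) :=
            (H.z.le_opNorm _).trans (by gcongr; exact (hgw t).trans (by gcongr; exact hwz t))
        _ ≤ (‖H.z‖ + 1) * (ε * (Cc * ‖H.z (w t)‖)) := by gcongr; linarith
        _ = _ := by rw [hC₁]; ring)
    (fun t => (H.hasDerivAt_z (hw t)).congr_deriv (by
      have := hz0 t
      field_simp))
  obtain ⟨⟨t₁, t₂, ht, hzt, hT₁⟩, t₀, a, ha, hza⟩ := H.exists_return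
    (z := fun t => H.z (w t)) (ℓ := ℓ) (κ := C₁ * ε) (T := T)
    (by linarith) hℓ0 hℓ (hz0 0) hzℓ hT (by
      have := hper 0
      rw [zero_add] at this
      simp only [this])
  -- The difference of two translates is again a bounded solution of a perturbed linear equation, by
  -- the Lipschitz bound on g. Its center component vanishes at one time, so it is zero.
  have hper₁ : Function.Periodic w (t₂ - t₁) := by
    have h1 := (hcone ε (M + M) (fun r => w (t₂ + r) - w (t₁ + r))
      (fun r => g (w (t₂ + r)) - g (w (t₁ + r))) hε hεε₁
      (fun r => (norm_sub_le _ _).trans (add_le_add (hM _) (hM _)))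
      (fun r => (((hw (t₂ + r)).comp_const_add t₂ r).sub
        ((hw (t₁ + r)).comp_const_add t₁ r)).congr_deriv (by rw [map_sub]; abel))
      (fun r => hg _ (hws _) _ (hws _))).1
    intro t
    have h2 := h1 (t - t₁)
    simp only [add_zero, map_sub, hzt, sub_self, norm_zero, mul_zero, zero_mul] at h2
    have h3 := sub_eq_zero.1 (norm_le_zero_iff.1 h2)
    rw [add_sub_cancel] at h3
    rw [← h3]
    congr 1
    ring
  set ν : ℝ := (t₂ - t₁ - H.T₀) / H.T₀ with hν
  have hνT : (1 + ν) * H.T₀ = t₂ - t₁ := by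
    rw [hν]
    field_simp
    ring
  have hν1 : |ν| ≤ 2 * (C₁ * ε) / |H.ω₀| := by
    rw [hν, abs_div, abs_of_pos hT₀, div_le_iff₀ hT₀]
    exact hT₁
  have hν2 : |ν| ≤ 1 / 2 := by
    refine hν1.trans ?_
    rw [div_le_iff₀ hω]
    linarith
  refine ⟨t₀, a, ν, ha, hza, ?_, hν2, by rw [hνT]; exact hper₁, ?_⟩
  · refine hν1.trans ?_
    have h1 : 0 ≤ (3 * Cc + 2 * ‖H.j‖ * C₂) * ε := by positivity
    calc 2 * (C₁ * ε) / |H.ω₀| = 2 * C₁ / |H.ω₀| * ε := by ring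
      _ ≤ C * ε := by rw [hC]; linarith
  · intro r hr
    set x := w (t₀ + (1 + ν) * r) with hx
    set δ : ℂ := Complex.I * H.ω₀ * (ν * r : ℝ) + (ℓ (t₀ + (1 + ν) * r) - ℓ t₀) with hδ
    set e := Complex.exp (Complex.I * H.ω₀ * r) with he
    have hzx : H.z x = a * e * Complex.exp δ := by
      have := hzℓ t₀ (t₀ + (1 + ν) * r)
      rw [hza] at this
      rw [hx, this, mul_assoc (a : ℂ) e, he, ← Complex.exp_add, hδ]
      congr 2
      push_cast
      ring
    have hν3 := abs_le.1 hν2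
    have hδn : ‖δ‖ ≤ C₂ * ε := by
      have h1 : ‖Complex.I * H.ω₀ * (ν * r : ℝ)‖ ≤ 2 * (C₁ * ε) * H.T₀ := by
        rw [norm_mul, norm_mul, Complex.norm_I, one_mul, Complex.norm_real, Complex.norm_real,
          Real.norm_eq_abs, Real.norm_eq_abs, abs_mul]
        calc |H.ω₀| * (|ν| * |r|) ≤ |H.ω₀| * (2 * (C₁ * ε) / |H.ω₀| * H.T₀) := by gcongr
          _ = _ := by field_simp
      have h2 : ‖ℓ (t₀ + (1 + ν) * r) - ℓ t₀‖ ≤ C₁ * ε * (2 * H.T₀) := by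
        refine (hℓ _ _).trans ?_
        rw [add_sub_cancel_left, abs_mul]
        gcongr
        rw [abs_le]
        constructor <;> linarith
      calc ‖δ‖ ≤ 2 * (C₁ * ε) * H.T₀ + C₁ * ε * (2 * H.T₀) :=
            (norm_add_le _ _).trans (add_le_add h1 h2)
        _ = _ := by rw [hC₂]; ring
    have hexp : ‖Complex.exp δ - 1‖ ≤ 2 * (C₂ * ε) :=
      (Complex.norm_exp_sub_one_le (hδn.trans hεC₂)).trans (by gcongr)
    have he1 : ‖e‖ = 1 := by
      rw [he, Complex.norm_exp]
      simp
    have hzx1 : ‖H.z x‖ ≤ 3 * a := by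
      rw [hzx, norm_mul, norm_mul, he1, mul_one, Complex.norm_real, Real.norm_of_nonneg ha.le]
      have h1 := norm_le_norm_add_norm_sub' (Complex.exp δ) 1
      rw [norm_one] at h1
      have h2 : ‖Complex.exp δ‖ ≤ 3 := by linarith
      nlinarith
    have hzx2 : ‖H.z x - a • e‖ ≤ 2 * (C₂ * ε) * a := by
      have h1 : H.z x - a • e = a * e * (Complex.exp δ - 1) := by
        rw [hzx, Complex.real_smul]
        ring
      rw [h1, norm_mul, norm_mul, he1, mul_one, Complex.norm_real, Real.norm_of_nonneg ha.le,
        mul_comm]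
      gcongr
    have h1 : x - a • H.j e = (x - H.j (H.z x)) + H.j (H.z x - a • e) := by
      rw [map_sub, map_smul]
      abel
    rw [h1]
    calc _ ≤ Cc * ε * (3 * a) + ‖H.j‖ * (2 * (C₂ * ε) * a) :=
          (norm_add_le _ _).trans (add_le_add ((hconew _).2.trans (by gcongr))
            ((H.j.le_opNorm _).trans (by gcongr)))
      _ = (3 * Cc + 2 * ‖H.j‖ * C₂) * (ε * a) := by ring
      _ ≤ C * (ε * a) := by
          have : 0 ≤ 2 * C₁ / |H.ω₀| := by positivity
          exact mul_le_mul_of_nonneg_right (by rw [hC]; linarith) (by positivity)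
      _ = _ := by ring

end HopfData

/-! ### Inhomogeneous linear differential equations -/

section LinearODE

variable {E : Type*} [NormedAddCommGroup E] [NormedSpace ℝ E]

lemma eq_of_linear_ode (B : E →L[ℝ] E) {f v w : ℝ → E}
    (hv : ∀ t, HasDerivAt v (B (v t) + f t) t) (hw : ∀ t, HasDerivAt w (B (w t) + f t) t)
    (h0 : v 0 = w 0) : v = w :=
  ODE_solution_unique_univ (v := fun t x => B x + f t) (s := fun _ => univ) (K := ‖B‖₊) (t₀ := 0)
    (fun t => by
      rw [lipschitzOnWith_univ]
      simpa using B.lipschitz.add (LipschitzWith.const (f t)))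
    (fun t => ⟨hv t, mem_univ _⟩) (fun t => ⟨hw t, mem_univ _⟩) h0

lemma periodic_of_linear_ode (B : E →L[ℝ] E) {f v : ℝ → E} {T : ℝ}
    (hv : ∀ t, HasDerivAt v (B (v t) + f t) t) (hf : Function.Periodic f T) (hT : v T = v 0) :
    Function.Periodic v T := by
  have h := eq_of_linear_ode B (f := f) (v := fun t => v (t + T)) (w := v)
    (fun t => by
      have := (hv (t + T)).comp_add_const t T
      rwa [hf t] at this) hv (by simpa using hT)
  exact fun t => congrFun h t

lemma norm_le_of_linear_ode (B : E →L[ℝ] E) {f v : ℝ → E} {T D : ℝ}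
    (hv : ∀ t, HasDerivAt v (B (v t) + f t) t) (hf : ∀ t, ‖f t‖ ≤ D) {t : ℝ} (ht : t ∈ Icc 0 T) :
    ‖v t‖ ≤ Real.exp ((‖B‖ + 1) * T) * (‖v 0‖ + D) := by
  have hD : 0 ≤ D := (norm_nonneg _).trans (hf 0)
  -- The rate ‖B‖ + 1 instead of ‖B‖ keeps the divisor in Grönwall's bound at least 1.
  have h := norm_le_gronwallBound_of_norm_deriv_right_le (f := v) (K := ‖B‖ + 1) (ε := D)
    (δ := ‖v 0‖) (a := 0) (b := T) (fun s _ => (hv s).continuousAt.continuousWithinAt)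
    (fun s _ => (hv s).hasDerivWithinAt) le_rfl
    (fun s _ => (norm_add_le _ _).trans (add_le_add ((B.le_opNorm _).trans
      (mul_le_mul_of_nonneg_right (by linarith) (norm_nonneg _))) (hf s))) t ht
  have hB := norm_nonneg B
  have hK : ‖B‖ + 1 ≠ 0 := by positivity
  rw [gronwallBound_of_K_ne_0 hK, sub_zero] at h
  have h1 : Real.exp ((‖B‖ + 1) * t) ≤ Real.exp ((‖B‖ + 1) * T) := by
    gcongr
    exact ht.2
  have h2 : D / (‖B‖ + 1) ≤ D := div_le_self hD (by linarith)
  calc ‖v t‖ ≤ ‖v 0‖ * Real.exp ((‖B‖ + 1) * T) + D * Real.exp ((‖B‖ + 1) * T) := by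
        refine h.trans (add_le_add (by gcongr) ?_)
        refine mul_le_mul h2 (by linarith) ?_ hD
        have := Real.one_le_exp (mul_nonneg (by linarith : 0 ≤ ‖B‖ + 1) ht.1)
        linarith
    _ = _ := by ring

variable [CompleteSpace E]

lemma hasDerivAt_exp_apply (B : E →L[ℝ] E) (x : E) (t : ℝ) :
    HasDerivAt (fun s : ℝ => NormedSpace.exp (s • B) x) (B (NormedSpace.exp (t • B) x)) t :=
  (ContinuousLinearMap.apply ℝ E x).hasFDerivAt.comp_hasDerivAt t (hasDerivAt_exp_smul_const' B t)

lemma exists_linear_ode (B : E →L[ℝ] E) {f : ℝ → E} (hf : Continuous f) (x : E) :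
    ∃ v : ℝ → E, v 0 = x ∧ ∀ t, HasDerivAt v (B (v t) + f t) t := by
  have hexp : Continuous fun s : ℝ => NormedSpace.exp (s • B) :=
    continuous_iff_continuousAt.2 fun t => (hasDerivAt_exp_smul_const B t).continuousAt
  have hg : Continuous fun s : ℝ => NormedSpace.exp ((-s) • B) (f s) :=
    (hexp.comp continuous_neg).clm_apply hf
  refine ⟨fun t => NormedSpace.exp (t • B)
    (x + ∫ s in (0 : ℝ)..t, NormedSpace.exp ((-s) • B) (f s)), by simp, fun t => ?_⟩
  have h1 : HasDerivAt (fun t => x + ∫ s in (0 : ℝ)..t, NormedSpace.exp ((-s) • B) (f s))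
      (NormedSpace.exp ((-t) • B) (f t)) t :=
    (intervalIntegral.integral_hasDerivAt_right (hg.intervalIntegrable _ _)
      (hg.stronglyMeasurableAtFilter _ _) hg.continuousAt).const_add x
  refine ((hasDerivAt_exp_smul_const' B t).clm_apply h1).congr_deriv ?_
  have h2 : NormedSpace.exp (t • B) * NormedSpace.exp ((-t) • B) = 1 := by
    let _ : NormedAlgebra ℚ (E →L[ℝ] E) := NormedAlgebra.restrictScalars ℚ ℝ _
    rw [neg_smul, ← NormedSpace.exp_add_of_commute (Commute.neg_right (Commute.refl _)),
      add_neg_cancel, NormedSpace.exp_zero]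
  have h3 : NormedSpace.exp (t • B) (NormedSpace.exp ((-t) • B) (f t)) = f t :=
    congrArg (fun g : E →L[ℝ] E => g (f t)) h2
  rw [h3]
  rfl

end LinearODE

/-! ### Periodic functions as functions on the circle -/

section Circle

lemma periodic_coe_comp {F : Type*} {T : ℝ} (v : AddCircle T → F) :
    Function.Periodic (fun t : ℝ => v t) T :=
  fun t => by simp

variable {F : Type*} [TopologicalSpace F] {T : ℝ}

/-- A continuous periodic function as a continuous function on the circle. -/
def ofPeriodic (f : ℝ → F) (hc : Continuous f) (hp : Function.Periodic f T) :
    C(AddCircle T, F) :=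
  ⟨hp.lift, hc.quotient_liftOn' _⟩

@[simp] lemma ofPeriodic_coe (f : ℝ → F) (hc : Continuous f) (hp : Function.Periodic f T)
    (t : ℝ) : ofPeriodic f hc hp (t : AddCircle T) = f t := rfl

end Circle

/-! ### Invertibility of the linearized periodic problem -/

namespace HopfData

variable {E : Type*} [NormedAddCommGroup E] [NormedSpace ℝ E] (H : HopfData E)

instance : Fact (0 < H.T₀) := ⟨H.T₀_pos⟩

/-- The linear center motion with amplitude one. -/
noncomputable def centerMotion : C(AddCircle H.T₀, E) :=
  ofPeriodic (fun t : ℝ => H.j (Complex.exp (Complex.I * H.ω₀ * t))) (by fun_prop) fun t => by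
    push_cast
    rw [mul_add, Complex.exp_add, H.exp_I_mul_T₀, mul_one]

lemma centerMotion_coe (t : ℝ) :
    H.centerMotion t = H.j (Complex.exp (Complex.I * H.ω₀ * t)) := rfl

/-- The inhomogeneous linear periodic problem, with the two solvability conditions absorbed by the
parameters `μ` and `ν`, and with normalized amplitude and phase. -/
def IsLinearSolution (h : C(AddCircle H.T₀, E)) (X : C(AddCircle H.T₀, E) × ℝ × ℝ) : Prop :=
  (∀ t : ℝ, HasDerivAt (fun t : ℝ => X.1 t) (H.A 0 (X.1 t) +
    (X.2.1 • H.A₁ (H.centerMotion t) + X.2.2 • H.A 0 (H.centerMotion t) + h t)) t) ∧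
    H.z (X.1 (0 : ℝ)) = 1

/-- The homogeneous linear problem has only the trivial solution. -/
lemma eq_zero_of_homogeneous {v : ℝ → E} {μ ν : ℝ}
    (hv : ∀ t : ℝ, HasDerivAt v (H.A 0 (v t) +
      (μ • H.A₁ (H.centerMotion t) + ν • H.A 0 (H.centerMotion t))) t)
    (hT : v H.T₀ = v 0) (hz : H.z (v 0) = 0) : v 0 = 0 ∧ μ = 0 ∧ ν = 0 := by
  have hω : (H.ω₀ : ℂ) ≠ 0 := by exact_mod_cast H.ω₀_ne
  have hper : Function.Periodic v H.T₀ := periodic_of_linear_ode _ hv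
    (periodic_coe_comp (fun θ => μ • H.A₁ (H.centerMotion θ) + ν • H.A 0 (H.centerMotion θ))) hT
  -- In the rotating frame the forcing becomes a + μd·exp(-2iω₀t). The resonant part a integrates to
  -- a secular term, the other part to b·exp(-2iω₀t), so G is constant.
  set a : ℂ := μ * H.c + ν * (Complex.I * H.ω₀) with ha
  set b : ℂ := μ * H.d * (Complex.I / (2 * H.ω₀)) with hb
  set G : ℝ → ℂ := fun t => Complex.exp (-(Complex.I * H.ω₀ * t)) * H.z (v t) -
    (a * t + b * Complex.exp (-(2 * (Complex.I * H.ω₀ * t)))) with hG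
  have hGd : ∀ t, HasDerivAt G 0 t := by
    intro t
    have h1 := H.hasDerivAt_exp_mul (H.hasDerivAt_z (hv t))
    have h2 : HasDerivAt (fun t : ℝ => a * (t : ℂ)) a t :=
      ((Complex.ofRealCLM.hasDerivAt (x := t)).const_mul a).congr_deriv (by simp)
    have h3 : HasDerivAt (fun t : ℝ => -(2 * (Complex.I * H.ω₀ * (t : ℂ))))
        (-(2 * (Complex.I * H.ω₀))) t :=
      (((Complex.ofRealCLM.hasDerivAt (x := t)).const_mul (Complex.I * H.ω₀)).const_mul
        2).neg.congr_deriv (by simp)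
    refine (h1.sub (h2.add (h3.cexp.const_mul b))).congr_deriv ?_
    rw [map_add, map_smul, map_smul, H.centerMotion_coe, H.z_A₁_j, H.z_A, H.z_j]
    have e1 : (starRingEnd ℂ) (Complex.exp (Complex.I * H.ω₀ * t)) =
        Complex.exp (-(Complex.I * H.ω₀ * t)) := by
      rw [← Complex.exp_conj]
      simp
    have e2 : Complex.exp (-(2 * (Complex.I * H.ω₀ * t))) =
        Complex.exp (-(Complex.I * H.ω₀ * t)) * Complex.exp (-(Complex.I * H.ω₀ * t)) := by
      rw [← Complex.exp_add]
      congr 1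
      ring
    have e3 : Complex.exp (-(Complex.I * H.ω₀ * t)) * Complex.exp (Complex.I * H.ω₀ * t) = 1 := by
      rw [← Complex.exp_add]
      simp
    have e4 : b * (2 * (Complex.I * H.ω₀)) = -(μ * H.d) := by
      rw [hb]
      field_simp
      linear_combination μ * H.d * Complex.I_sq
    rw [e1, e2, Complex.real_smul, Complex.real_smul, ha]
    linear_combination (μ * H.c + ν * (Complex.I * H.ω₀)) * e3 +
      Complex.exp (-(Complex.I * H.ω₀ * t)) * Complex.exp (-(Complex.I * H.ω₀ * t)) * e4
  have hGc : ∀ t, G t = G 0 := fun t =>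
    is_const_of_deriv_eq_zero (fun t => (hGd t).differentiableAt) (fun t => (hGd t).deriv) t 0
  have hexpT : Complex.exp (-(Complex.I * H.ω₀ * H.T₀)) = 1 := by
    rw [Complex.exp_neg, H.exp_I_mul_T₀, inv_one]
  have hexpT2 : Complex.exp (-(2 * (Complex.I * H.ω₀ * H.T₀))) = 1 := by
    rw [show -(2 * (Complex.I * H.ω₀ * H.T₀)) = -(Complex.I * H.ω₀ * H.T₀)
      + -(Complex.I * H.ω₀ * H.T₀) by ring, Complex.exp_add, hexpT, mul_one]
  have ha0 : a = 0 := by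
    have h1 := hGc H.T₀
    simp only [hG, hT, hz, hexpT2] at h1
    have h2 : a * H.T₀ = 0 := by simpa using h1
    exact (mul_eq_zero.1 h2).resolve_right (by exact_mod_cast H.T₀_pos.ne')
  have hμ : μ = 0 := by
    have h1 := congrArg Complex.re ha0
    simp only [ha, Complex.add_re, Complex.mul_re, Complex.I_re,
      Complex.I_im, Complex.ofReal_re, Complex.ofReal_im, Complex.zero_re] at h1
    -- The term with ν is purely imaginary, so the real part isolates μ; this is where
    -- transversality enters.
    have h2 : μ * H.c.re = 0 := by linarith
    exact (mul_eq_zero.1 h2).resolve_right H.c_re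
  have hν : ν = 0 := by
    have h1 : (ν : ℂ) * (Complex.I * H.ω₀) = 0 := by simpa [ha, hμ] using ha0
    simpa [hω] using h1
  refine ⟨?_, hμ, hν⟩
  obtain ⟨K, η, hK, hη, hyp⟩ := H.hyperbolic
  have hvc : Continuous v := continuous_iff_continuousAt.2 fun t => (hv t).continuousAt
  obtain ⟨M, hM⟩ : ∃ M, ∀ t, ‖v t‖ ≤ M := by
    set V := ofPeriodic v hvc hper
    exact ⟨‖V‖, fun t => V.norm_coe_le_norm t⟩
  have hzv : ∀ t, H.z (v t) = 0 := by
    intro t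
    have h1 := hGc t
    simp only [hG, hz, ha0, hb, hμ] at h1
    simpa using h1
  have := hyp v (fun _ => 0) M 0 hM (fun t => by simpa [hμ, hν] using hv t) hzv (by simp) 0
  simpa using this

variable [FiniteDimensional ℝ E] [CompleteSpace E]

lemma exists_linear_solution_operator : ∃ K : ℝ, 0 < K ∧
    (∀ h, ∃ X, H.IsLinearSolution h X) ∧
    ∀ h h' X X', H.IsLinearSolution h X → H.IsLinearSolution h' X' →
      ‖X - X'‖ ≤ K * ‖h - h'‖ := by
  choose S hS0 hS using fun h : C(AddCircle H.T₀, E) =>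
    exists_linear_ode (H.A 0) (f := fun t : ℝ => h t) (by fun_prop) 0
  set m : C(AddCircle H.T₀, E) := ⟨fun θ => H.A₁ (H.centerMotion θ), by fun_prop⟩ with hm
  set n : C(AddCircle H.T₀, E) := ⟨fun θ => H.A 0 (H.centerMotion θ), by fun_prop⟩ with hn
  have hm' : ∀ t : ℝ, m t = H.A₁ (H.centerMotion t) := fun t => rfl
  have hn' : ∀ t : ℝ, n t = H.A 0 (H.centerMotion t) := fun t => rfl
  set v : E → ℝ → ℝ → ℝ → E := fun x μ ν t =>
    NormedSpace.exp (t • H.A 0) x + μ • S m t + ν • S n t with hvdef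
  have hv0 : ∀ x μ ν, v x μ ν 0 = x := fun x μ ν => by simp [hvdef, hS0]
  have hv : ∀ x μ ν t, HasDerivAt (v x μ ν) (H.A 0 (v x μ ν t) + (μ • m t + ν • n t)) t := by
    intro x μ ν t
    refine (((hasDerivAt_exp_apply (H.A 0) x t).add ((hS m t).const_smul μ)).add
      ((hS n t).const_smul ν)).congr_deriv ?_
    simp only [hvdef, map_add, map_smul, smul_add]
    abel
  -- Initial value and parameters are mapped to the periodicity defect and the normalization. The
  -- two real parameters match the two real dimensions of ℂ, so injectivity gives bijectivity.
  set Λ : E × ℝ × ℝ →ₗ[ℝ] E × ℂ :=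
    { toFun := fun p => (v p.1 p.2.1 p.2.2 H.T₀ - p.1, H.z p.1)
      map_add' := fun p p' => by
        simp only [hvdef, Prod.fst_add, Prod.snd_add, map_add, add_smul, Prod.mk_add_mk]
        congr 1
        abel
      map_smul' := fun c p => by
        simp [hvdef, smul_sub, mul_smul] } with hΛ
  have hΛ_apply : ∀ x μ ν, Λ (x, μ, ν) = (v x μ ν H.T₀ - x, H.z x) := fun _ _ _ => rfl
  have hker : LinearMap.ker Λ = ⊥ := by
    rw [LinearMap.ker_eq_bot']
    rintro ⟨x, μ, ν⟩ hx
    rw [hΛ_apply, Prod.mk_eq_zero] at hx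
    obtain ⟨h1, h2, h3⟩ := H.eq_zero_of_homogeneous (v := v x μ ν) (μ := μ) (ν := ν)
      (hv x μ ν) (by rw [hv0]; exact sub_eq_zero.1 hx.1) (by rw [hv0]; exact hx.2)
    rw [hv0] at h1
    simp [h1, h2, h3]
  have hsurj : Function.Surjective Λ := by
    rw [← LinearMap.injective_iff_surjective_of_finrank_eq_finrank]
    · exact LinearMap.ker_eq_bot.1 hker
    · simp [Module.finrank_prod, Complex.finrank_real_complex]
  obtain ⟨L, hL, hΛL⟩ := Λ.exists_antilipschitzWith hker
  have hΛL' : ∀ p, ‖p‖ ≤ L * ‖Λ p‖ := fun p => ZeroHomClass.bound_of_antilipschitz Λ hΛL p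
  set R := Real.exp ((‖H.A 0‖ + 1) * H.T₀) with hR
  have hR0 : 0 < R := Real.exp_pos _
  have hTmem : H.T₀ ∈ Icc 0 H.T₀ := right_mem_Icc.2 H.T₀_pos.le
  -- LR bounds the initial value and the two parameters; the second summand bounds v over one period
  -- by Grönwall.
  refine ⟨L * R + R * (L * R * (1 + ‖m‖ + ‖n‖) + 1), by positivity, fun h => ?_, ?_⟩
  · obtain ⟨⟨x, μ, ν⟩, hx⟩ := hsurj (-S h H.T₀, 1)
    rw [hΛ_apply, Prod.mk.injEq] at hx
    set w : ℝ → E := fun t => v x μ ν t + S h t with hw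
    have hwd : ∀ t, HasDerivAt w (H.A 0 (w t) + (μ • m t + ν • n t + h t)) t := fun t => by
      refine ((hv x μ ν t).add (hS h t)).congr_deriv ?_
      simp only [hw, map_add]
      abel
    have hw0 : w 0 = x := by simp [hw, hv0, hS0]
    have hwT : w H.T₀ = w 0 := by
      rw [hw0]
      change v x μ ν H.T₀ + S h H.T₀ = x
      rw [sub_eq_iff_eq_add.1 hx.1]
      abel
    have hper := periodic_of_linear_ode _ hwd
      (periodic_coe_comp (fun θ => μ • m θ + ν • n θ + h θ)) hwT
    refine ⟨(ofPeriodic w (continuous_iff_continuousAt.2 fun t => (hwd t).continuousAt) hper,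
      μ, ν), hwd, ?_⟩
    change H.z (w 0) = 1
    rw [hw0]
    exact hx.2
  · rintro h h' ⟨V, μ, ν⟩ ⟨V', μ', ν'⟩ ⟨h1, h1z⟩ ⟨h2, h2z⟩
    set d : ℝ → E := fun t => V t - V' t with hd
    set k := h - h' with hk
    have hdd : ∀ t, HasDerivAt d (H.A 0 (d t) +
        ((μ - μ') • m t + (ν - ν') • n t + k t)) t := fun t => by
      refine ((h1 t).sub (h2 t)).congr_deriv ?_
      simp only [hd, map_sub, sub_smul, hm', hn', hk, ContinuousMap.sub_apply]
      abel
    have hdper : Function.Periodic d H.T₀ := periodic_coe_comp (fun θ => V θ - V' θ)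
    have hdeq : d = fun t => v (d 0) (μ - μ') (ν - ν') t + S k t :=
      eq_of_linear_ode (H.A 0) hdd (fun t => by
        refine ((hv (d 0) (μ - μ') (ν - ν') t).add (hS k t)).congr_deriv ?_
        simp only [map_add]
        abel) (by simp [hv0, hS0])
    have hΛd : Λ (d 0, μ - μ', ν - ν') = (-S k H.T₀, 0) := by
      rw [hΛ_apply]
      have e1 := congrFun hdeq H.T₀
      have e2 : d H.T₀ = d 0 := by simpa using hdper 0
      rw [e2] at e1
      have e3 : H.z (d 0) = 0 := by
        simp only at h1z h2z
        simp only [hd, map_sub, h1z, h2z, sub_self]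
      rw [e3]
      congr 1
      rw [sub_eq_iff_eq_add, eq_neg_add_iff_add_eq, add_comm]
      exact e1.symm
    have hSk : ‖S k H.T₀‖ ≤ R * ‖k‖ := by
      have := norm_le_of_linear_ode (H.A 0) (hS k) (fun t => k.norm_coe_le_norm t) hTmem
      simpa [hS0] using this
    have hp : ‖((d 0, μ - μ', ν - ν') : E × ℝ × ℝ)‖ ≤ L * R * ‖k‖ := by
      refine (hΛL' _).trans ?_
      rw [hΛd, Prod.norm_mk, norm_neg, norm_zero, max_eq_left (norm_nonneg _), mul_assoc]
      gcongr
    have hd0 : ‖d 0‖ ≤ L * R * ‖k‖ := (norm_fst_le _).trans hp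
    have hμν := (norm_snd_le ((d 0, μ - μ', ν - ν') : E × ℝ × ℝ)).trans hp
    have hμ : ‖μ - μ'‖ ≤ L * R * ‖k‖ := (norm_fst_le _).trans hμν
    have hν : ‖ν - ν'‖ ≤ L * R * ‖k‖ := (norm_snd_le _).trans hμν
    have hforce : ∀ t : ℝ, ‖(μ - μ') • m t + (ν - ν') • n t + k t‖ ≤
        L * R * ‖k‖ * ‖m‖ + L * R * ‖k‖ * ‖n‖ + ‖k‖ := by
      intro t
      refine (norm_add₃_le).trans (add_le_add_three ?_ ?_ (k.norm_coe_le_norm t))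
      · rw [norm_smul]
        gcongr
        exact m.norm_coe_le_norm t
      · rw [norm_smul]
        gcongr
        exact n.norm_coe_le_norm t
    have hV : ‖V - V'‖ ≤ R * (L * R * (1 + ‖m‖ + ‖n‖) + 1) * ‖k‖ := by
      rw [ContinuousMap.norm_le _ (by positivity)]
      intro θ
      obtain ⟨t, ht, rfl⟩ : θ ∈ (fun t : ℝ => (t : AddCircle H.T₀)) '' Ico 0 (0 + H.T₀) := by
        rw [AddCircle.coe_image_Ico_eq]
        exact mem_univ θ
      rw [zero_add] at ht
      have := norm_le_of_linear_ode (H.A 0) hdd hforce (T := H.T₀) (t := t) ⟨ht.1, ht.2.le⟩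
      refine this.trans ?_
      calc _ ≤ R * (L * R * ‖k‖ + (L * R * ‖k‖ * ‖m‖ + L * R * ‖k‖ * ‖n‖ + ‖k‖)) := by
            gcongr
        _ = _ := by ring
    have hLR : 0 ≤ L * R * ‖k‖ := by positivity
    have hRR : 0 ≤ R * (L * R * (1 + ‖m‖ + ‖n‖) + 1) * ‖k‖ := by positivity
    rw [Prod.norm_def, Prod.norm_def, add_mul]
    refine max_le (hV.trans (le_add_of_nonneg_left hLR)) (max_le ?_ ?_)
    · exact hμ.trans (le_add_of_nonneg_right hRR)
    · exact hν.trans (le_add_of_nonneg_right hRR)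

end HopfData

/-! ### The nonlinear periodic problem as a contraction -/

namespace HopfData

variable {E : Type*} [NormedAddCommGroup E] [NormedSpace ℝ E] (H : HopfData E)

/-- The remainder of the periodic problem after subtraction of its linearization at the linear
center motion. -/
noncomputable def remainder (g : C(E, E)) (X : C(AddCircle H.T₀, E) × ℝ × ℝ) :
    C(AddCircle H.T₀, E) :=
  ⟨fun θ => (1 + X.2.2) • (H.A X.2.1 (X.1 θ) + g (X.1 θ)) - H.A 0 (X.1 θ) -
    X.2.1 • H.A₁ (H.centerMotion θ) - X.2.2 • H.A 0 (H.centerMotion θ), by fun_prop⟩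

lemma remainder_apply (g : C(E, E)) (X : C(AddCircle H.T₀, E) × ℝ × ℝ) (θ : AddCircle H.T₀) :
    H.remainder g X θ = (1 + X.2.2) • (H.A X.2.1 (X.1 θ) + g (X.1 θ)) - H.A 0 (X.1 θ) -
    X.2.1 • H.A₁ (H.centerMotion θ) - X.2.2 • H.A 0 (H.centerMotion θ) := rfl

/-- Periodic solutions `X = (v, μ, ν)` of the system with nonlinearity `g` at the parameter `μ`,
where time is scaled by `1 + ν` in order to fix the period, normalized at time `0`. -/
def IsPeriodicSolution (g : E → E) (X : C(AddCircle H.T₀, E) × ℝ × ℝ) : Prop :=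
  (∀ t : ℝ, HasDerivAt (fun t : ℝ => X.1 t)
    ((1 + X.2.2) • (H.A X.2.1 (X.1 t) + g (X.1 t))) t) ∧ H.z (X.1 (0 : ℝ)) = 1

/-- Rewrites the periodic problem as a fixed-point equation: solve the linear problem with the
remainder of X as right-hand side and demand X back. -/
lemma isLinearSolution_remainder_iff (g : C(E, E)) (X : C(AddCircle H.T₀, E) × ℝ × ℝ) :
    H.IsLinearSolution (H.remainder g X) X ↔ H.IsPeriodicSolution g X := by
  refine and_congr_left' (forall_congr' fun t => ?_)
  have : H.A 0 (X.1 t) + (X.2.1 • H.A₁ (H.centerMotion t) + X.2.2 • H.A 0 (H.centerMotion t) +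
      H.remainder g X t) = (1 + X.2.2) • (H.A X.2.1 (X.1 t) + g (X.1 t)) := by
    rw [remainder_apply]
    abel
  rw [this]

/-- The linear center motion as a solution of the linear problem. -/
noncomputable def X₀ : C(AddCircle H.T₀, E) × ℝ × ℝ := (H.centerMotion, 0, 0)

lemma isPeriodicSolution_X₀ : H.IsPeriodicSolution (0 : C(E, E)) H.X₀ := by
  constructor
  · intro t
    have h1 : HasDerivAt (fun t : ℝ => Complex.exp (Complex.I * H.ω₀ * t))
        (Complex.exp (Complex.I * H.ω₀ * t) * (Complex.I * H.ω₀)) t :=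
      (((Complex.ofRealCLM.hasDerivAt (x := t)).const_mul (Complex.I * H.ω₀)).congr_deriv
        (by simp)).cexp
    refine (H.j.hasFDerivAt.comp_hasDerivAt t h1).congr_deriv ?_
    simp [X₀, H.centerMotion_coe, H.A_j, mul_comm]
  · simp only [X₀]
    rw [H.centerMotion_coe, H.z_j]
    simp

lemma exists_strictDeriv_bound {r : ℝ} (hr : 0 < r) : ∃ δ : ℝ, 0 < δ ∧ ∀ μ μ' : ℝ,
    |μ| ≤ δ → |μ'| ≤ δ → ‖H.A μ - H.A μ' - (μ - μ') • H.A₁‖ ≤ r * |μ - μ'| := by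
  have h1 := H.strictDeriv.hasStrictFDerivAt.isLittleO.def hr
  obtain ⟨δ, hδ, h⟩ := Metric.eventually_nhds_iff_ball.1 h1
  refine ⟨δ / 2, by positivity, fun μ μ' hμ hμ' => ?_⟩
  have h2 := h (μ, μ') ?_
  · simpa using h2
  rw [Metric.mem_ball, dist_eq_norm, Prod.mk_sub_mk, sub_zero, sub_zero, Prod.norm_mk,
    Real.norm_eq_abs, Real.norm_eq_abs]
  exact max_lt (by linarith) (by linarith)

/-- With R(μ) = A(μ) - A(0) - μA₁ the remainder equals μA₁(x - w) + νA(0)(x - w) + νμA₁x + (1 +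
ν)(R(μ)x + g(x)). The first three terms are products of two small factors or small parameters, hence
have Lipschitz constant O(δ); the last is controlled by strict differentiability of A (constant r)
and by the Lipschitz constant ε of g. -/
lemma norm_remainder_le {g : C(E, E)} {M δ r ε μ μ' ν ν' d : ℝ} {w x x' : E}
    (hδ1 : δ ≤ 1) (hε : 0 ≤ ε) (hr0 : 0 ≤ r)
    (hr : ∀ μ μ' : ℝ, |μ| ≤ δ → |μ'| ≤ δ →
      ‖H.A μ - H.A μ' - (μ - μ') • H.A₁‖ ≤ r * |μ - μ'|)
    (hg : ∀ x y, ‖g x - g y‖ ≤ ε * ‖x - y‖) (hg0 : g 0 = 0)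
    (hx : ‖x - w‖ ≤ δ) (hx' : ‖x' - w‖ ≤ δ) (hxM : ‖x‖ ≤ M) (hxM' : ‖x'‖ ≤ M)
    (hμ : |μ| ≤ δ) (hμ' : |μ'| ≤ δ) (hν : |ν| ≤ δ) (hν' : |ν'| ≤ δ)
    (hdx : ‖x - x'‖ ≤ d) (hdμ : |μ - μ'| ≤ d) (hdν : |ν - ν'| ≤ d) :
    ‖((1 + ν) • (H.A μ x + g x) - H.A 0 x - μ • H.A₁ w - ν • H.A 0 w) -
      ((1 + ν') • (H.A μ' x' + g x') - H.A 0 x' - μ' • H.A₁ w - ν' • H.A 0 w)‖ ≤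
      (δ * (2 * ‖H.A₁‖ + 2 * ‖H.A 0‖ + ‖H.A₁‖ * (2 * M + 1)) + (r + ε) * (3 * M + 2)) * d := by
  have hδ0 : 0 ≤ δ := (norm_nonneg _).trans hx
  have hM0 : 0 ≤ M := (norm_nonneg _).trans hxM
  have hd0 : 0 ≤ d := (norm_nonneg _).trans hdx
  have ha1 := norm_nonneg H.A₁
  have ha0 := norm_nonneg (H.A 0)
  set R : ℝ → E →L[ℝ] E := fun μ => H.A μ - H.A 0 - μ • H.A₁ with hR
  have hR0 : ∀ μ : ℝ, |μ| ≤ δ → ‖R μ‖ ≤ r * δ := fun μ hμ => by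
    have := hr μ 0 hμ (by simpa using hδ0)
    rw [sub_zero] at this
    exact this.trans (by gcongr)
  have hRd : ‖R μ - R μ'‖ ≤ r * d := by
    have h1 : R μ - R μ' = H.A μ - H.A μ' - (μ - μ') • H.A₁ := by
      simp only [hR, sub_smul]
      abel
    rw [h1]
    exact (hr μ μ' hμ hμ').trans (by gcongr)
  have hgM : ‖g x'‖ ≤ ε * M := by
    have := hg x' 0
    rw [hg0, sub_zero, sub_zero] at this
    exact this.trans (by gcongr)
  -- two ways to estimate a difference of products
  have hlin : ∀ (B : E →L[ℝ] E) (s s' : ℝ), |s| ≤ δ → |s - s'| ≤ d →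
      ‖s • B (x - w) - s' • B (x' - w)‖ ≤ δ * (2 * ‖B‖) * d := by
    intro B s s' hs hss
    have h1 : s • B (x - w) - s' • B (x' - w) = s • B (x - x') + (s - s') • B (x' - w) := by
      simp only [map_sub, smul_sub, sub_smul]
      abel
    rw [h1]
    calc _ ≤ δ * (‖B‖ * d) + d * (‖B‖ * δ) := by
          refine (norm_add_le _ _).trans (add_le_add ?_ ?_) <;> rw [norm_smul, Real.norm_eq_abs]
          · gcongr
            exact (B.le_opNorm _).trans (by gcongr)
          · gcongr
            exact (B.le_opNorm _).trans (by gcongr)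
      _ = _ := by ring
  have hquad : ‖(ν * μ) • H.A₁ x - (ν' * μ') • H.A₁ x'‖ ≤ δ * (‖H.A₁‖ * (2 * M + 1)) * d := by
    have h1 : (ν * μ) • H.A₁ x - (ν' * μ') • H.A₁ x' =
        (ν * μ) • H.A₁ (x - x') + ((ν - ν') * μ + ν' * (μ - μ')) • H.A₁ x' := by
      simp only [map_sub, smul_sub]
      rw [show (ν - ν') * μ + ν' * (μ - μ') = ν * μ - ν' * μ' by ring, sub_smul]
      abel
    have h2 : |ν * μ| ≤ δ * 1 := by
      rw [abs_mul]
      gcongr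
      exact hμ.trans hδ1
    have h3 : |(ν - ν') * μ + ν' * (μ - μ')| ≤ d * δ + δ * d := by
      refine (abs_add_le _ _).trans ?_
      rw [abs_mul, abs_mul]
      gcongr
    rw [h1]
    calc _ ≤ δ * 1 * (‖H.A₁‖ * d) + (d * δ + δ * d) * (‖H.A₁‖ * M) := by
          refine (norm_add_le _ _).trans (add_le_add ?_ ?_) <;> rw [norm_smul, Real.norm_eq_abs]
          · gcongr
            exact (H.A₁.le_opNorm _).trans (by gcongr)
          · gcongr
            exact (H.A₁.le_opNorm _).trans (by gcongr)
      _ = _ := by ring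
  have hnl : ‖(1 + ν) • (R μ x + g x) - (1 + ν') • (R μ' x' + g x')‖ ≤
      (r + ε) * (3 * M + 2) * d := by
    have h1 : (1 + ν) • (R μ x + g x) - (1 + ν') • (R μ' x' + g x') =
        (1 + ν) • ((R μ - R μ') x + R μ' (x - x') + (g x - g x')) +
          (ν - ν') • (R μ' x' + g x') := by
      simp only [map_sub, sub_apply, smul_add, smul_sub, add_smul, sub_smul, one_smul]
      abel
    have h2 : |1 + ν| ≤ 2 := by
      rw [abs_le] at hν ⊢
      constructor <;> linarith
    rw [h1]
    calc _ ≤ 2 * (r * d * M + r * δ * d + ε * d) + d * (r * δ * M + ε * M) := by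
          refine (norm_add_le _ _).trans (add_le_add ?_ ?_) <;> rw [norm_smul, Real.norm_eq_abs]
          · gcongr
            refine norm_add₃_le.trans (add_le_add_three ?_ ?_ ?_)
            · exact ((R μ - R μ').le_opNorm _).trans (by gcongr)
            · exact ((R μ').le_opNorm _).trans
                (mul_le_mul (hR0 μ' hμ') hdx (norm_nonneg _) (by positivity))
            · exact (hg _ _).trans (by gcongr)
          · gcongr
            refine (norm_add_le _ _).trans (add_le_add ?_ hgM)
            exact ((R μ').le_opNorm _).trans
              (mul_le_mul (hR0 μ' hμ') hxM' (norm_nonneg _) (by positivity))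
      _ = (r * (2 * M + 2 * δ + δ * M) + ε * (2 + M)) * d := by ring
      _ ≤ (r * (2 * M + 2 * 1 + 1 * M) + ε * (2 + 3 * M)) * d := by
          gcongr
          linarith
      _ = _ := by ring
  have hsplit : ∀ (x : E) (μ ν : ℝ),
      (1 + ν) • (H.A μ x + g x) - H.A 0 x - μ • H.A₁ w - ν • H.A 0 w =
      μ • H.A₁ (x - w) + ν • H.A 0 (x - w) + (ν * μ) • H.A₁ x + (1 + ν) • (R μ x + g x) := by
    intro x μ ν
    simp only [hR, map_sub, sub_apply, smul_apply, smul_add, smul_sub, add_smul, one_smul,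
      mul_smul]
    abel
  have hcomb : ∀ a b c e a' b' c' e' : E, a + b + c + e - (a' + b' + c' + e') =
      (a - a') + (b - b') + (c - c') + (e - e') := fun _ _ _ _ _ _ _ _ => by abel
  rw [hsplit, hsplit, hcomb]
  calc _ ≤ δ * (2 * ‖H.A₁‖) * d + δ * (2 * ‖H.A 0‖) * d + δ * (‖H.A₁‖ * (2 * M + 1)) * d
        + (r + ε) * (3 * M + 2) * d :=
        norm_add₄_le.trans (add_le_add (add_le_add_three (hlin _ _ _ hμ hdμ) (hlin _ _ _ hν hdν)
          hquad) hnl)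
    _ = _ := by ring

/-- In a small ball the remainder of the periodic problem has small Lipschitz constant. -/
lemma exists_remainder_lipschitz {κ : ℝ} (hκ : 0 < κ) : ∃ δ ε : ℝ, 0 < δ ∧ δ ≤ 1 / 2 ∧ 0 < ε ∧
    ∀ g : C(E, E), (∀ x y, ‖g x - g y‖ ≤ ε * ‖x - y‖) → g 0 = 0 →
      ∀ X X', ‖X - H.X₀‖ ≤ δ → ‖X' - H.X₀‖ ≤ δ →
        ‖H.remainder g X - H.remainder g X'‖ ≤ κ * ‖X - X'‖ := by
  set M := ‖H.centerMotion‖ + 1 with hM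
  have hM0 : 0 < M := by positivity
  set S : ℝ := 2 * ‖H.A₁‖ + 2 * ‖H.A 0‖ + ‖H.A₁‖ * (2 * M + 1) + 1 with hS
  have hS0 : 0 < S := by positivity
  set r : ℝ := κ / (4 * (3 * M + 2)) with hr
  have hr0 : 0 < r := by positivity
  obtain ⟨δ₁, hδ₁, hstrict⟩ := H.exists_strictDeriv_bound hr0
  set δ := min δ₁ (min (1 / 2) (κ / (2 * S))) with hδ
  have hδ1 : δ ≤ δ₁ := min_le_left _ _
  have hδ2 : δ ≤ 1 / 2 := (min_le_right _ _).trans (min_le_left _ _)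
  have hδ3 : δ ≤ κ / (2 * S) := (min_le_right _ _).trans (min_le_right _ _)
  have hδ0 : 0 < δ := lt_min hδ₁ (lt_min (by norm_num) (by positivity))
  refine ⟨δ, r, hδ0, hδ2, hr0, fun g hg hg0 X X' hX hX' => ?_⟩
  have hcomp : ∀ Y : C(AddCircle H.T₀, E) × ℝ × ℝ, ‖Y - H.X₀‖ ≤ δ →
      (∀ θ, ‖Y.1 θ - H.centerMotion θ‖ ≤ δ) ∧ (∀ θ, ‖Y.1 θ‖ ≤ M) ∧ |Y.2.1| ≤ δ ∧ |Y.2.2| ≤ δ := by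
    intro Y hY
    have h1 : ∀ θ, ‖Y.1 θ - H.centerMotion θ‖ ≤ δ := fun θ =>
      ((Y.1 - H.centerMotion).norm_coe_le_norm θ).trans ((norm_fst_le (Y - H.X₀)).trans hY)
    have h2 := (norm_snd_le (Y - H.X₀)).trans hY
    refine ⟨h1, fun θ => ?_, ?_, ?_⟩
    · have h3 := norm_le_norm_add_norm_sub' (Y.1 θ) (H.centerMotion θ)
      have h4 := H.centerMotion.norm_coe_le_norm θ
      linarith [h1 θ]
    · simpa [X₀] using (norm_fst_le (Y - H.X₀).2).trans h2
    · simpa [X₀] using (norm_snd_le (Y - H.X₀).2).trans h2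
  obtain ⟨h1, h2, h3, h4⟩ := hcomp X hX
  obtain ⟨h1', h2', h3', h4'⟩ := hcomp X' hX'
  rw [ContinuousMap.norm_le _ (by positivity)]
  intro θ
  have hsnd := norm_snd_le (X - X')
  refine (H.norm_remainder_le (M := M) (δ := δ) (r := r) (ε := r) (d := ‖X - X'‖) (by linarith)
    hr0.le hr0.le (fun μ μ' h h' => hstrict μ μ' (h.trans hδ1) (h'.trans hδ1)) hg hg0 (h1 θ)
    (h1' θ) (h2 θ) (h2' θ) h3 h3' h4 h4'
    (((X.1 - X'.1).norm_coe_le_norm θ).trans (norm_fst_le (X - X')))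
    ((norm_fst_le (X - X').2).trans hsnd) ((norm_snd_le (X - X').2).trans hsnd)).trans ?_
  gcongr
  have h5 : (r + r) * (3 * M + 2) = κ / 2 := by
    rw [hr]
    field_simp
    ring
  have h6 : δ * S ≤ κ / 2 := by
    calc δ * S ≤ κ / (2 * S) * S := by gcongr
      _ = κ / 2 := by field_simp
  have h7 : δ * (2 * ‖H.A₁‖ + 2 * ‖H.A 0‖ + ‖H.A₁‖ * (2 * M + 1)) ≤ δ * S := by
    exact mul_le_mul_of_nonneg_left (by linarith) hδ0.le
  linarith

variable [FiniteDimensional ℝ E] [CompleteSpace E]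

/-- Existence of a periodic solution near the linear center motion, and its dependence on the
nonlinearity. -/
lemma exists_periodicSolution : ∃ δ ε K : ℝ, 0 < δ ∧ δ ≤ 1 / 2 ∧ 0 < ε ∧ 0 < K ∧
    (∀ g : C(E, E), (∀ x y, ‖g x - g y‖ ≤ ε * ‖x - y‖) → g 0 = 0 →
      ∃ X, ‖X - H.X₀‖ ≤ δ ∧ H.IsPeriodicSolution g X) ∧
    ∀ (g g' : C(E, E)) (X X' : C(AddCircle H.T₀, E) × ℝ × ℝ) (B : ℝ),
      (∀ x y, ‖g x - g y‖ ≤ ε * ‖x - y‖) → g 0 = 0 →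
      ‖X - H.X₀‖ ≤ δ → ‖X' - H.X₀‖ ≤ δ → H.IsPeriodicSolution g X →
      H.IsPeriodicSolution g' X' → (∀ θ, ‖g (X'.1 θ) - g' (X'.1 θ)‖ ≤ B) → ‖X - X'‖ ≤ K * B := by
  obtain ⟨K, hK, hex, hbd⟩ := H.exists_linear_solution_operator
  obtain ⟨δ, ε₁, hδ, hδ1, hε₁, hlip⟩ := H.exists_remainder_lipschitz (κ := 1 / (2 * K))
    (by positivity)
  set m := ‖H.centerMotion‖ + 1 with hm
  have hm0 : 0 < m := by positivity
  set ε := min ε₁ (δ / (2 * K * m)) with hε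
  have hε0 : 0 < ε := lt_min hε₁ (by positivity)
  have hlip' : ∀ g : C(E, E), (∀ x y, ‖g x - g y‖ ≤ ε * ‖x - y‖) → g 0 = 0 →
      ∀ X X', ‖X - H.X₀‖ ≤ δ → ‖X' - H.X₀‖ ≤ δ →
        K * ‖H.remainder g X - H.remainder g X'‖ ≤ 1 / 2 * ‖X - X'‖ := by
    intro g hg hg0 X X' hX hX'
    have h1 := hlip g (fun x y => (hg x y).trans (by gcongr; exact min_le_left _ _)) hg0 X X' hX hX'
    calc _ ≤ K * (1 / (2 * K) * ‖X - X'‖) := by gcongr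
      _ = _ := by field_simp
  refine ⟨δ, ε, 4 * K, hδ, hδ1, hε0, by positivity, ?_, ?_⟩
  · intro g hg hg0
    -- The linear bound gives Φ Lipschitz constant K · 1/(2K) = 1/2 on the δ-ball.
    choose Φ hΦ using fun X => hex (H.remainder g X)
    have hΦlip : ∀ X X', ‖X - H.X₀‖ ≤ δ → ‖X' - H.X₀‖ ≤ δ → ‖Φ X - Φ X'‖ ≤ 1 / 2 * ‖X - X'‖ :=
      fun X X' hX hX' => (hbd _ _ _ _ (hΦ X) (hΦ X')).trans (hlip' g hg hg0 X X' hX hX')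
    have hX₀ : ‖H.X₀ - H.X₀‖ ≤ δ := by simpa using hδ.le
    -- The center motion solves the problem with g = 0, so Φ moves it only by the effect of g; with
    -- the factor 1/2 this keeps the δ-ball invariant.
    have hΦ₀ : ‖Φ H.X₀ - H.X₀‖ ≤ δ / 2 := by
      refine (hbd _ _ _ _ (hΦ H.X₀)
        ((H.isLinearSolution_remainder_iff 0 _).2 H.isPeriodicSolution_X₀)).trans ?_
      have h1 : ‖H.remainder g H.X₀ - H.remainder 0 H.X₀‖ ≤ ε * m := by
        rw [ContinuousMap.norm_le _ (by positivity)]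
        intro θ
        have h2 := hg (H.centerMotion θ) 0
        rw [hg0, sub_zero, sub_zero] at h2
        have h3 : (H.remainder g H.X₀ - H.remainder 0 H.X₀) θ = g (H.centerMotion θ) := by
          simp [remainder_apply, X₀]
        rw [h3]
        refine h2.trans ?_
        gcongr
        exact (H.centerMotion.norm_coe_le_norm θ).trans (by rw [hm]; linarith)
      calc _ ≤ K * (δ / (2 * K * m) * m) := by
            gcongr
            exact h1.trans (by gcongr; exact min_le_right _ _)
        _ = δ / 2 := by field_simp
    have hmaps : MapsTo Φ (Metric.closedBall H.X₀ δ) (Metric.closedBall H.X₀ δ) := by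
      intro X hX
      rw [mem_closedBall_iff_norm] at hX ⊢
      have h1 : Φ X - H.X₀ = (Φ X - Φ H.X₀) + (Φ H.X₀ - H.X₀) := by abel
      rw [h1]
      have h2 := hΦlip X H.X₀ hX hX₀
      exact (norm_add_le _ _).trans (by linarith)
    have hcontr : ContractingWith (1 / 2) (hmaps.restrict Φ _ _) := by
      refine ⟨by rw [← NNReal.coe_lt_coe]; norm_num, LipschitzWith.of_dist_le_mul ?_⟩
      rintro ⟨X, hX⟩ ⟨X', hX'⟩
      rw [mem_closedBall_iff_norm] at hX hX'
      rw [Subtype.dist_eq, Subtype.dist_eq, dist_eq_norm, dist_eq_norm]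
      have := hΦlip X X' hX hX'
      simpa using this
    obtain ⟨X, hX, hfix, -⟩ := hcontr.exists_fixedPoint' Metric.isClosed_closedBall.isComplete hmaps
      (x := H.X₀) (Metric.mem_closedBall_self hδ.le) (edist_ne_top _ _)
    refine ⟨X, mem_closedBall_iff_norm.1 hX, ?_⟩
    rw [← isLinearSolution_remainder_iff]
    have := hΦ X
    rwa [hfix] at this
  · intro g g' X X' B hg hg0 hX hX' hs hs' hB
    have h1 := hbd _ _ _ _ ((H.isLinearSolution_remainder_iff g X).2 hs)
      ((H.isLinearSolution_remainder_iff g' X').2 hs')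
    have hB0 : 0 ≤ B := (norm_nonneg _).trans (hB 0)
    have h2 : ‖H.remainder g X' - H.remainder g' X'‖ ≤ 2 * B := by
      rw [ContinuousMap.norm_le _ (by positivity)]
      intro θ
      have h3 : (H.remainder g X' - H.remainder g' X') θ =
          (1 + X'.2.2) • (g (X'.1 θ) - g' (X'.1 θ)) := by
        simp only [ContinuousMap.sub_apply, remainder_apply, smul_add, smul_sub]
        abel
      have h4 : |X'.2.2| ≤ δ := by
        have := (norm_snd_le (X' - H.X₀).2).trans ((norm_snd_le (X' - H.X₀)).trans hX')
        simpa [X₀] using this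
      have h5 : |1 + X'.2.2| ≤ 2 := by
        rw [abs_le] at h4 ⊢
        constructor <;> linarith
      rw [h3, norm_smul, Real.norm_eq_abs]
      gcongr
      exact hB θ
    -- Changing the solution and the nonlinearity separately gives ‖X - X'‖ ≤ ½‖X - X'‖ + 2KB,
    -- whence the constant 4K.
    have h3 : ‖H.remainder g X - H.remainder g' X'‖ ≤
        ‖H.remainder g X - H.remainder g X'‖ + 2 * B := by
      have : H.remainder g X - H.remainder g' X' = (H.remainder g X - H.remainder g X') +
        (H.remainder g X' - H.remainder g' X') := by abel
      rw [this]
      exact (norm_add_le _ _).trans (by gcongr)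
    have h4 := hlip' g hg hg0 X X' hX hX'
    have h5 := mul_le_mul_of_nonneg_left h3 hK.le
    linarith

end HopfData

/-! ### Regularity of real functions from difference bounds of the form (a - b)/a -/

section RealFunctions

variable {f : ℝ → ℝ} {a₀ C : ℝ}

lemma locallyLipschitzOn_of_le_div
    (hf : ∀ a b, 0 < b → b ≤ a → a < a₀ → |f a - f b| ≤ C * ((a - b) / a)) :
    LocallyLipschitzOn (Ioo 0 a₀) f := by
  intro x hx
  have hx0 : 0 < x := hx.1
  refine ⟨(C * (2 / x)).toNNReal, Ioo (x / 2) a₀,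
    mem_nhdsWithin_of_mem_nhds (Ioo_mem_nhds (by linarith) hx.2),
    LipschitzOnWith.of_dist_le_mul ?_⟩
  have hC : 0 ≤ C := by
    have h1 := (abs_nonneg _).trans (hf x (x / 2) (by linarith) (by linarith) hx.2)
    have h2 : (x - x / 2) / x = 1 / 2 := by
      field_simp
      ring
    rw [h2] at h1
    linarith
  have key : ∀ a ∈ Ioo (x / 2) a₀, ∀ b ∈ Ioo (x / 2) a₀, b ≤ a →
      |f a - f b| ≤ C * (2 / x) * (a - b) := by
    intro a ha b hb hba
    refine (hf a b (by linarith [hb.1]) hba ha.2).trans ?_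
    rw [mul_assoc]
    gcongr
    have ha0 : 0 < a := by linarith [ha.1]
    rw [div_le_iff₀ ha0, div_mul_eq_mul_div, div_mul_eq_mul_div, le_div_iff₀ hx0]
    have := mul_le_mul_of_nonneg_left (show x ≤ 2 * a by linarith [ha.1]) (sub_nonneg.2 hba)
    linarith
  intro a ha b hb
  rw [Real.coe_toNNReal _ (by positivity), Real.dist_eq, Real.dist_eq]
  rcases le_total b a with h | h
  · rw [abs_of_nonneg (sub_nonneg.2 h)]
    exact key a ha b hb h
  · rw [abs_sub_comm, abs_sub_comm a, abs_of_nonneg (sub_nonneg.2 h)]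
    exact key b hb a ha h

lemma continuousOn_of_le_div {C' : ℝ}
    (hf : ∀ a b, 0 < b → b ≤ a → a < a₀ → |f a - f b| ≤ C * ((a - b) / a))
    (hf0 : ∀ a ∈ Ico 0 a₀, |f a - f 0| ≤ C' * a) : ContinuousOn f (Ico 0 a₀) := by
  intro x hx
  rcases hx.1.eq_or_lt with rfl | hx0
  · rw [ContinuousWithinAt, tendsto_iff_dist_tendsto_zero]
    refine squeeze_zero' (g := fun a => C' * a) (Eventually.of_forall fun _ => dist_nonneg)
      (eventually_mem_nhdsWithin.mono hf0) ?_
    have : Tendsto (fun a : ℝ => C' * a) (𝓝 0) (𝓝 (C' * 0)) := tendsto_id.const_mul C'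
    rw [mul_zero] at this
    exact this.mono_left nhdsWithin_le_nhds
  · exact ((locallyLipschitzOn_of_le_div hf).continuousOn.continuousAt
      (Ioo_mem_nhds hx0 hx.2)).continuousWithinAt

lemma lipschitzOnWith_Ico_of_le {L : ℝ} (hL : 0 ≤ L)
    (hf : ∀ a b, 0 < b → b ≤ a → a < a₀ → |f a - f b| ≤ L * (a - b))
    (hf0 : ∀ a ∈ Ico 0 a₀, |f a - f 0| ≤ L * a) : LipschitzOnWith L.toNNReal f (Ico 0 a₀) := by
  refine LipschitzOnWith.of_dist_le_mul ?_
  have key : ∀ a ∈ Ico 0 a₀, ∀ b ∈ Ico 0 a₀, b ≤ a → |f a - f b| ≤ L * (a - b) := by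
    intro a ha b hb hba
    rcases hb.1.eq_or_lt with rfl | hb0
    · simpa using hf0 a ha
    · exact hf a b hb0 hba ha.2
  intro a ha b hb
  rw [Real.coe_toNNReal _ hL, Real.dist_eq, Real.dist_eq]
  rcases le_total b a with h | h
  · rw [abs_of_nonneg (sub_nonneg.2 h)]
    exact key a ha b hb h
  · rw [abs_sub_comm, abs_sub_comm a, abs_of_nonneg (sub_nonneg.2 h)]
    exact key b hb a ha h

end RealFunctions

/-- A perturbation ζ within |φ|/8 of 1 cannot undo a rotation by φ. Comparing real parts gives b cos
φ ≥ 1/2, so b ≥ 1/2 and |φ| ≤ π/2; then b|sin φ| ≥ |φ|/4, while the imaginary part of ζ is at most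
|φ|/8. -/
lemma eq_zero_of_exp_mul_eq_pos {φ b : ℝ} {ζ : ℂ} (hφ : |φ| ≤ Real.pi) (hb : 0 < b)
    (hζ : ‖ζ - 1‖ ≤ |φ| / 8) (h : Complex.exp (Complex.I * φ) * ζ = b) : φ = 0 := by
  have hpi := Real.pi_lt_d2
  have hpi0 := Real.pi_pos
  have hζ' : ζ = b * Complex.exp (((-φ : ℝ) : ℂ) * Complex.I) := by
    rw [← h, mul_right_comm, ← Complex.exp_add]
    simp [mul_comm]
  have hre : ζ.re = b * Real.cos φ := by
    rw [hζ', Complex.re_ofReal_mul, Complex.exp_ofReal_mul_I_re, Real.cos_neg]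
  have him : ζ.im = -(b * Real.sin φ) := by
    rw [hζ', Complex.im_ofReal_mul, Complex.exp_ofReal_mul_I_im, Real.sin_neg, mul_neg]
  have h1 : |ζ.re - 1| ≤ |φ| / 8 := by
    simpa using (Complex.abs_re_le_norm (ζ - 1)).trans hζ
  have h2 : |ζ.im| ≤ |φ| / 8 := by
    simpa using (Complex.abs_im_le_norm (ζ - 1)).trans hζ
  have h3 : 1 / 2 ≤ b * Real.cos φ := by
    rw [← hre]
    have := (abs_le.1 h1).1
    linarith
  have hcos : 0 < Real.cos φ := by
    by_contra! hc
    nlinarith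
  have hb2 : 1 / 2 ≤ b := h3.trans (by nlinarith [Real.cos_le_one φ])
  have hφ2 : |φ| ≤ Real.pi / 2 := by
    by_contra! hc
    have := Real.cos_nonpos_of_pi_div_two_le_of_le hc.le (by linarith)
    rw [Real.cos_abs] at this
    linarith
  have hsin := Real.mul_abs_le_abs_sin hφ2
  rw [him, abs_neg, abs_mul, abs_of_pos hb] at h2
  have h4 : 1 / 2 ≤ 2 / Real.pi := by
    rw [div_le_div_iff₀ two_pos hpi0]
    linarith
  have h5 : 1 / 2 * |φ| ≤ |Real.sin φ| :=
    (mul_le_mul_of_nonneg_right h4 (abs_nonneg φ)).trans hsin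
  have h6 : 1 / 2 * (1 / 2 * |φ|) ≤ b * |Real.sin φ| := by gcongr
  have h7 : |φ| = 0 := le_antisymm (by linarith) (abs_nonneg φ)
  exact abs_eq_zero.1 h7

/-! ### The blown-up nonlinearity -/

section Scaling

variable {E : Type*} [NormedAddCommGroup E] [NormedSpace ℝ E]

/-- The nonlinearity in the blown-up variable `x / a`. -/
noncomputable def scaled (G : C(E, E)) (a : ℝ) : C(E, E) :=
  ⟨fun x => a⁻¹ • G (a • x), by fun_prop⟩

lemma scaled_apply (G : C(E, E)) (a : ℝ) (x : E) : scaled G a x = a⁻¹ • G (a • x) := rfl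

/-- The convention 0⁻¹ = 0 makes a = 0 the linear problem, so the branch includes its starting point
without a separate case. -/
lemma scaled_zero (G : C(E, E)) : scaled G 0 = 0 := by
  ext x
  simp [scaled_apply]

lemma scaled_apply_zero {G : C(E, E)} (h0 : G 0 = 0) (a : ℝ) : scaled G a 0 = 0 := by
  simp [scaled_apply, h0]

lemma norm_scaled_sub_le {G : C(E, E)} {ε : ℝ} (hε : 0 ≤ ε)
    (hG : ∀ x y, ‖G x - G y‖ ≤ ε * ‖x - y‖)
    (a : ℝ) (x y : E) : ‖scaled G a x - scaled G a y‖ ≤ ε * ‖x - y‖ := by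
  rcases eq_or_ne a 0 with rfl | ha
  · simpa [scaled_zero] using mul_nonneg hε (norm_nonneg (x - y))
  · rw [scaled_apply, scaled_apply, ← smul_sub, norm_smul, norm_inv]
    have h1 := hG (a • x) (a • y)
    rw [← smul_sub, norm_smul] at h1
    calc ‖a‖⁻¹ * ‖G (a • x) - G (a • y)‖ ≤ ‖a‖⁻¹ * (ε * (‖a‖ * ‖x - y‖)) := by gcongr
      _ = _ := by
        have := norm_ne_zero_iff.2 ha
        field_simp

lemma norm_scaled_le {G : C(E, E)} {a C M : ℝ} (ha : 0 ≤ a)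
    (hG : ∀ x, ‖x‖ ≤ a * M → ‖G x‖ ≤ C * ‖x‖ ^ 2) {x : E} (hx : ‖x‖ ≤ M) :
    ‖scaled G a x‖ ≤ C * a * ‖x‖ ^ 2 := by
  rcases ha.eq_or_lt with rfl | ha
  · simp [scaled_zero]
  · have h1 := hG (a • x) (by rw [norm_smul, Real.norm_of_nonneg ha.le]; gcongr)
    rw [norm_smul, Real.norm_of_nonneg ha.le] at h1
    rw [scaled_apply, norm_smul, norm_inv, Real.norm_of_nonneg ha.le]
    calc a⁻¹ * ‖G (a • x)‖ ≤ a⁻¹ * (C * (a * ‖x‖) ^ 2) := by gcongr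
      _ = _ := by field_simp

lemma norm_scaled_sub_scaled_le {G : C(E, E)} {a b l M : ℝ} (hb : 0 < b) (hab : b ≤ a)
    (hl : 0 ≤ l) (h0 : G 0 = 0)
    (hG : ∀ x y, ‖x‖ ≤ a * M → ‖y‖ ≤ a * M → ‖G x - G y‖ ≤ l * ‖x - y‖) {x : E} (hx : ‖x‖ ≤ M) :
    ‖scaled G a x - scaled G b x‖ ≤ 2 * l * M * ((a - b) / a) := by
  have ha : 0 < a := hb.trans_le hab
  have hM : 0 ≤ M := (norm_nonneg x).trans hx
  have hax : ‖a • x‖ ≤ a * M := by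
    rw [norm_smul, Real.norm_of_nonneg ha.le]
    gcongr
  have hbx : ‖b • x‖ ≤ a * M := by
    rw [norm_smul, Real.norm_of_nonneg hb.le]
    gcongr
  -- Each of the two terms is at most lM(a - b)/a.
  have h1 : scaled G a x - scaled G b x =
      a⁻¹ • (G (a • x) - G (b • x)) + (a⁻¹ - b⁻¹) • G (b • x) := by
    rw [scaled_apply, scaled_apply, smul_sub, sub_smul]
    abel
  have h2 := hG _ _ hax hbx
  rw [← sub_smul, norm_smul, Real.norm_of_nonneg (sub_nonneg.2 hab)] at h2
  have h3 := hG (b • x) 0 hbx (by simpa using mul_nonneg ha.le hM)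
  rw [h0, sub_zero, sub_zero, norm_smul, Real.norm_of_nonneg hb.le] at h3
  have h4 : ‖a⁻¹ - b⁻¹‖ = (a - b) / (a * b) := by
    rw [Real.norm_eq_abs, abs_sub_comm, abs_of_nonneg (sub_nonneg.2 (inv_anti₀ hb hab))]
    field_simp
  rw [h1]
  have hab' : 0 ≤ a - b := sub_nonneg.2 hab
  calc _ ≤ a⁻¹ * (l * ((a - b) * M)) + (a - b) / (a * b) * (l * (b * M)) := by
        refine (norm_add_le _ _).trans (add_le_add ?_ ?_)
        · rw [norm_smul, norm_inv, Real.norm_of_nonneg ha.le]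
          gcongr
          exact h2.trans (by gcongr)
        · rw [norm_smul, h4]
          gcongr
          exact h3.trans (by gcongr)
    _ = _ := by
        field_simp
        ring

end Scaling

/-! ### The branch of blown-up solutions -/

namespace HopfData

variable {E : Type*} [NormedAddCommGroup E] [NormedSpace ℝ E] (H : HopfData E)

/-- Bound for the blown-up periodic solutions. -/
noncomputable def bound : ℝ := ‖H.centerMotion‖ + 1

lemma bound_pos : 0 < H.bound := by
  unfold bound
  positivity

variable {H} in
lemma near_X₀ {X : C(AddCircle H.T₀, E) × ℝ × ℝ} {δ : ℝ} (hX : ‖X - H.X₀‖ ≤ δ) :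
    (∀ θ, ‖X.1 θ - H.centerMotion θ‖ ≤ δ) ∧ |X.2.1| ≤ δ ∧ |X.2.2| ≤ δ := by
  have h2 := (norm_snd_le (X - H.X₀)).trans hX
  refine ⟨fun θ => ?_, ?_, ?_⟩
  · exact ((X.1 - H.centerMotion).norm_coe_le_norm θ).trans ((norm_fst_le (X - H.X₀)).trans hX)
  · simpa [X₀] using (norm_fst_le (X - H.X₀).2).trans h2
  · simpa [X₀] using (norm_snd_le (X - H.X₀).2).trans h2

variable {H} in
lemma norm_le_bound {X : C(AddCircle H.T₀, E) × ℝ × ℝ} (hX : ‖X - H.X₀‖ ≤ 1)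
    (θ : AddCircle H.T₀) : ‖X.1 θ‖ ≤ H.bound := by
  have h1 := (near_X₀ hX).1 θ
  have h2 := norm_le_norm_add_norm_sub' (X.1 θ) (H.centerMotion θ)
  have h3 := H.centerMotion.norm_coe_le_norm θ
  unfold bound
  linarith

variable [FiniteDimensional ℝ E] [CompleteSpace E]

/-- The branch of blown-up periodic solutions, parametrized by the amplitude. -/
lemma exists_branch : ∃ δ ε K : ℝ, 0 < δ ∧ δ ≤ 1 / 2 ∧ 0 < ε ∧ 0 < K ∧
    ∀ G : C(E, E), (∀ x y, ‖G x - G y‖ ≤ ε * ‖x - y‖) → G 0 = 0 →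
      ∃ X : ℝ → C(AddCircle H.T₀, E) × ℝ × ℝ, X 0 = H.X₀ ∧ (∀ a, ‖X a - H.X₀‖ ≤ δ) ∧
        (∀ a, H.IsPeriodicSolution (scaled G a) (X a)) ∧
        (∀ a Y, ‖Y - H.X₀‖ ≤ δ → H.IsPeriodicSolution (scaled G a) Y → Y = X a) ∧
        (∀ a C, 0 ≤ a → 0 ≤ C → (∀ x, ‖x‖ ≤ a * H.bound → ‖G x‖ ≤ C * ‖x‖ ^ 2) →
          ‖X a - H.X₀‖ ≤ K * C * a) ∧
        ∀ a b l, 0 < b → b ≤ a → 0 ≤ l →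
          (∀ x y, ‖x‖ ≤ a * H.bound → ‖y‖ ≤ a * H.bound → ‖G x - G y‖ ≤ l * ‖x - y‖) →
          ‖X a - X b‖ ≤ K * l * ((a - b) / a) := by
  obtain ⟨δ, ε, K, hδ, hδ1, hε, hK, hex, hcmp⟩ := H.exists_periodicSolution
  have hM := H.bound_pos
  have hδ' : δ ≤ 1 := hδ1.trans (by norm_num)
  refine ⟨δ, ε, K * (H.bound ^ 2 + 2 * H.bound), hδ, hδ1, hε, by positivity, fun G hG hG0 => ?_⟩
  have hGs := norm_scaled_sub_le hε.le hG
  choose X hX hXs using fun a => hex (scaled G a) (hGs a) (scaled_apply_zero hG0 a)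
  have huniq : ∀ a Y, ‖Y - H.X₀‖ ≤ δ → H.IsPeriodicSolution (scaled G a) Y → Y = X a := by
    intro a Y hY hYs
    have := hcmp (scaled G a) (scaled G a) Y (X a) 0 (hGs a) (scaled_apply_zero hG0 a) hY (hX a)
      hYs (hXs a) (fun θ => by simp)
    rw [mul_zero] at this
    exact sub_eq_zero.1 (norm_le_zero_iff.1 this)
  have hX₀ : ‖H.X₀ - H.X₀‖ ≤ δ := by simpa using hδ.le
  refine ⟨X, (huniq 0 H.X₀ hX₀ (by rw [scaled_zero]; exact H.isPeriodicSolution_X₀)).symm, hX,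
    hXs, huniq, ?_, ?_⟩
  · intro a C ha hC hq
    refine (hcmp (scaled G a) 0 (X a) H.X₀ (C * a * H.bound ^ 2) (hGs a)
      (scaled_apply_zero hG0 a) (hX a) hX₀ (hXs a) H.isPeriodicSolution_X₀ (fun θ => ?_)).trans ?_
    · have h1 : ‖H.X₀.1 θ‖ ≤ H.bound := norm_le_bound (hX₀.trans hδ') θ
      simp only [ContinuousMap.zero_apply, sub_zero]
      exact (norm_scaled_le ha hq h1).trans (by gcongr)
    · have : 0 ≤ K * (2 * H.bound) * C * a := by positivity
      calc K * (C * a * H.bound ^ 2) = K * H.bound ^ 2 * C * a := by ring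
        _ ≤ K * H.bound ^ 2 * C * a + K * (2 * H.bound) * C * a := by linarith
        _ = _ := by ring
  · intro a b l hb hba hl hl'
    refine (hcmp (scaled G a) (scaled G b) (X a) (X b) (2 * l * H.bound * ((a - b) / a)) (hGs a)
      (scaled_apply_zero hG0 a) (hX a) (hX b) (hXs a) (hXs b) (fun θ => ?_)).trans ?_
    · exact norm_scaled_sub_scaled_le hb hba hl hG0 hl' (norm_le_bound ((hX b).trans hδ') θ)
    · have h1 : 0 ≤ (a - b) / a := div_nonneg (by linarith) (by linarith)
      have : 0 ≤ K * H.bound ^ 2 * l * ((a - b) / a) := by positivity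
      calc K * (2 * l * H.bound * ((a - b) / a)) = K * (2 * H.bound) * l * ((a - b) / a) := by ring
        _ ≤ K * H.bound ^ 2 * l * ((a - b) / a) + K * (2 * H.bound) * l * ((a - b) / a) := by
          linarith
        _ = _ := by ring

end HopfData

/-! ### Orbits in the original variables and normalization of small periodic solutions -/

namespace HopfData

variable {E : Type*} [NormedAddCommGroup E] [NormedSpace ℝ E] (H : HopfData E)

/-- The periodic orbit in the original variables belonging to a blown-up solution. -/
noncomputable def orbit (X : C(AddCircle H.T₀, E) × ℝ × ℝ) (a t : ℝ) : E :=
  a • X.1 ((t / (1 + X.2.2) : ℝ) : AddCircle H.T₀)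

variable {H} {G : C(E, E)} {X : C(AddCircle H.T₀, E) × ℝ × ℝ} {a : ℝ}

lemma hasDerivAt_orbit (hG : G 0 = 0) (hX : H.IsPeriodicSolution (scaled G a) X)
    (hν : 1 + X.2.2 ≠ 0) (t : ℝ) :
    HasDerivAt (H.orbit X a) (H.A X.2.1 (H.orbit X a t) + G (H.orbit X a t)) t := by
  rcases eq_or_ne a 0 with rfl | ha
  · have : H.orbit X 0 = fun _ => 0 := by
      ext t
      simp [orbit]
    simpa [this, hG] using hasDerivAt_const t (0 : E)
  · have h1 := (hX.1 (t / (1 + X.2.2))).scomp t ((hasDerivAt_id t).div_const (1 + X.2.2))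
    refine (h1.const_smul a).congr_deriv ?_
    rw [smul_smul (1 / (1 + X.2.2)), one_div, inv_mul_cancel₀ hν, one_smul, smul_add,
      scaled_apply, smul_inv_smul₀ ha, ← map_smul]
    rfl

lemma periodic_orbit (hν : 1 + X.2.2 ≠ 0) :
    Function.Periodic (H.orbit X a) (2 * Real.pi / (H.ω₀ / (1 + X.2.2))) := by
  have h1 : Function.Periodic (H.orbit X a) ((1 + X.2.2) * H.T₀) := by
    intro t
    simp only [orbit]
    rw [add_div, mul_div_cancel_left₀ _ hν, AddCircle.coe_add_period]
  have hω := H.ω₀_ne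
  -- For ω₀ < 0 the number 2π/ω' is negative, and minus a period is a period.
  rcases abs_choice H.ω₀ with h | h
  · have e : ∀ c : ℝ, 2 * Real.pi / (H.ω₀ / c) = c * H.T₀ := fun c => by
      rw [T₀, h]
      field_simp
    rw [e]
    exact h1
  · have e : ∀ c : ℝ, 2 * Real.pi / (H.ω₀ / c) = -(c * H.T₀) := fun c => by
      rw [T₀, h]
      field_simp
    rw [e]
    exact h1.neg

lemma orbit_sub_le (ha : 0 ≤ a) {d : ℝ} (hX : ‖X - H.X₀‖ ≤ d) (t : ℝ) :
    ‖H.orbit X a t - a • H.j (Complex.exp (Complex.I * ((H.ω₀ / (1 + X.2.2) : ℝ) : ℂ) * t))‖ ≤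
      a * d := by
  have h1 := (near_X₀ hX).1 ((t / (1 + X.2.2) : ℝ) : AddCircle H.T₀)
  rw [H.centerMotion_coe] at h1
  have h2 : Complex.I * ((H.ω₀ / (1 + X.2.2) : ℝ) : ℂ) * t =
      Complex.I * H.ω₀ * ((t / (1 + X.2.2) : ℝ) : ℂ) := by
    push_cast
    ring
  rw [h2, orbit, ← smul_sub, norm_smul, Real.norm_of_nonneg ha]
  gcongr

lemma norm_orbit_le (ha : 0 ≤ a) (hX : ‖X - H.X₀‖ ≤ 1) (t : ℝ) :
    ‖H.orbit X a t‖ ≤ a * H.bound := by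
  rw [orbit, norm_smul, Real.norm_of_nonneg ha]
  gcongr
  exact norm_le_bound hX _

/-- Along the center motion |z| = 1, which a perturbation with ‖z‖d < 1 cannot cancel. -/
lemma orbit_ne_zero (ha : a ≠ 0) {d : ℝ} (hX : ‖X - H.X₀‖ ≤ d) (hd : ‖H.z‖ * d < 1) (t : ℝ) :
    H.orbit X a t ≠ 0 := by
  intro h
  have h1 := (near_X₀ hX).1 ((t / (1 + X.2.2) : ℝ) : AddCircle H.T₀)
  rw [orbit, smul_eq_zero] at h
  rw [h.resolve_left ha, zero_sub, norm_neg, H.centerMotion_coe] at h1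
  have h2 := H.z.le_opNorm (H.j (Complex.exp (Complex.I * H.ω₀ * ((t / (1 + X.2.2) : ℝ) : ℂ))))
  rw [H.z_j, Complex.norm_exp] at h2
  simp only [Complex.mul_re, Complex.I_re, Complex.I_im, Complex.ofReal_re, Complex.ofReal_im,
    Complex.mul_im, zero_mul, mul_zero, one_mul, sub_self, Real.exp_zero] at h2
  have h3 := mul_le_mul_of_nonneg_left h1 (norm_nonneg H.z)
  linarith

lemma norm_deriv_sub_le {g : C(E, E)} {κ : ℝ} (hX1 : ‖X - H.X₀‖ ≤ 1) (θ : AddCircle H.T₀)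
    (hν : |X.2.2| * (‖H.A 0‖ * H.bound) ≤ κ) (hA : ‖H.A X.2.1 - H.A 0‖ * H.bound ≤ κ)
    (hg : ‖g (X.1 θ)‖ ≤ κ) :
    ‖(1 + X.2.2) • (H.A X.2.1 (X.1 θ) + g (X.1 θ)) - H.A 0 (X.1 θ)‖ ≤ 5 * κ := by
  have hM := norm_le_bound hX1 θ
  have hν1 : |1 + X.2.2| ≤ 2 := by
    have := (near_X₀ hX1).2.2
    rw [abs_le] at this ⊢
    constructor <;> linarith
  have h1 : (1 + X.2.2) • (H.A X.2.1 (X.1 θ) + g (X.1 θ)) - H.A 0 (X.1 θ) =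
      (1 + X.2.2) • ((H.A X.2.1 - H.A 0) (X.1 θ) + g (X.1 θ)) + X.2.2 • H.A 0 (X.1 θ) := by
    simp only [sub_apply, smul_add, smul_sub, add_smul, one_smul]
    abel
  rw [h1]
  calc _ ≤ 2 * (κ + κ) + κ := by
        refine (norm_add_le _ _).trans (add_le_add ?_ ?_)
        · rw [norm_smul, Real.norm_eq_abs]
          gcongr
          exact (norm_add_le _ _).trans (add_le_add
            (((H.A X.2.1 - H.A 0).le_opNorm _).trans (le_trans (by gcongr) hA)) hg)
        · rw [norm_smul, Real.norm_eq_abs]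
          exact le_trans (by gcongr; exact ((H.A 0).le_opNorm _).trans (by gcongr)) hν
    _ = 5 * κ := by ring

/-- The orbit meets the positive real half-axis only at its normalization point. -/
lemma eq_one_of_z_eq_pos {g : E → E} (hX : H.IsPeriodicSolution g X) {κ : ℝ}
    (hκ : ∀ θ, ‖(1 + X.2.2) • (H.A X.2.1 (X.1 θ) + g (X.1 θ)) - H.A 0 (X.1 θ)‖ ≤ κ)
    (hκω : ‖H.z‖ * κ ≤ |H.ω₀| / 8) {θ : AddCircle H.T₀} {b : ℝ} (hb : 0 < b)
    (hz : H.z (X.1 θ) = b) : b = 1 := by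
  have hω := abs_pos.2 H.ω₀_ne
  -- A representative with |s| ≤ T₀/2 makes the angle |ω₀s| at most π.
  obtain ⟨s, hs, rfl⟩ : θ ∈ (fun t : ℝ => (t : AddCircle H.T₀)) ''
      Ico (-(H.T₀ / 2)) (-(H.T₀ / 2) + H.T₀) := by
    rw [AddCircle.coe_image_Ico_eq]
    exact mem_univ θ
  have hs' : |s| ≤ H.T₀ / 2 := abs_le.2 ⟨hs.1, by linarith [hs.2]⟩
  set ζ : ℝ → ℂ := fun t => Complex.exp (-(Complex.I * H.ω₀ * t)) * H.z (X.1 t) with hζ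
  have hζd : ∀ t : ℝ, HasDerivAt ζ (Complex.exp (-(Complex.I * H.ω₀ * t)) *
      H.z ((1 + X.2.2) • (H.A X.2.1 (X.1 t) + g (X.1 t)) - H.A 0 (X.1 t))) t := fun t =>
    H.hasDerivAt_exp_mul (H.hasDerivAt_z ((hX.1 t).congr_deriv (by abel)))
  have hζ0 : ζ 0 = 1 := by
    simp only [hζ]
    rw [hX.2]
    simp
  -- In the rotating frame z starts at 1 and moves with speed at most |ω₀|/8.
  have hζs : ‖ζ s - 1‖ ≤ |H.ω₀ * s| / 8 := by
    have h1 := convex_univ.norm_image_sub_le_of_norm_hasDerivWithin_le (C := |H.ω₀| / 8)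
      (fun t _ => (hζd t).hasDerivWithinAt) (fun t _ => by
        rw [norm_mul, H.norm_exp_I_mul, one_mul]
        exact (H.z.le_opNorm _).trans (le_trans (by gcongr; exact hκ t) hκω))
      (mem_univ 0) (mem_univ s)
    rw [hζ0, sub_zero, Real.norm_eq_abs] at h1
    rw [abs_mul]
    linarith
  have hφ : |H.ω₀ * s| ≤ Real.pi := by
    rw [abs_mul]
    calc |H.ω₀| * |s| ≤ |H.ω₀| * (H.T₀ / 2) := by gcongr
      _ = Real.pi := by
        rw [T₀]
        field_simp
  have h0 := eq_zero_of_exp_mul_eq_pos hφ hb hζs (by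
    simp only [hζ]
    rw [← mul_assoc, ← Complex.exp_add, hz]
    push_cast
    rw [← mul_assoc, add_neg_cancel, Complex.exp_zero, one_mul])
  have hs0 : s = 0 := (mul_eq_zero.1 h0).resolve_left H.ω₀_ne
  rw [hs0] at hz
  have := hX.2
  rw [hz] at this
  exact_mod_cast this

/-- Dependence of the orbits on the amplitude, on bounded intervals of time. -/
lemma orbit_sub_orbit_le {X' : C(AddCircle H.T₀, E) × ℝ × ℝ} {b C L t T : ℝ}
    (hX1 : ‖X - H.X₀‖ ≤ 1 / 2) (hX1' : ‖X' - H.X₀‖ ≤ 1 / 2) (hb : 0 ≤ b) (hba : b ≤ a)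
    (hL : ∀ s s' : ℝ, ‖X.1 s - X.1 s'‖ ≤ L * |s - s'|) (hL0 : 0 ≤ L)
    (hC : b * ‖X - X'‖ ≤ C * (a - b)) (ht : |t| ≤ T) :
    ‖H.orbit X a t - H.orbit X' b t‖ ≤ (H.bound + C + 4 * L * T * C) * (a - b) := by
  have hT : 0 ≤ T := (abs_nonneg t).trans ht
  have hν := abs_le.1 (near_X₀ hX1).2.2
  have hν' := abs_le.1 (near_X₀ hX1').2.2
  have hνν : |X.2.2 - X'.2.2| ≤ ‖X - X'‖ := (norm_snd_le (X - X').2).trans (norm_snd_le (X - X'))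
  set s := t / (1 + X.2.2) with hs
  set s' := t / (1 + X'.2.2) with hs'
  have hss : |s - s'| ≤ 4 * T * ‖X - X'‖ := by
    have h1 : s - s' = t * ((1 + X.2.2)⁻¹ * (1 + X'.2.2)⁻¹) * (X'.2.2 - X.2.2) := by
      have e1 : 1 + X.2.2 ≠ 0 := by linarith
      have e2 : 1 + X'.2.2 ≠ 0 := by linarith
      rw [hs, hs']
      field_simp
      ring
    have h2 : ∀ ν : ℝ, -(1 / 2) ≤ ν → |(1 + ν)⁻¹| ≤ 2 := by
      intro ν hν
      rw [abs_of_pos (inv_pos.2 (by linarith)), inv_le_comm₀ (by linarith) two_pos]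
      linarith
    rw [h1, abs_mul, abs_mul, abs_mul, abs_sub_comm X'.2.2]
    calc _ ≤ T * (2 * 2) * ‖X - X'‖ := by
          gcongr
          · exact h2 _ hν.1
          · exact h2 _ hν'.1
      _ = _ := by ring
  -- The difference X - X' enters only with the factor b, which cancels the singular quotient in its
  -- bound.
  have hsplit : H.orbit X a t - H.orbit X' b t =
      (a - b) • X.1 s + (b • (X.1 s - X.1 s') + b • (X - X').1 s') := by
    have : (X - X').1 (s' : AddCircle H.T₀) = X.1 s' - X'.1 s' := rfl
    rw [this]
    simp only [orbit, ← hs, ← hs', sub_smul, smul_sub]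
    abel
  rw [hsplit]
  have hab : 0 ≤ a - b := sub_nonneg.2 hba
  calc _ ≤ (a - b) * H.bound + (b * (L * (4 * T * ‖X - X'‖)) + b * ‖X - X'‖) := by
        refine (norm_add_le _ _).trans (add_le_add ?_ ((norm_add_le _ _).trans (add_le_add ?_ ?_)))
          <;> rw [norm_smul, Real.norm_of_nonneg (by assumption)]
        · gcongr
          exact norm_le_bound (hX1.trans (by norm_num)) _
        · gcongr
          exact (hL s s').trans (by gcongr)
        · gcongr
          exact ((X - X').1.norm_coe_le_norm s').trans (norm_fst_le (X - X'))
    _ = (a - b) * H.bound + (4 * L * T * (b * ‖X - X'‖) + b * ‖X - X'‖) := by ring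
    _ ≤ (a - b) * H.bound + (4 * L * T * (C * (a - b)) + C * (a - b)) := by gcongr
    _ = _ := by ring

/-- A periodic solution is uniformly Lipschitz in time. -/
lemma lipschitz_of_isPeriodicSolution {g : E → E} (hX : H.IsPeriodicSolution g X) {κ L : ℝ}
    (hX1 : ‖X - H.X₀‖ ≤ 1)
    (hκ : ∀ θ, ‖(1 + X.2.2) • (H.A X.2.1 (X.1 θ) + g (X.1 θ)) - H.A 0 (X.1 θ)‖ ≤ κ)
    (hL : κ + ‖H.A 0‖ * H.bound ≤ L) (s s' : ℝ) : ‖X.1 s - X.1 s'‖ ≤ L * |s - s'| := by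
  have h1 := convex_univ.norm_image_sub_le_of_norm_hasDerivWithin_le (C := L)
    (fun t _ => (hX.1 t).hasDerivWithinAt) (fun t _ => by
      refine le_trans ?_ hL
      have h2 := norm_le_norm_sub_add
        ((1 + X.2.2) • (H.A X.2.1 (X.1 t) + g (X.1 t))) (H.A 0 (X.1 t))
      refine h2.trans (add_le_add (hκ t) (((H.A 0).le_opNorm _).trans ?_))
      gcongr
      exact norm_le_bound hX1 _)
    (mem_univ s') (mem_univ s)
  exact h1

variable (H) in
/-- A small periodic solution is, up to a shift of time, an orbit in normalized form. -/
lemma exists_normalization {δ : ℝ} (hδ : 0 < δ) : ∃ ε : ℝ, 0 < ε ∧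
    ∀ (G : C(E, E)) (m M T : ℝ) (w : ℝ → E), (∀ x y, ‖G x - G y‖ ≤ ε * ‖x - y‖) → G 0 = 0 →
      |m| ≤ δ → ‖H.A m - H.A 0‖ ≤ ε → (∀ t, HasDerivAt w (H.A m (w t) + G (w t)) t) →
      (∀ t, ‖w t‖ ≤ M) → 0 < T → Function.Periodic w T → (∃ t, w t ≠ 0) →
      ∃ (a t₀ : ℝ) (Y : C(AddCircle H.T₀, E) × ℝ × ℝ), 0 < a ∧ H.z (w t₀) = a ∧ Y.2.1 = m ∧
        ‖Y - H.X₀‖ ≤ δ ∧ H.IsPeriodicSolution (scaled G a) Y ∧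
        ∀ t, w t = H.orbit Y a (t + (-t₀)) := by
  obtain ⟨ε₀, C, hε₀, hC, hnear⟩ := H.exists_near_linear
  -- Halved because A(m) - A(0) and G each contribute ε to the Lipschitz constant of the
  -- perturbation.
  set ε := min ε₀ (δ / C) / 2 with hε
  have hmin : 0 < min ε₀ (δ / C) := lt_min hε₀ (by positivity)
  have hCε : C * (2 * ε) ≤ δ := by
    calc C * (2 * ε) = C * min ε₀ (δ / C) := by rw [hε]; ring
      _ ≤ C * (δ / C) := by gcongr; exact min_le_right _ _
      _ = δ := by field_simp
  refine ⟨ε, by positivity, fun G m M T w hG hG0 hm hA hw hM hT hper hne => ?_⟩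
  have hε0 : 0 < ε := by positivity
  obtain ⟨t₀, a, ν, ha, hza, hν, hν2, hper', hclose⟩ := hnear (2 * ε) M T univ
    (fun x => (H.A m - H.A 0) x + G x) w (by positivity)
    (by rw [hε]; linarith [min_le_left ε₀ (δ / C)]) (mem_univ _)
    (by simp [hG0])
    (fun x _ y _ => by
      have h1 : (H.A m - H.A 0) x + G x - ((H.A m - H.A 0) y + G y) =
          (H.A m - H.A 0) (x - y) + (G x - G y) := by
        rw [map_sub]
        abel
      rw [h1, two_mul, add_mul]
      exact (norm_add_le _ _).trans (add_le_add (((H.A m - H.A 0).le_opNorm _).trans (by gcongr))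
        (hG x y)))
    (fun _ => mem_univ _) hM
    (fun t => (hw t).congr_deriv (by rw [sub_apply]; abel)) hT hper hne
  have hν3 := abs_le.1 hν2
  have hν0 : 1 + ν ≠ 0 := by linarith
  set v : ℝ → E := fun r => a⁻¹ • w (t₀ + (1 + ν) * r) with hv
  have hwcont : Continuous w := continuous_iff_continuousAt.2 fun t => (hw t).continuousAt
  have hvper : Function.Periodic v H.T₀ := fun r => by
    simp only [hv]
    rw [mul_add, ← add_assoc, hper']
  set Y : C(AddCircle H.T₀, E) × ℝ × ℝ := (ofPeriodic v (by fun_prop) hvper, m, ν) with hY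
  have hY1 : ∀ t : ℝ, Y.1 t = v t := fun t => rfl
  refine ⟨a, t₀, Y, ha, hza, rfl, ?_, ⟨fun t => ?_, ?_⟩, fun t => ?_⟩
  · rw [Prod.norm_def, Prod.norm_def]
    refine max_le ?_ (max_le (by simpa [X₀, hY] using hm)
      (by simpa [X₀, hY] using hν.trans hCε))
    rw [ContinuousMap.norm_le _ hδ.le]
    intro θ
    obtain ⟨r, hr, rfl⟩ : θ ∈ (fun t : ℝ => (t : AddCircle H.T₀)) '' Ico 0 (0 + H.T₀) := by
      rw [AddCircle.coe_image_Ico_eq]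
      exact mem_univ θ
    rw [zero_add] at hr
    have h1 := hclose r (by rw [abs_of_nonneg hr.1]; exact hr.2.le)
    have h2 : (Y - H.X₀).1 (r : AddCircle H.T₀) =
        a⁻¹ • (w (t₀ + (1 + ν) * r) - a • H.j (Complex.exp (Complex.I * H.ω₀ * r))) := by
      rw [smul_sub, inv_smul_smul₀ ha.ne']
      rfl
    rw [h2, norm_smul, norm_inv, Real.norm_of_nonneg ha.le]
    calc _ ≤ a⁻¹ * (C * (2 * ε) * a) := by gcongr
      _ = C * (2 * ε) := by field_simp
      _ ≤ δ := hCε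
  · have h1 : HasDerivAt (fun r : ℝ => t₀ + (1 + ν) * r) (1 + ν) t := by
      simpa using ((hasDerivAt_id t).const_mul (1 + ν)).const_add t₀
    have h2 := ((hw (t₀ + (1 + ν) * t)).scomp t h1).const_smul a⁻¹
    refine h2.congr_deriv ?_
    rw [hY1, scaled_apply, hv]
    simp only [smul_inv_smul₀ ha.ne', map_smul, hY]
    rw [smul_comm, smul_add]
  · rw [hY1, hv]
    simp only [mul_zero, add_zero, map_smul, hza, Complex.real_smul]
    push_cast
    exact inv_mul_cancel₀ (by exact_mod_cast ha.ne')
  · rw [orbit, hY1, hv]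
    simp only [smul_inv_smul₀ ha.ne', hY]
    congr 1
    field_simp
    ring

end HopfData

/-! ### Extension of the nonlinearity from a small ball -/

section Extension

variable {E : Type*} [NormedAddCommGroup E] [NormedSpace ℝ E] [FiniteDimensional ℝ E]

lemma exists_global_extension {U : Set E} (hU : IsOpen U) (hU0 : (0 : E) ∈ U) {G : E → E}
    (hquad : G =O[𝓝 0] fun x => ‖x‖ ^ 2)
    (hsmall : ∀ ε : ℝ, 0 < ε → ∃ ρ : ℝ, 0 < ρ ∧
      ∀ x y : E, ‖x‖ < ρ → ‖y‖ < ρ → ‖G x - G y‖ ≤ ε * ‖x - y‖) {ε : ℝ} (hε : 0 < ε) :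
    ∃ (F : C(E, E)) (ρ C : ℝ), 0 < ρ ∧ 0 < C ∧ Metric.ball 0 ρ ⊆ U ∧
      (∀ x y, ‖F x - F y‖ ≤ ε * ‖x - y‖) ∧ F 0 = 0 ∧
      (∀ x, ‖x‖ < ρ → F x = G x) ∧ ∀ x, ‖x‖ < ρ → ‖F x‖ ≤ C * ‖x‖ ^ 2 := by
  have hc := lipschitzExtensionConstant_pos E
  set c := lipschitzExtensionConstant E with hcdef
  have hc' : (0 : ℝ) < c := hc
  -- Extending from the ball multiplies the Lipschitz constant by at most c, which is divided out in
  -- advance.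
  obtain ⟨ρ₁, hρ₁, hlip⟩ := hsmall (ε / c) (by positivity)
  have hGlip : LipschitzOnWith (ε / c).toNNReal G (Metric.ball 0 ρ₁) :=
    LipschitzOnWith.of_dist_le_mul fun x hx y hy => by
      rw [Real.coe_toNNReal _ (by positivity), dist_eq_norm, dist_eq_norm]
      exact hlip x y (by simpa using hx) (by simpa using hy)
  obtain ⟨F, hF, hFG⟩ := hGlip.extend_finite_dimension
  obtain ⟨C, hC, hbound⟩ := hquad.exists_pos
  obtain ⟨ρ₂, hρ₂, hbound⟩ := Metric.eventually_nhds_iff_ball.1 hbound.bound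
  obtain ⟨ρ₃, hρ₃, hball⟩ := Metric.isOpen_iff.1 hU 0 hU0
  have hFG' : ∀ x, ‖x‖ < min ρ₁ (min ρ₂ ρ₃) → F x = G x := fun x hx =>
    (hFG (by simpa using hx.trans_le (min_le_left _ _))).symm
  have hFC : ∀ x, ‖x‖ < min ρ₁ (min ρ₂ ρ₃) → ‖F x‖ ≤ C * ‖x‖ ^ 2 := fun x hx => by
    rw [hFG' x hx]
    simpa using hbound x
      (by simpa using hx.trans_le ((min_le_right _ _).trans (min_le_left _ _)))
  have hρ : 0 < min ρ₁ (min ρ₂ ρ₃) := lt_min hρ₁ (lt_min hρ₂ hρ₃)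
  refine ⟨⟨F, hF.continuous⟩, min ρ₁ (min ρ₂ ρ₃), C, hρ, hC, ?_, fun x y => ?_, ?_, hFG', hFC⟩
  · exact (Metric.ball_subset_ball ((min_le_right _ _).trans (min_le_right _ _))).trans hball
  · have h1 := hF.dist_le_mul x y
    rw [dist_eq_norm, dist_eq_norm, NNReal.coe_mul, Real.coe_toNNReal _ (by positivity),
      mul_div_cancel₀ _ hc'.ne'] at h1
    exact h1
  · simpa using hFC 0 (by simpa using hρ)

end Extension

lemma abs_div_one_add_sub_div_one_add_le {w ν ν' : ℝ} (hν : |ν| ≤ 1 / 2) (hν' : |ν'| ≤ 1 / 2) :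
    |w / (1 + ν) - w / (1 + ν')| ≤ 4 * |w| * |ν - ν'| := by
  have h2 : ∀ ν : ℝ, |ν| ≤ 1 / 2 → 0 < 1 + ν ∧ |(1 + ν)⁻¹| ≤ 2 := by
    intro ν hν
    have hν := abs_le.1 hν
    refine ⟨by linarith, ?_⟩
    rw [abs_of_pos (inv_pos.2 (by linarith)), inv_le_comm₀ (by linarith) two_pos]
    linarith
  obtain ⟨h3, h4⟩ := h2 ν hν
  obtain ⟨h3', h4'⟩ := h2 ν' hν'
  have h1 : w / (1 + ν) - w / (1 + ν') = w * ((1 + ν)⁻¹ * (1 + ν')⁻¹) * (ν' - ν) := by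
    field_simp
    ring
  rw [h1, abs_mul, abs_mul, abs_mul, abs_sub_comm ν']
  calc _ ≤ |w| * (2 * 2) * |ν - ν'| := by gcongr
    _ = _ := by ring

/-! ### The abstract bifurcation theorem -/

namespace HopfData

variable {E : Type*} [NormedAddCommGroup E] [NormedSpace ℝ E] (H : HopfData E)
variable [FiniteDimensional ℝ E] [CompleteSpace E]

/-- The Hopf bifurcation for a Lipschitz continuous nonlinearity, in abstract form. -/
theorem exists_bifurcating_family {U : Set E} (hU : IsOpen U) (hU0 : (0 : E) ∈ U) {G : E → E}
    (hquad : G =O[𝓝 0] fun x => ‖x‖ ^ 2)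
    (hsmall : ∀ ε : ℝ, 0 < ε → ∃ ρ : ℝ, 0 < ρ ∧
      ∀ x y : E, ‖x‖ < ρ → ‖y‖ < ρ → ‖G x - G y‖ ≤ ε * ‖x - y‖) :
    ∃ (V : Set E) (μ₀ a₀ : ℝ) (μ ω' : ℝ → ℝ) (u : ℝ → ℝ → E),
      IsOpen V ∧ (0 : E) ∈ V ∧ V ⊆ U ∧ 0 < μ₀ ∧ 0 < a₀ ∧ μ 0 = 0 ∧ ω' 0 = H.ω₀ ∧
      (∀ a ∈ Ico 0 a₀, |μ a| < μ₀ ∧ ω' a ≠ 0 ∧ (∀ t, u a t ∈ V) ∧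
        (∀ t, HasDerivAt (u a) (H.A (μ a) (u a t) + G (u a t)) t) ∧
        Function.Periodic (u a) (2 * Real.pi / ω' a)) ∧
      (∀ t, u 0 t = 0) ∧ (∀ a ∈ Ioo 0 a₀, ∀ t, u a t ≠ 0) ∧
      (∀ (m : ℝ) (w : ℝ → E), |m| < μ₀ →
        (∀ t, HasDerivAt w (H.A m (w t) + G (w t)) t) →
        (∃ T : ℝ, 0 < T ∧ Function.Periodic w T) → (∀ t, w t ∈ V) → (∃ t, w t ≠ 0) →
        ∃ a ∈ Ioo 0 a₀, μ a = m ∧ ∃ τ : ℝ, ∀ t, w t = u a (t + τ)) ∧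
      (∀ T : ℝ, ∃ L : ℝ≥0, ∀ t : ℝ, |t| ≤ T → LipschitzOnWith L (fun a => u a t) (Ico 0 a₀)) ∧
      ContinuousOn μ (Ico 0 a₀) ∧ ContinuousOn ω' (Ico 0 a₀) ∧
      LocallyLipschitzOn (Ioo 0 a₀) μ ∧ LocallyLipschitzOn (Ioo 0 a₀) ω' ∧
      (∃ C : ℝ, ∀ a ∈ Ico 0 a₀, |μ a| ≤ C * a ∧ |ω' a - H.ω₀| ≤ C * a) ∧
      ((∃ C ρ : ℝ, 0 < ρ ∧ ∀ r : ℝ, r < ρ → ∀ x y : E, ‖x‖ ≤ r → ‖y‖ ≤ r →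
          ‖G x - G y‖ ≤ C * r * ‖x - y‖) →
        ∃ L : ℝ≥0, LipschitzOnWith L μ (Ico 0 a₀) ∧ LipschitzOnWith L ω' (Ico 0 a₀)) ∧
      ∃ C : ℝ, 0 ≤ C ∧ ∀ a ∈ Ico 0 a₀, ∀ t : ℝ,
        ‖u a t - a • H.j (Complex.exp (Complex.I * (ω' a : ℂ) * (t : ℂ)))‖ ≤ C * a ^ 2 := by
  obtain ⟨δ, ε₁, K, hδ, hδ1, hε₁, hK, hbranch⟩ := H.exists_branch
  obtain ⟨ε₂, hε₂, hnorm⟩ := H.exists_normalization hδ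
  have hω := abs_pos.2 H.ω₀_ne
  have hM := H.bound_pos
  set M := H.bound with hMdef
  set ε := min ε₁ ε₂ with hε
  have hε0 : 0 < ε := lt_min hε₁ hε₂
  obtain ⟨F, ρ, Cq, hρ, hCq, hρU, hF, hF0, hFG, hFq⟩ :=
    exists_global_extension hU hU0 hquad hsmall hε0
  have hF1 : ∀ x y, ‖F x - F y‖ ≤ ε₁ * ‖x - y‖ := fun x y =>
    (hF x y).trans (by gcongr; exact min_le_left _ _)
  have hF2 : ∀ x y, ‖F x - F y‖ ≤ ε₂ * ‖x - y‖ := fun x y =>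
    (hF x y).trans (by gcongr; exact min_le_right _ _)
  obtain ⟨X, hX0, hXδ, hXs, huniq, hXq, hXd⟩ := hbranch F hF1 hF0
  -- Chosen so that the deviation 5κ from the linear flow, seen through z, is at most |ω₀|/8.
  set κ : ℝ := |H.ω₀| / (40 * (‖H.z‖ + 1)) with hκ
  have hκ0 : 0 < κ := by positivity
  have hκz : ‖H.z‖ * (5 * κ) ≤ |H.ω₀| / 8 := by
    calc ‖H.z‖ * (5 * κ) ≤ (‖H.z‖ + 1) * (5 * κ) := by gcongr; linarith
      _ = |H.ω₀| / 8 := by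
        rw [hκ]
        field_simp
        norm_num
  obtain ⟨μ₁, hμ₁, hAμ⟩ : ∃ μ₁ : ℝ, 0 < μ₁ ∧ ∀ m, |m| < μ₁ →
      ‖H.A m - H.A 0‖ ≤ min ε₂ (κ / M) := by
    have h1 := Metric.continuousAt_iff.1 H.strictDeriv.hasDerivAt.continuousAt (min ε₂ (κ / M))
      (lt_min hε₂ (by positivity))
    obtain ⟨μ₁, hμ₁, h2⟩ := h1
    refine ⟨μ₁, hμ₁, fun m hm => ?_⟩
    have h3 := h2 (x := m) (by simpa using hm)
    rw [dist_eq_norm] at h3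
    exact h3.le
  set μ₀ := min μ₁ δ with hμ₀
  have hμ₀0 : 0 < μ₀ := lt_min hμ₁ hδ
  set CE := K * Cq with hCE
  have hCE0 : 0 < CE := by positivity
  -- The sum p dominates every coefficient s for which a·s must be small, and r collects the
  -- corresponding bounds ρ, μ₀, κ and 1; hence a₀ = r/p.
  set p : ℝ := M + CE + CE * (‖H.A 0‖ * M) + Cq * M ^ 2 + ‖H.z‖ * CE with hp
  have hp1 : 0 ≤ CE * (‖H.A 0‖ * M) := by positivity
  have hp2 : 0 ≤ Cq * M ^ 2 := by positivity
  have hp3 : 0 ≤ ‖H.z‖ * CE := by positivity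
  have hp0 : 0 < p := by positivity
  set r : ℝ := min (min ρ μ₀) (min κ 1) with hr
  have hr0 : 0 < r := lt_min (lt_min hρ hμ₀0) (lt_min hκ0 one_pos)
  have hrρ : r ≤ ρ := (min_le_left _ _).trans (min_le_left _ _)
  have hrμ : r ≤ μ₀ := (min_le_left _ _).trans (min_le_right _ _)
  have hrκ : r ≤ κ := (min_le_right _ _).trans (min_le_left _ _)
  have hr1 : r ≤ 1 := (min_le_right _ _).trans (min_le_right _ _)
  set a₀ := r / p with ha₀
  have ha₀0 : 0 < a₀ := by positivity
  have hsm : ∀ a ∈ Ico 0 a₀, ∀ s, s ≤ p → a * s < r := by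
    intro a ha s hs
    have h1 : a * p < r := (lt_div_iff₀ hp0).1 ha.2
    exact (mul_le_mul_of_nonneg_left hs ha.1).trans_lt h1
  have haM : ∀ a ∈ Ico 0 a₀, a * M < ρ := fun a ha =>
    (hsm a ha M (by linarith)).trans_le hrρ
  have hXE : ∀ a ∈ Ico 0 a₀, ‖X a - H.X₀‖ ≤ CE * a := fun a ha =>
    hXq a Cq ha.1 hCq.le fun x hx => hFq x (hx.trans_lt (haM a ha))
  have hXμ : ∀ a ∈ Ico 0 a₀, CE * a < μ₀ := fun a ha => by
    rw [mul_comm]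
    exact (hsm a ha CE (by linarith)).trans_le hrμ
  set μ : ℝ → ℝ := fun a => (X a).2.1 with hμdef
  set ν : ℝ → ℝ := fun a => (X a).2.2 with hνdef
  set ω' : ℝ → ℝ := fun a => H.ω₀ / (1 + ν a) with hω'def
  have hX1 : ∀ a, ‖X a - H.X₀‖ ≤ 1 := fun a => (hXδ a).trans (by linarith)
  have hX2 : ∀ a, ‖X a - H.X₀‖ ≤ 1 / 2 := fun a => (hXδ a).trans hδ1
  have hν2 : ∀ a, |ν a| ≤ 1 / 2 := fun a => (near_X₀ (hX2 a)).2.2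
  have hν1 : ∀ a, 1 + ν a ≠ 0 := fun a => by
    have := abs_le.1 (hν2 a)
    linarith
  have hμE : ∀ a ∈ Ico 0 a₀, |μ a| ≤ CE * a := fun a ha => (near_X₀ (hXE a ha)).2.1
  have hνE : ∀ a ∈ Ico 0 a₀, |ν a| ≤ CE * a := fun a ha => (near_X₀ (hXE a ha)).2.2
  have hμlt : ∀ a ∈ Ico 0 a₀, |μ a| < μ₀ := fun a ha => (hμE a ha).trans_lt (hXμ a ha)
  have hμ00 : μ 0 = 0 := by
    simp only [hμdef, hX0]
    rfl
  have hν00 : ν 0 = 0 := by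
    simp only [hνdef, hX0]
    rfl
  have hω'0 : ω' 0 = H.ω₀ := by
    simp [hω'def, hν00]
  have hsub : ∀ a b, |μ a - μ b| ≤ ‖X a - X b‖ ∧ |ν a - ν b| ≤ ‖X a - X b‖ := fun a b =>
    ⟨(norm_fst_le (X a - X b).2).trans (norm_snd_le (X a - X b)),
      (norm_snd_le (X a - X b).2).trans (norm_snd_le (X a - X b))⟩
  have hω'sub : ∀ a b, |ω' a - ω' b| ≤ 4 * |H.ω₀| * |ν a - ν b| := fun a b =>
    abs_div_one_add_sub_div_one_add_le (hν2 a) (hν2 b)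
  have hω'E : ∀ a ∈ Ico 0 a₀, |ω' a - ω' 0| ≤ 4 * |H.ω₀| * CE * a := fun a ha => by
    refine (hω'sub a 0).trans ?_
    rw [hν00, sub_zero, mul_assoc _ CE]
    gcongr
    exact hνE a ha
  have hD : ∀ a b, 0 < b → b ≤ a → ‖X a - X b‖ ≤ K * ε * ((a - b) / a) := fun a b hb hba =>
    hXd a b ε hb hba hε0.le fun x y _ _ => hF x y
  have hμD : ∀ a b, 0 < b → b ≤ a → a < a₀ → |μ a - μ b| ≤ K * ε * ((a - b) / a) :=
    fun a b hb hba _ => (hsub a b).1.trans (hD a b hb hba)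
  have hω'D : ∀ a b, 0 < b → b ≤ a → a < a₀ →
      |ω' a - ω' b| ≤ 4 * |H.ω₀| * (K * ε) * ((a - b) / a) := fun a b hb hba _ => by
    refine (hω'sub a b).trans ?_
    rw [mul_assoc _ (K * ε)]
    gcongr
    exact (hsub a b).2.trans (hD a b hb hba)
  have hμE0 : ∀ a ∈ Ico 0 a₀, |μ a - μ 0| ≤ CE * a := fun a ha => by
    rw [hμ00, sub_zero]
    exact hμE a ha
  have hforce : ∀ a ∈ Ico 0 a₀, ∀ θ, ‖(1 + (X a).2.2) • (H.A (X a).2.1 ((X a).1 θ) +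
      scaled F a ((X a).1 θ)) - H.A 0 ((X a).1 θ)‖ ≤ 5 * κ := by
    intro a ha θ
    refine norm_deriv_sub_le (hX1 a) θ ?_ ?_ ?_
    · calc _ ≤ CE * a * (‖H.A 0‖ * M) := by
            gcongr
            exact hνE a ha
        _ = a * (CE * (‖H.A 0‖ * M)) := by ring
        _ ≤ κ := ((hsm a ha _ (by linarith)).trans_le hrκ).le
    · calc _ ≤ κ / M * M := by
            gcongr
            exact (hAμ _ ((hμlt a ha).trans_le (min_le_left _ _))).trans (min_le_right _ _)
        _ = κ := by field_simp
    · refine (norm_scaled_le ha.1 (fun x hx => hFq x (hx.trans_lt (haM a ha)))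
        (norm_le_bound (hX1 a) θ)).trans ?_
      calc _ ≤ Cq * a * M ^ 2 := by
            have := ha.1
            gcongr
            exact norm_le_bound (hX1 a) θ
        _ = a * (Cq * M ^ 2) := by ring
        _ ≤ κ := ((hsm a ha _ (by linarith)).trans_le hrκ).le
  -- Removing the points with z real and ≥ a₀ makes the amplitude of any periodic solution in V
  -- smaller than a₀, because after normalization z takes the value a on it. A plain ball would not
  -- match the range of the branch.
  set V : Set E := Metric.ball 0 ρ ∩ {x | (H.z x).im = 0 ∧ a₀ ≤ (H.z x).re}ᶜ with hV
  have hVρ : ∀ x ∈ V, ‖x‖ < ρ := fun x hx => by simpa using hx.1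
  have hVa : ∀ x ∈ V, ∀ b : ℝ, H.z x = b → b < a₀ := by
    intro x hx b hb
    by_contra! hcon
    exact hx.2 ⟨by rw [hb, Complex.ofReal_im], by rwa [hb, Complex.ofReal_re]⟩
  have hVopen : IsOpen V := by
    refine Metric.isOpen_ball.inter (IsClosed.isOpen_compl (self := ?_))
    exact (isClosed_eq (Complex.continuous_im.comp H.z.continuous) continuous_const).inter
      (isClosed_le continuous_const (Complex.continuous_re.comp H.z.continuous))
  have hnormu : ∀ a ∈ Ico 0 a₀, ∀ t, ‖H.orbit (X a) a t‖ < ρ := fun a ha t =>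
    (norm_orbit_le ha.1 (hX1 a) t).trans_lt (haM a ha)
  have huV : ∀ a ∈ Ico 0 a₀, ∀ t, H.orbit (X a) a t ∈ V := by
    intro a ha t
    refine ⟨by simpa using hnormu a ha t, ?_⟩
    rintro ⟨him, hre⟩
    have ha0 : 0 < a := by
      refine ha.1.lt_of_ne ?_
      rintro rfl
      simp only [orbit, zero_smul, map_zero, Complex.zero_re] at hre
      linarith
    rw [orbit, map_smul, Complex.real_smul] at him hre
    rw [Complex.im_ofReal_mul, mul_eq_zero] at him
    rw [Complex.re_ofReal_mul] at hre
    set ζ := H.z ((X a).1 ((t / (1 + (X a).2.2) : ℝ) : AddCircle H.T₀)) with hζ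
    have hre0 : 0 < ζ.re := by
      by_contra! hcon
      nlinarith [mul_nonpos_of_nonneg_of_nonpos ha0.le hcon]
    -- A point of the orbit in the removed set would have z positive, hence equal to a,
    -- contradicting a < a₀.
    have h1 := eq_one_of_z_eq_pos (hXs a) (hforce a ha) hκz (b := ζ.re) hre0
      (by rw [← hζ]; exact Complex.ext rfl (by simpa using him.resolve_left ha0.ne'))
    rw [h1] at hre
    linarith [ha.2]
  refine ⟨V, μ₀, a₀, μ, ω', fun a => H.orbit (X a) a, hVopen,
    ⟨by simpa using hρ, by simp [ha₀0]⟩, inter_subset_left.trans hρU, hμ₀0, ha₀0,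
    hμ00, hω'0, ?_, ?_, ?_, ?_, ?_, continuousOn_of_le_div hμD hμE0,
    continuousOn_of_le_div hω'D hω'E, locallyLipschitzOn_of_le_div hμD,
    locallyLipschitzOn_of_le_div hω'D, ?_, ?_, ?_⟩
  · intro a ha
    refine ⟨hμlt a ha, div_ne_zero H.ω₀_ne (hν1 a), huV a ha, fun t => ?_, periodic_orbit (hν1 a)⟩
    rw [← hFG _ (hnormu a ha t)]
    exact hasDerivAt_orbit hF0 (hXs a) (hν1 a) t
  · intro t
    simp [orbit]
  · intro a ha t
    have ha' : a ∈ Ico 0 a₀ := ⟨ha.1.le, ha.2⟩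
    refine orbit_ne_zero ha.1.ne' (hXE a ha') ?_ t
    calc ‖H.z‖ * (CE * a) = a * (‖H.z‖ * CE) := by ring
      _ < 1 := (hsm a ha' _ (by linarith)).trans_le hr1
  · rintro m w hm hw ⟨T, hT, hper⟩ hwV hne
    obtain ⟨a, t₀, Y, ha, hza, hYm, hYδ, hYs, hwY⟩ := hnorm F m ρ T w hF2 hF0
      (hm.le.trans (min_le_right _ _))
      ((hAμ m (hm.trans_le (min_le_left _ _))).trans (min_le_left _ _))
      (fun t => by
        rw [hFG _ (hVρ _ (hwV t))]
        exact hw t)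
      (fun t => (hVρ _ (hwV t)).le) hT hper hne
    have hYX := huniq a Y hYδ hYs
    subst hYX
    exact ⟨a, ⟨ha, hVa _ (hwV t₀) a hza⟩, hYm, -t₀, hwY⟩
  · intro T
    set L : ℝ := 5 * κ + ‖H.A 0‖ * M with hL
    have hL0 : 0 ≤ L := by positivity
    set Cu : ℝ := M + K * ε + 4 * L * |T| * (K * ε) with hCu
    have hCu0 : 0 ≤ Cu := by positivity
    refine ⟨Cu.toNNReal, fun t ht => LipschitzOnWith.of_dist_le_mul ?_⟩
    have key : ∀ a ∈ Ico 0 a₀, ∀ b ∈ Ico 0 a₀, b ≤ a →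
        ‖H.orbit (X a) a t - H.orbit (X b) b t‖ ≤ Cu * (a - b) := by
      intro a ha b hb hba
      refine orbit_sub_orbit_le (hX2 a) (hX2 b) hb.1 hba
        (lipschitz_of_isPeriodicSolution (hXs a) (hX1 a) (hforce a ha) le_rfl) hL0 ?_
        (ht.trans (le_abs_self T))
      rcases hb.1.eq_or_lt with rfl | hb0
      · rw [zero_mul]
        exact mul_nonneg (by positivity) (sub_nonneg.2 hba)
      · have ha0 : 0 < a := hb0.trans_le hba
        have hab : 0 ≤ a - b := sub_nonneg.2 hba
        calc b * ‖X a - X b‖ ≤ a * (K * ε * ((a - b) / a)) := by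
              gcongr
              exact hD a b hb0 hba
          _ = K * ε * (a - b) := by field_simp
    intro a ha b hb
    rw [Real.coe_toNNReal _ hCu0, dist_eq_norm, Real.dist_eq]
    rcases le_total b a with h | h
    · rw [abs_of_nonneg (sub_nonneg.2 h)]
      exact key a ha b hb h
    · rw [norm_sub_rev, abs_sub_comm, abs_of_nonneg (sub_nonneg.2 h)]
      exact key b hb a ha h
  · refine ⟨(4 * |H.ω₀| + 1) * CE, fun a ha => ⟨?_, ?_⟩⟩
    · refine (hμE a ha).trans ?_
      have := mul_nonneg hω.le (mul_nonneg hCE0.le ha.1)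
      linarith
    · have h1 := hω'E a ha
      rw [hω'0] at h1
      refine h1.trans ?_
      have := mul_nonneg hCE0.le ha.1
      linarith
  · rintro ⟨C, ρ', hρ', hlin⟩
    set L : ℝ := K * (|C| * M) + K * ε * (M / ρ') + CE with hL
    have hL0 : 0 ≤ L := by positivity
    have hXL : ∀ a b, 0 < b → b ≤ a → a < a₀ → ‖X a - X b‖ ≤ L * (a - b) := by
      intro a b hb hba haa
      have ha0 : 0 < a := hb.trans_le hba
      have hab : 0 ≤ a - b := sub_nonneg.2 hba
      have h1 : 0 ≤ K * (|C| * M) * (a - b) := by positivity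
      have h2 : 0 ≤ K * ε * (M / ρ') * (a - b) := by positivity
      have h3 : 0 ≤ CE * (a - b) := by positivity
      -- For small a the Lipschitz constant |C|aM cancels the factor 1/a; otherwise 1/a ≤ M/ρ' is
      -- bounded.
      rcases lt_or_ge (a * M) ρ' with haρ | haρ
      · have h4 := hXd a b (|C| * (a * M)) hb hba (by positivity) fun x y hx hy => by
          have hlt := haM a ⟨ha0.le, haa⟩
          rw [hFG x (hx.trans_lt hlt), hFG y (hy.trans_lt hlt)]
          refine (hlin (a * M) haρ x y hx hy).trans ?_
          gcongr
          exact le_abs_self C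
        have h5 : K * (|C| * (a * M)) * ((a - b) / a) = K * (|C| * M) * (a - b) := by
          field_simp
        rw [h5] at h4
        rw [hL]
        linarith
      · have h4 := hD a b hb hba
        have h5 : (a - b) / a ≤ M / ρ' * (a - b) := by
          rw [div_le_iff₀ ha0, mul_assoc, mul_comm (a - b), ← mul_assoc]
          refine le_mul_of_one_le_left hab ?_
          rw [div_mul_eq_mul_div, le_div_iff₀ hρ']
          linarith
        have h6 : K * ε * ((a - b) / a) ≤ K * ε * (M / ρ') * (a - b) := by
          rw [mul_assoc (K * ε)]
          gcongr
        rw [hL]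
        linarith
    have hLCE : CE ≤ L := by
      have h1 : 0 ≤ K * (|C| * M) := by positivity
      have h2 : 0 ≤ K * ε * (M / ρ') := by positivity
      linarith
    refine ⟨(max L (4 * |H.ω₀| * L)).toNNReal, ?_, ?_⟩
    · refine lipschitzOnWith_Ico_of_le (hL0.trans (le_max_left _ _)) ?_ ?_
      · intro a b hb hba haa
        have hab : 0 ≤ a - b := sub_nonneg.2 hba
        exact ((hsub a b).1.trans (hXL a b hb hba haa)).trans (by gcongr; exact le_max_left _ _)
      · intro a ha
        have := ha.1
        exact (hμE0 a ha).trans (by gcongr; exact hLCE.trans (le_max_left _ _))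
    · refine lipschitzOnWith_Ico_of_le (hL0.trans (le_max_left _ _)) ?_ ?_
      · intro a b hb hba haa
        have hab : 0 ≤ a - b := sub_nonneg.2 hba
        calc _ ≤ 4 * |H.ω₀| * (L * (a - b)) := (hω'sub a b).trans (by
              gcongr
              exact (hsub a b).2.trans (hXL a b hb hba haa))
          _ = 4 * |H.ω₀| * L * (a - b) := by ring
          _ ≤ _ := by gcongr; exact le_max_right _ _
      · intro a ha
        have := ha.1
        refine (hω'E a ha).trans ?_
        gcongr
        exact le_trans (by gcongr) (le_max_right _ _)
  · refine ⟨CE, hCE0.le, fun a ha t => (orbit_sub_le ha.1 (hXE a ha) t).trans (le_of_eq ?_)⟩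
    ring

end HopfData

end HopfLipschitz

/-! ### Translation to the matrix formulation -/

theorem theorem2p2 (n : ℕ) (U : Set (HopfLipschitz.State n)) (hU : IsOpen U)
    (hU0 : (0 : HopfLipschitz.State n) ∈ U)
    (A : ℝ → Matrix (Fin n) (Fin n) ℝ) (ω : ℝ → ℝ)
    (G : HopfLipschitz.State n → HopfLipschitz.State n)
    -- regularity of the linear part and of the frequency near the critical parameter
    (hA : ∀ i j, ContDiffAt ℝ 1 (fun μ => A μ i j) 0)
    (hω : ContDiffAt ℝ 1 ω 0) (hω0 : ω 0 ≠ 0)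
    -- `μ + i ω(μ)` (hence also its conjugate) is an eigenvalue of the real matrix `A μ`
    (hpair : ∀ᶠ μ : ℝ in 𝓝 0, (HopfLipschitz.complexify (A μ)).charpoly.IsRoot
      ((μ : ℂ) + (ω μ : ℂ) * Complex.I))
    -- the pair is simple at `μ = 0`
    (hsimple : (HopfLipschitz.complexify (A 0)).charpoly.rootMultiplicity
      ((ω 0 : ℂ) * Complex.I) = 1)
    -- all other eigenvalues of `A 0` are off the imaginary axis
    (hhyp : ∀ z : ℂ, (HopfLipschitz.complexify (A 0)).charpoly.IsRoot z →
      z ≠ (ω 0 : ℂ) * Complex.I → z ≠ -((ω 0 : ℂ) * Complex.I) → z.re ≠ 0)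
    -- the nonlinearity is Lipschitz continuous and of quadratic order
    (hGlip : LocallyLipschitzOn U G)
    (hGquad : G =O[𝓝 0] fun x => ‖x‖ ^ 2)
    (hGsmall : HopfLipschitz.VanishingLipschitzConstant G)
    -- a complex eigenvector for `i ω(0)`; `z ↦ Re (z q)` identifies `ℂ` with the eigenspace
    (q : Fin n → ℂ) (hq0 : q ≠ 0)
    (hq : (HopfLipschitz.complexify (A 0)).mulVec q = ((ω 0 : ℂ) * Complex.I) • q) :
    ∃ (V : Set (HopfLipschitz.State n)) (μ₀ a₀ : ℝ) (μ ω' : ℝ → ℝ)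
      (u : ℝ → ℝ → HopfLipschitz.State n),
      IsOpen V ∧ (0 : HopfLipschitz.State n) ∈ V ∧ V ⊆ U ∧ 0 < μ₀ ∧ 0 < a₀ ∧
      μ 0 = 0 ∧ ω' 0 = ω 0 ∧
      -- a family of periodic solutions, contained in `V`
      (∀ a ∈ Ico 0 a₀, |μ a| < μ₀ ∧ ω' a ≠ 0 ∧ (∀ t, u a t ∈ V) ∧
        HopfLipschitz.IsSolution (A (μ a)) G (u a) ∧
        Function.Periodic (u a) (2 * Real.pi / ω' a)) ∧
      -- the family bifurcates from the trivial solution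
      (∀ t, u 0 t = 0) ∧ (∀ a ∈ Ioo 0 a₀, ∀ t, u a t ≠ 0) ∧
      -- there are no other periodic solutions in `V`, up to a phase shift
      (∀ (m : ℝ) (w : ℝ → HopfLipschitz.State n), |m| < μ₀ →
        HopfLipschitz.IsSolution (A m) G w → HopfLipschitz.IsPeriodic w →
        (∀ t, w t ∈ V) → (∃ t, w t ≠ 0) →
        ∃ a ∈ Ioo 0 a₀, μ a = m ∧ ∃ τ : ℝ, ∀ t, w t = u a (t + τ)) ∧
      -- Lipschitz dependence of the solutions, uniformly on bounded time intervals
      (∀ T : ℝ, ∃ L : ℝ≥0, ∀ t : ℝ, |t| ≤ T → LipschitzOnWith L (fun a => u a t) (Ico 0 a₀)) ∧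
      -- regularity of the parameter and of the frequency along the branch
      ContinuousOn μ (Ico 0 a₀) ∧ ContinuousOn ω' (Ico 0 a₀) ∧
      LocallyLipschitzOn (Ioo 0 a₀) μ ∧ LocallyLipschitzOn (Ioo 0 a₀) ω' ∧
      (∃ C : ℝ, ∀ a ∈ Ico 0 a₀, |μ a| ≤ C * a ∧ |ω' a - ω 0| ≤ C * a) ∧
      (HopfLipschitz.LinearLipschitzConstant G →
        ∃ L : ℝ≥0, LipschitzOnWith L μ (Ico 0 a₀) ∧ LipschitzOnWith L ω' (Ico 0 a₀)) ∧
      -- the projection to the center eigenspace is `a exp(i ω' t) + o(a)`, uniformly in time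
      (∀ P : HopfLipschitz.State n →ₗ[ℝ] HopfLipschitz.State n,
        LinearMap.IsProj (HopfLipschitz.centerEigenspace (A 0) (ω 0)) P →
        ∀ ε : ℝ, 0 < ε → ∃ δ : ℝ, 0 < δ ∧ ∀ a ∈ Ico 0 a₀, a < δ → ∀ t : ℝ,
          ‖P (u a t) - HopfLipschitz.reVec n
            (((a : ℂ) * Complex.exp (Complex.I * (ω' a : ℂ) * (t : ℂ))) • q)‖ ≤ ε * a) ∧
      -- the distance from the center eigenspace is `O(a²)`, uniformly in time
      (∃ C : ℝ, ∀ a ∈ Ico 0 a₀, ∀ t : ℝ,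
        Metric.infDist (u a t)
          (HopfLipschitz.centerEigenspace (A 0) (ω 0) : Set (HopfLipschitz.State n))
          ≤ C * a ^ 2) := by
  obtain ⟨H, hHA, hHω, hHj⟩ := HopfLipschitz.exists_hopfData A ω hA hω hω0 hpair hsimple hhyp q hq0 hq
  obtain ⟨V, μ₀, a₀, μ, ω', u, hV, hV0, hVU, hμ₀, ha₀, hμ0, hω'0, hsol, hu0, hune, huniq, hlip,
    hμc, hω'c, hμl, hω'l, hC, hlin, C, hC0, hlead⟩ :=
    H.exists_bifurcating_family hU hU0 hGquad hGsmall
  simp only [hHA] at hsol huniq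
  simp only [hHω] at hω'0 hC
  have hjmem : ∀ ζ : ℂ, H.j ζ ∈ HopfLipschitz.centerEigenspace (A 0) (ω 0) := fun ζ => by
    rw [hHj]
    exact HopfLipschitz.reVec_smul_mem_centerEigenspace hq ζ
  have hja : ∀ (a t : ℝ), HopfLipschitz.reVec n
      (((a : ℂ) * Complex.exp (Complex.I * (ω' a : ℂ) * (t : ℂ))) • q) =
      a • H.j (Complex.exp (Complex.I * (ω' a : ℂ) * (t : ℂ))) := fun a t => by
    rw [← hHj, ← map_smul, Complex.real_smul]
  refine ⟨V, μ₀, a₀, μ, ω', u, hV, hV0, hVU, hμ₀, ha₀, hμ0, hω'0, hsol, hu0, hune, huniq, hlip,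
    hμc, hω'c, hμl, hω'l, hC, hlin, ?_, ?_⟩
  · intro P hP ε hε
    set P' := LinearMap.toContinuousLinearMap P with hP'
    -- P fixes the center motion, so its error is at most ‖P‖Ca²; the summand 1 keeps the
    -- denominator positive.
    refine ⟨ε / (‖P'‖ * C + 1), by positivity, fun a ha haδ t => ?_⟩
    have h1 : P (u a t) - a • H.j (Complex.exp (Complex.I * (ω' a : ℂ) * (t : ℂ))) =
        P' (u a t - a • H.j (Complex.exp (Complex.I * (ω' a : ℂ) * (t : ℂ)))) := by
      rw [map_sub]
      congr 1
      exact (hP.map_id _ (Submodule.smul_mem _ a (hjmem _))).symm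
    rw [hja, h1]
    have ha0 := ha.1
    have h2 : a * (‖P'‖ * C + 1) ≤ ε := ((lt_div_iff₀ (by positivity)).1 haδ).le
    calc _ ≤ ‖P'‖ * (C * a ^ 2) := (P'.le_opNorm _).trans (by gcongr; exact hlead a ha t)
      _ ≤ a * (‖P'‖ * C + 1) * a := by nlinarith [sq_nonneg a]
      _ ≤ ε * a := by gcongr
  · refine ⟨C, fun a ha t => (Metric.infDist_le_dist_of_mem
      (Submodule.smul_mem _ a (hjmem (Complex.exp (Complex.I * (ω' a : ℂ) * (t : ℂ)))))).trans ?_⟩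
    rw [dist_eq_norm]
    exact hlead a ha t
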